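/- Let $\mathcal M=(M,\mathcal O)$ be a compact smooth supermanifold of dimension $m|n$: $M$ is a compact Hausdorff smooth $m$-manifold and $\mathcal O$ is a sheaf of $\mathbb Z/2$-graded supercommutative real algebras on $M$ which is locally isomorphic to $C^\infty_M\otimes\Lambda_n$, where $\Lambda_n=\Lambda^\bullet(\mathbb R^n)$. Morphisms are smooth maps of the underlying manifolds together with grading-preserving morphisms of sheaves of algebras. Let $\mathcal J\subset\mathcal O$ be the ideal sheaf generated by the odd sections, let $\mathcal M/\mathcal J^2$ denote $M$ with the sheaf of $\mathbb Z/2$-graded algebras $\mathcal O/\mathcal J^2$, and put $G=\mathrm{Aut}(\mathcal M/\mathcal J^2)$. Let $\mathrm{Nil}_{\mathcal M}\subset\mathrm{Aut}(\mathcal M)$ be the subgroup of the automorphisms which induce the identity on $\mathcal M/\mathcal J^2$. A vector bundle associated with $\mathcal M$ is a pair $(E,\xi)$ of a smooth real vector bundle $E\to M$ of rank $n$ and a grading-preserving isomorphism $\xi\colon\Gamma(\Lambda^\bullet E)\to\mathcal O$ of sheaves of algebras covering $\mathrm{id}_M$. Then: 1. The presheaf $U\mapsto\mathcal O(U)/\mathcal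 J^2(U)$ is a sheaf, and the natural homomorphism $\pi\colon\mathrm{Aut}(\mathcal M)\to G$ gives an exact sequence $$1\longrightarrow\mathrm{Nil}_{\mathcal M}\longrightarrow\mathrm{Aut}(\mathcal M)\xrightarrow{\ \pi\ }G\longrightarrow1 .$$ 2. There is a vector bundle associated with $\mathcal M$. For every such pair $(E,\xi)$ there is exactly one homomorphism $\sigma_E\colon G\to\mathrm{Aut}(\mathcal M)$ with $\pi\circ\sigma_E=\mathrm{id}_G$ such that every $\sigma_E(g)$ corresponds under $\xi$ to the automorphism of $\Lambda^\bullet E$ determined by a vector bundle automorphism of $E$. If $G$ acts on $\mathrm{Nil}_{\mathcal M}$ by conjugation through $\sigma_E$, and $\mathrm{Nil}_{\mathcal M}\rtimes_E G$ is the corresponding semidirect product, then $(a,g)\mapsto a\,\sigma_E(g)$ is an isomorphism $\mathrm{Nil}_{\mathcal M}\rtimes_E G\cong\mathrm{Aut}(\mathcal M)$. 3. The splitting is not natural in $\mathcal M$: it is impossible to choose for every compact supermanifold $\mathcal M$ a homomorphism $\sigma_{\mathcal M}\colon\mathrm{Aut}(\mathcal M/\mathcal J^2)\to\mathrm{Aut}(\mathcal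 M)$ which is a section of $\pi$ in such a way that $\sigma_{\mathcal N}(\bar e\,g\,\bar e^{-1})=e\,\sigma_{\mathcal M}(g)\,e^{-1}$ for all isomorphisms $e\colon\mathcal M\to\mathcal N$ of supermanifolds, with induced isomorphism $\bar e\colon\mathcal M/\mathcal J^2\to\mathcal N/\mathcal J^2$, and all $g\in\mathrm{Aut}(\mathcal M/\mathcal J^2)$. -/

import Mathlib

open CategoryTheory Opposite TopologicalSpace Bundle
open scoped Manifold ContDiff

universe u

noncomputable section

/-! ### Presheaves of `ℤ/2`-graded algebras and the powers of the odd ideal -/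

/-- A presheaf of real associative unital algebras on `M` with designated submodules
`parity U 0` (even sections) and `parity U 1` (odd sections) over every open set `U`.
The laws of a sheaf of supercommutative superalgebras are stated in `IsSupermanifold`. -/
structure SuperPresheaf (M : Type u) [TopologicalSpace M] where
  presheaf : TopCat.Presheaf (AlgCat.{u} ℝ) (TopCat.of M)
  parity (U : Opens M) (i : ZMod 2) : Submodule ℝ (presheaf.obj (op U))
  map_parity : ∀ (U V : Opens M) (h : U ≤ V) (i : ZMod 2), ∀ s ∈ parity V i,
    (presheaf.map (homOfLE h).op).hom s ∈ parity U i

namespace SuperPresheaf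

variable {M : Type u} [TopologicalSpace M] (P : SuperPresheaf M)

/-- The algebra of sections over the open set `U`. -/
abbrev Sec (U : Opens M) : Type u := P.presheaf.obj (op U)

/-- Restriction of sections from `V` to `U ⊆ V`. -/
def res {U V : Opens M} (h : U ≤ V) : P.Sec V →ₐ[ℝ] P.Sec U :=
  (P.presheaf.map (homOfLE h).op).hom

theorem res_self {U : Opens M} (s : P.Sec U) : P.res le_rfl s = s :=
  congrArg (fun f => AlgCat.Hom.hom f s) (P.presheaf.map_id (op U))

theorem res_res {U V W : Opens M} (h : U ≤ V) (h' : V ≤ W) (s : P.Sec W) :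
    P.res h (P.res h' s) = P.res (h.trans h') s := by
  have := P.presheaf.map_comp (homOfLE h').op (homOfLE h).op
  exact (congrArg (fun f => AlgCat.Hom.hom f s) this).symm

/-- The two-sided ideal of the algebra of sections over `U` generated by the odd sections. -/
def oddIdeal (U : Opens M) : TwoSidedIdeal (P.Sec U) :=
  TwoSidedIdeal.span (P.parity U 1 : Set (P.Sec U))

/-- The `k`-th power of `oddIdeal`, i.e. the two-sided ideal generated by all `k`-fold
products of its elements. -/
def oddIdealPow (k : ℕ) (U : Opens M) : TwoSidedIdeal (P.Sec U) :=
  TwoSidedIdeal.span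
    {a | ∃ l : List (P.Sec U), l.length = k ∧ (∀ b ∈ l, b ∈ P.oddIdeal U) ∧ l.prod = a}

/-- An algebra map which sends odd elements to odd elements respects the
powers of the ideal generated by the odd elements. -/
theorem span_pow_le {A B : Type*} [Ring A] [Ring B] (f : A →+* B) (SA : Set A) (SB : Set B)
    (h : ∀ a ∈ SA, f a ∈ SB) (k : ℕ) (a : A)
    (ha : a ∈ TwoSidedIdeal.span {a : A | ∃ l : List A, l.length = k ∧
      (∀ b ∈ l, b ∈ TwoSidedIdeal.span SA) ∧ l.prod = a}) :
    f a ∈ TwoSidedIdeal.span {a : B | ∃ l : List B, l.length = k ∧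
      (∀ b ∈ l, b ∈ TwoSidedIdeal.span SB) ∧ l.prod = a} := by
  have h1 : ∀ b ∈ TwoSidedIdeal.span SA, f b ∈ TwoSidedIdeal.span SB := by
    intro b hb
    have : TwoSidedIdeal.span SA ≤ TwoSidedIdeal.comap f (TwoSidedIdeal.span SB) := by
      rw [TwoSidedIdeal.span_le]
      intro x hx
      exact (TwoSidedIdeal.mem_comap f).2 (TwoSidedIdeal.subset_span (h x hx))
    exact (TwoSidedIdeal.mem_comap f).1 (this hb)
  refine (TwoSidedIdeal.mem_comap f).1 ((TwoSidedIdeal.span_le (I := TwoSidedIdeal.comap f _)).2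
    ?_ ha)
  rintro _ ⟨l, hl, hb, rfl⟩
  refine (TwoSidedIdeal.mem_comap f).2 (TwoSidedIdeal.subset_span ⟨l.map f, by simpa using hl, ?_,
    (map_list_prod f l).symm⟩)
  intro b hb'
  obtain ⟨c, hc, rfl⟩ := List.mem_map.1 hb'
  exact h1 c (hb c hc)

theorem res_mem_oddIdealPow (k : ℕ) {U V : Opens M} (h : U ≤ V) (s : P.Sec V)
    (hs : s ∈ P.oddIdealPow k V) : P.res h s ∈ P.oddIdealPow k U :=
  span_pow_le (P.res h).toRingHom _ _ (fun a ha => P.map_parity U V h 1 a ha) k s hs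

/-- The sections over `U` of the `k`-th power `J ^ k` of the ideal sheaf `J` generated by the odd
sections: those sections which locally lie in the `k`-th power of the ideal generated by the odd
sections. -/
def nilIdeal (k : ℕ) (U : Opens M) : Ideal (P.Sec U) where
  carrier := {s | ∀ x ∈ U, ∃ V : Opens M, x ∈ V ∧ ∃ h : V ≤ U, P.res h s ∈ P.oddIdealPow k V}
  zero_mem' := fun x hx => ⟨U, hx, le_rfl, by rw [map_zero]; exact TwoSidedIdeal.zero_mem _⟩
  add_mem' := by
    intro a b ha hb x hx
    obtain ⟨V, hxV, hV, h1⟩ := ha x hx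
    obtain ⟨V', hxV', hV', h2⟩ := hb x hx
    refine ⟨V ⊓ V', ⟨hxV, hxV'⟩, inf_le_left.trans hV, ?_⟩
    rw [map_add]
    refine TwoSidedIdeal.add_mem _ ?_ ?_
    · simpa only [res_res] using P.res_mem_oddIdealPow k (inf_le_left : V ⊓ V' ≤ V) _ h1
    · simpa only [res_res] using P.res_mem_oddIdealPow k (inf_le_right : V ⊓ V' ≤ V') _ h2
  smul_mem' := by
    intro c a ha x hx
    obtain ⟨V, hxV, hV, h1⟩ := ha x hx
    refine ⟨V, hxV, hV, ?_⟩
    rw [smul_eq_mul, map_mul]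
    exact TwoSidedIdeal.mul_mem_left _ _ _ h1

instance (k : ℕ) (U : Opens M) : (P.nilIdeal k U).IsTwoSided where
  mul_mem_of_left := by
    intro a b ha x hx
    obtain ⟨V, hxV, hV, h1⟩ := ha x hx
    refine ⟨V, hxV, hV, ?_⟩
    rw [map_mul]
    exact TwoSidedIdeal.mul_mem_right _ _ _ h1

theorem res_mem_nilIdeal (k : ℕ) {U V : Opens M} (h : U ≤ V) (s : P.Sec V)
    (hs : s ∈ P.nilIdeal k V) : P.res h s ∈ P.nilIdeal k U := by
  intro x hx
  obtain ⟨V', hxV, hV, h1⟩ := hs x (h hx)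
  refine ⟨V' ⊓ U, ⟨hxV, hx⟩, inf_le_right, ?_⟩
  rw [res_res]
  simpa only [res_res] using P.res_mem_oddIdealPow k (inf_le_left : V' ⊓ U ≤ V') _ h1

/-- The algebra `O(U) / J ^ k (U)`. -/
abbrev QuotSec (k : ℕ) (U : Opens M) : Type u := P.Sec U ⧸ P.nilIdeal k U

/-- The quotient map `O(U) → O(U) / J ^ k (U)`. -/
def quotMk (k : ℕ) (U : Opens M) : P.Sec U →ₐ[ℝ] P.QuotSec k U :=
  Ideal.Quotient.mkₐ ℝ (P.nilIdeal k U)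

theorem quotMk_surjective (k : ℕ) (U : Opens M) : Function.Surjective (P.quotMk k U) :=
  Ideal.Quotient.mk_surjective

/-- Restriction in the quotient `O / J ^ k`. -/
def quotRes (k : ℕ) {U V : Opens M} (h : U ≤ V) : P.QuotSec k V →ₐ[ℝ] P.QuotSec k U :=
  Ideal.quotientMapₐ (P.nilIdeal k U) (P.res h) (fun s hs => P.res_mem_nilIdeal k h s hs)

theorem quotRes_mk (k : ℕ) {U V : Opens M} (h : U ≤ V) (s : P.Sec V) :
    P.quotRes k h (P.quotMk k V s) = P.quotMk k U (P.res h s) := rfl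

/-- The quotient `U ↦ O(U) / J ^ k (U)`, with even and odd parts the images of the even and odd
parts of `O(U)`. -/
def quot (k : ℕ) : SuperPresheaf M where
  presheaf :=
    { obj := fun U => AlgCat.of ℝ (P.QuotSec k U.unop)
      map := fun i => AlgCat.ofHom (P.quotRes k i.unop.le)
      map_id := by
        intro U
        ext s
        obtain ⟨s, rfl⟩ := P.quotMk_surjective k U.unop s
        exact congrArg (P.quotMk k U.unop) (P.res_self s)
      map_comp := by
        intro U V W i j
        ext s
        obtain ⟨s, rfl⟩ := P.quotMk_surjective k U.unop s
        exact congrArg (P.quotMk k W.unop) (P.res_res j.unop.le i.unop.le s).symm }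
  parity U i := (P.parity U i).map (P.quotMk k U).toLinearMap
  map_parity := by
    rintro U V h i _ ⟨s, hs, rfl⟩
    exact ⟨P.res h s, P.map_parity U V h i s hs, rfl⟩

variable {P}

/-- An isomorphism between `P|_U` and `Q|_U` of presheaves of superalgebras, covering the
identity of the open set `U`. -/
structure IsoOn (P Q : SuperPresheaf M) (U : Opens M) where
  equiv (V : Opens M) (hV : V ≤ U) : P.Sec V ≃ₐ[ℝ] Q.Sec V
  equiv_res : ∀ (V W : Opens M) (h : V ≤ W) (hW : W ≤ U) (s : P.Sec W),
    equiv V (h.trans hW) (P.res h s) = Q.res h (equiv W hW s)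
  parity_iff : ∀ (V : Opens M) (hV : V ≤ U) (i : ZMod 2) (s : P.Sec V),
    equiv V hV s ∈ Q.parity V i ↔ s ∈ P.parity V i

end SuperPresheaf

/-! ### Smooth vector bundles and the sheaf of sections of the exterior algebra bundle -/

/-- A smooth real vector bundle of rank `n` over the smooth `m`-manifold `M`. -/
structure SmoothVectorBundle (m n : ℕ) (M : Type u) [TopologicalSpace M]
    [ChartedSpace (EuclideanSpace ℝ (Fin m)) M] where
  fiber : M → Type
  [addCommGroup : ∀ x, AddCommGroup (fiber x)]
  [module : ∀ x, Module ℝ (fiber x)]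
  [topologicalSpace : ∀ x, TopologicalSpace (fiber x)]
  [totalTopology : TopologicalSpace (TotalSpace (EuclideanSpace ℝ (Fin n)) fiber)]
  [fiberBundle : FiberBundle (EuclideanSpace ℝ (Fin n)) fiber]
  [vectorBundle : VectorBundle ℝ (EuclideanSpace ℝ (Fin n)) fiber]
  [contMDiffVectorBundle :
    ContMDiffVectorBundle ∞ (EuclideanSpace ℝ (Fin n)) fiber (𝓡 m)]

namespace SmoothVectorBundle

attribute [instance] addCommGroup module topologicalSpace totalTopology fiberBundle
  vectorBundle contMDiffVectorBundle

variable {m n : ℕ} {M : Type u} [TopologicalSpace M]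
  [ChartedSpace (EuclideanSpace ℝ (Fin m)) M]

/-- The product bundle `M × ℝⁿ`. -/
def trivial (m n : ℕ) (M : Type u) [TopologicalSpace M]
    [ChartedSpace (EuclideanSpace ℝ (Fin m)) M] : SmoothVectorBundle m n M where
  fiber := Bundle.Trivial M (EuclideanSpace ℝ (Fin n))

variable (E : SmoothVectorBundle m n M)

/-- The total space of `E`. -/
abbrev Total : Type u := TotalSpace (EuclideanSpace ℝ (Fin n)) E.fiber

/-- The expression in `Λ ℝⁿ`, through the preferred trivialization of `E` at `x₀`, of an element
of the exterior algebra of the fibre at `x`. -/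
def extCoord (x₀ x : M) : ExteriorAlgebra ℝ (E.fiber x) →ₐ[ℝ]
    ExteriorAlgebra ℝ (EuclideanSpace ℝ (Fin n)) :=
  ExteriorAlgebra.map
    ((trivializationAt (EuclideanSpace ℝ (Fin n)) E.fiber x₀).linearMapAt ℝ x)

/-- A section over `U` of the exterior algebra bundle of `E` is smooth if, in the local
trivializations of `E`, all its coordinates in the finite-dimensional space `Λ ℝⁿ` are smooth. -/
def IsSmoothExt {U : Opens M} (s : ∀ x : U, ExteriorAlgebra ℝ (E.fiber x)) : Prop :=
  ∀ (x₀ : U) (l : Module.Dual ℝ (ExteriorAlgebra ℝ (EuclideanSpace ℝ (Fin n)))),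
    ContMDiffAt (𝓡 m) 𝓘(ℝ, ℝ) ∞ (fun x : U => l (E.extCoord x₀ x (s x))) x₀

/-- The algebra `Γ(U, Λ E)` of smooth sections over `U` of the exterior algebra bundle. -/
def extAlgebra (U : Opens M) :
    Subalgebra ℝ (∀ x : U, ExteriorAlgebra ℝ (E.fiber x)) where
  carrier := {s | E.IsSmoothExt s}
  add_mem' := by
    intro a b ha hb x₀ l
    have h := (ha x₀ l).add (hb x₀ l)
    refine h.congr_of_eventuallyEq (Filter.Eventually.of_forall fun x => ?_)
    simp only [Pi.add_apply, map_add]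
  mul_mem' := by
    intro a b ha hb x₀ l
    let B := (EuclideanSpace.basisFun (Fin n) ℝ).toBasis.ExteriorAlgebra
    have key : ∀ p q : ExteriorAlgebra ℝ (EuclideanSpace ℝ (Fin n)),
        l (p * q) = ∑ i, ∑ j, B.coord i p * B.coord j q * l (B i * B j) := by
      intro p q
      conv_lhs => rw [← B.sum_repr p, ← B.sum_repr q, Finset.sum_mul_sum, map_sum]
      refine Finset.sum_congr rfl fun i _ => ?_
      rw [map_sum]
      refine Finset.sum_congr rfl fun j _ => ?_
      rw [smul_mul_smul_comm, map_smul, smul_eq_mul]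
      rfl
    have h : ContMDiffAt (𝓡 m) 𝓘(ℝ, ℝ) ∞ (fun x : U => ∑ i, ∑ j,
        B.coord i (E.extCoord x₀ x (a x)) * B.coord j (E.extCoord x₀ x (b x)) *
          l (B i * B j)) x₀ :=
      ContMDiffAt.sum fun i _ => ContMDiffAt.sum fun j _ =>
        ((ha x₀ (B.coord i)).mul (hb x₀ (B.coord j))).mul contMDiffAt_const
    refine h.congr_of_eventuallyEq (Filter.Eventually.of_forall fun x => ?_)
    exact (congrArg l (map_mul (E.extCoord x₀ x) (a x) (b x))).trans (key _ _)
  algebraMap_mem' := by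
    intro r x₀ l
    simp only [Pi.algebraMap_apply, AlgHom.commutes]
    exact contMDiffAt_const

theorem restrict_mem {U V : Opens M} (h : U ≤ V) (s : E.extAlgebra V) :
    (fun x : U => s.1 ⟨x.1, h x.2⟩) ∈ E.extAlgebra U := by
  intro x₀ l
  have h1 : ContMDiff (𝓡 m) (𝓡 m) ∞ (Opens.inclusion h) := contMDiff_inclusion h
  have h2 := s.2 ⟨x₀.1, h x₀.2⟩ l
  exact ContMDiffAt.comp (I' := 𝓡 m) (f := Opens.inclusion h)
    (g := fun x : V => l (E.extCoord x₀ x (s.1 x))) x₀ h2 (h1 x₀)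

/-- Restriction of smooth sections of the exterior algebra bundle. -/
def restrict {U V : Opens M} (h : U ≤ V) : E.extAlgebra V →ₐ[ℝ] E.extAlgebra U where
  toFun s := ⟨fun x : U => s.1 ⟨x.1, h x.2⟩, E.restrict_mem h s⟩
  map_one' := rfl
  map_mul' _ _ := rfl
  map_zero' := rfl
  map_add' _ _ := rfl
  commutes' _ := rfl

/-- The sheaf `Γ(Λ E)` of smooth sections of the exterior algebra bundle of `E`, graded by the
parity of the exterior degree. For the product bundle `M × ℝⁿ` this is `C^∞_M ⊗ Λₙ`. -/
def extSheaf : SuperPresheaf M where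
  presheaf :=
    { obj := fun U => AlgCat.of ℝ (E.extAlgebra U.unop)
      map := fun i => AlgCat.ofHom (E.restrict i.unop.le)
      map_id := fun _ => rfl
      map_comp := fun _ _ => rfl }
  parity U i :=
    { carrier := {s : E.extAlgebra U | ∀ x : U,
        s.1 x ∈ CliffordAlgebra.evenOdd (0 : QuadraticForm ℝ (E.fiber x)) i}
      add_mem' := fun ha hb x => Submodule.add_mem _ (ha x) (hb x)
      zero_mem' := fun _ => Submodule.zero_mem _
      smul_mem' := fun c _ ha x => Submodule.smul_mem _ c (ha x) }
  map_parity := fun _ _ h _ _ hs x => hs ⟨x.1, h x.2⟩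

/-- A vector bundle automorphism of `E` covering the map `f : M → M`: a fibrewise linear
diffeomorphism of the total space. -/
structure AutOver (f : M → M) where
  fiberEquiv (x : M) : E.fiber x ≃ₗ[ℝ] E.fiber (f x)
  total : E.Total ≃ₘ^∞⟮(𝓡 m).prod 𝓘(ℝ, EuclideanSpace ℝ (Fin n)),
    (𝓡 m).prod 𝓘(ℝ, EuclideanSpace ℝ (Fin n))⟯ E.Total
  total_mk : ∀ (x : M) (v : E.fiber x), total ⟨x, v⟩ = ⟨f x, fiberEquiv x v⟩

end SmoothVectorBundle

/-! ### Supermanifolds -/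

/-- A space with charts in `ℝᵐ` carrying a presheaf of `ℤ/2`-graded algebras. Both supermanifolds
and their quotients by powers of the odd ideal are objects of this kind. -/
structure SuperSpace (m : ℕ) where
  carrier : Type u
  [top : TopologicalSpace carrier]
  [charted : ChartedSpace (EuclideanSpace ℝ (Fin m)) carrier]
  O : SuperPresheaf carrier

namespace SuperSpace

variable {m : ℕ}

attribute [instance] top charted

/-- The underlying presheafed space. -/
def toPresheafed (X : SuperSpace.{u} m) : AlgebraicGeometry.PresheafedSpace (AlgCat.{u} ℝ) :=
  ⟨TopCat.of X.carrier, X.O.presheaf⟩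

/-- The map of underlying spaces of a morphism of presheafed spaces. -/
def baseMap {X Y : SuperSpace.{u} m} (f : X.toPresheafed ⟶ Y.toPresheafed) :
    X.carrier → Y.carrier := fun x => f.base x

/-- The preimage of an open set under a morphism of presheafed spaces. -/
def preimageOf {X Y : SuperSpace.{u} m} (f : X.toPresheafed ⟶ Y.toPresheafed)
    (U : Opens Y.carrier) : Opens X.carrier := (Opens.map f.base).obj U

/-- The action of a morphism on sections, `O_Y(U) → O_X(f⁻¹ U)`. -/
def pullbackOf {X Y : SuperSpace.{u} m} (f : X.toPresheafed ⟶ Y.toPresheafed)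
    (U : Opens Y.carrier) : Y.O.Sec U →ₐ[ℝ] X.O.Sec (preimageOf f U) :=
  (f.c.app (op U)).hom

/-- A morphism consists of a smooth map of the underlying spaces and a morphism of presheaves of
algebras over it which preserves the `ℤ/2`-grading. -/
@[ext]
structure Hom (X Y : SuperSpace.{u} m) where
  hom : X.toPresheafed ⟶ Y.toPresheafed
  smooth : ContMDiff (𝓡 m) (𝓡 m) ∞ (baseMap hom)
  map_parity : ∀ (U : Opens Y.carrier) (i : ZMod 2) (s : Y.O.Sec U), s ∈ Y.O.parity U i →
    pullbackOf hom U s ∈ X.O.parity (preimageOf hom U) i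

/-- The identity morphism. -/
def Hom.id (X : SuperSpace.{u} m) : Hom X X where
  hom := 𝟙 _
  smooth := contMDiff_id
  map_parity := fun _ _ _ hs => hs

/-- Composition of morphisms. -/
def Hom.comp {X Y Z : SuperSpace.{u} m} (f : Hom X Y) (g : Hom Y Z) : Hom X Z where
  hom := f.hom ≫ g.hom
  smooth := g.smooth.comp f.smooth
  map_parity := fun U i s hs => f.map_parity _ i _ (g.map_parity U i s hs)

instance : Category (SuperSpace.{u} m) where
  Hom := Hom
  id := Hom.id
  comp := Hom.comp
  id_comp f := Hom.ext (Category.id_comp (Hom.hom f))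
  comp_id f := Hom.ext (Category.comp_id (Hom.hom f))
  assoc f g h := Hom.ext (Category.assoc (Hom.hom f) (Hom.hom g) (Hom.hom h))

variable {X Y : SuperSpace.{u} m}

theorem pullbackOf_res (f : X.toPresheafed ⟶ Y.toPresheafed) {U V : Opens Y.carrier} (h : U ≤ V)
    (s : Y.O.Sec V) : pullbackOf f U (Y.O.res h s) =
      X.O.res (U := preimageOf f U) (V := preimageOf f V) (fun _ hx => h hx) (pullbackOf f V s) :=
  congrArg (fun g => AlgCat.Hom.hom g s) (f.c.naturality (homOfLE h).op)

theorem Hom.pullback_mem_nilIdeal (f : Hom X Y) (k : ℕ) {U : Opens Y.carrier} (s : Y.O.Sec U)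
    (hs : s ∈ Y.O.nilIdeal k U) : pullbackOf f.hom U s ∈ X.O.nilIdeal k (preimageOf f.hom U) := by
  intro x hx
  obtain ⟨V, hxV, hV, h1⟩ := hs (baseMap f.hom x) hx
  refine ⟨preimageOf f.hom V, hxV, fun _ hx => hV hx, ?_⟩
  rw [← pullbackOf_res]
  exact SuperPresheaf.span_pow_le (pullbackOf f.hom V).toRingHom _ _
    (fun a ha => f.map_parity V 1 a ha) k _ h1

/-- The space `X / J ^ k`: the same underlying space, with `O` replaced by `O / J ^ k`. -/
def modPow (k : ℕ) (X : SuperSpace.{u} m) : SuperSpace.{u} m where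
  carrier := X.carrier
  O := X.O.quot k

/-- The action of a morphism on sections of `O / J ^ k`. -/
def Hom.quotPullback (f : Hom X Y) (k : ℕ) (U : Opens Y.carrier) :
    Y.O.QuotSec k U →ₐ[ℝ] X.O.QuotSec k (preimageOf f.hom U) :=
  Ideal.quotientMapₐ (X.O.nilIdeal k (preimageOf f.hom U)) (pullbackOf f.hom U)
    (fun s hs => f.pullback_mem_nilIdeal k s hs)

/-- The morphism `X / J ^ k ⟶ Y / J ^ k` induced by a morphism `X ⟶ Y`. -/
def Hom.modPow (f : Hom X Y) (k : ℕ) : Hom (X.modPow k) (Y.modPow k) where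
  hom :=
    { base := f.hom.base
      c :=
        { app := fun U => AlgCat.ofHom (f.quotPullback k U.unop)
          naturality := by
            intro U V i
            ext s
            obtain ⟨s, rfl⟩ := Y.O.quotMk_surjective k U.unop s
            exact congrArg (X.O.quotMk k (preimageOf f.hom V.unop))
              (pullbackOf_res f.hom i.unop.le s) } }
  smooth := f.smooth
  map_parity := by
    rintro U i _ ⟨s, hs, rfl⟩
    exact ⟨pullbackOf f.hom U s, f.map_parity U i s hs, rfl⟩

/-- The functor `X ↦ X / J ^ k`. -/
def modPowFunctor (m k : ℕ) : SuperSpace.{u} m ⥤ SuperSpace.{u} m where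
  obj X := X.modPow k
  map f := Hom.modPow f k
  map_id X := by
    refine Hom.ext (AlgebraicGeometry.PresheafedSpace.hext _ _ rfl (heq_of_eq ?_))
    ext U s
    obtain ⟨s, rfl⟩ := X.O.quotMk_surjective k U s
    rfl
  map_comp {X Y Z} f g := by
    refine Hom.ext (AlgebraicGeometry.PresheafedSpace.hext _ _ rfl (heq_of_eq ?_))
    ext U s
    obtain ⟨s, rfl⟩ := Z.O.quotMk_surjective k U s
    rfl

/-- The natural homomorphism `Aut(X) → Aut(X / J ^ k)`. -/
def autModPow (X : SuperSpace.{u} m) (k : ℕ) : Aut X →* Aut (X.modPow k) :=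
  (modPowFunctor m k).mapAut X

/-- `Nil_X^(k)`: the subgroup of the automorphisms of `X` which induce the identity on
`X / J ^ k`. -/
def nilAut (X : SuperSpace.{u} m) (k : ℕ) : Subgroup (Aut X) := (X.autModPow k).ker

instance (X : SuperSpace.{u} m) (k : ℕ) : (X.nilAut k).Normal :=
  MonoidHom.normal_ker _

/-- `X` is a smooth supermanifold of dimension `m|n`: a smooth `m`-manifold (Hausdorff and second
countable) with a sheaf of supercommutative superalgebras which is locally isomorphic to
`C^∞ ⊗ Λₙ`. -/
class IsSupermanifold (n : ℕ) (X : SuperSpace.{u} m) : Prop where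
  isManifold : IsManifold (𝓡 m) ∞ X.carrier
  t2 : T2Space X.carrier
  secondCountable : SecondCountableTopology X.carrier
  isSheaf : X.O.presheaf.IsSheaf
  gradedMonoid : ∀ U : Opens X.carrier, SetLike.GradedMonoid (X.O.parity U)
  isInternal : ∀ U : Opens X.carrier, DirectSum.IsInternal (X.O.parity U)
  supercomm : ∀ (U : Opens X.carrier) (i j : ZMod 2) (a b : X.O.Sec U), a ∈ X.O.parity U i →
    b ∈ X.O.parity U j → a * b = (-1 : ℝ) ^ (i.val * j.val) • (b * a)
  locally_split : ∀ x : X.carrier, ∃ U : Opens X.carrier, x ∈ U ∧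
    Nonempty (SuperPresheaf.IsoOn (SmoothVectorBundle.trivial m n X.carrier).extSheaf X.O U)

/-- A vector bundle associated with `X`: a smooth vector bundle `E` of rank `n` over the
underlying manifold, with an isomorphism `ξ : Γ(Λ E) ≅ O` of sheaves of superalgebras covering the
identity. In particular `ξ` induces an isomorphism `Γ(E) ≅ J / J ^ 2`. -/
structure AssociatedBundle (n : ℕ) (X : SuperSpace.{u} m) where
  E : SmoothVectorBundle m n X.carrier
  ξ : SuperPresheaf.IsoOn E.extSheaf X.O ⊤

/-- The automorphism `a` of `X` corresponds under `ξ : Γ(Λ E) ≅ O` to the automorphism of `Γ(Λ E)`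
determined by a vector bundle automorphism `φ` of `E` covering the base map `f` of `a`, namely
`(a^* s)(x) = Λ(φ_x⁻¹) (s (f x))`. -/
def AssociatedBundle.IsInduced {n : ℕ} {X : SuperSpace.{u} m} (A : X.AssociatedBundle n)
    (a : Aut X) : Prop :=
  ∃ φ : A.E.AutOver (baseMap (Hom.hom a.hom)),
    ∀ (U : Opens X.carrier) (s : A.E.extAlgebra U) (x : preimageOf (Hom.hom a.hom) U),
      ((A.ξ.equiv (preimageOf (Hom.hom a.hom) U) le_top).symm
        (pullbackOf (Hom.hom a.hom) U (A.ξ.equiv U le_top s)) :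
          A.E.extAlgebra (preimageOf (Hom.hom a.hom) U)).1 x =
      ExteriorAlgebra.map (φ.fiberEquiv x.1).symm.toLinearMap
        (s.1 ⟨baseMap (Hom.hom a.hom) x.1, x.2⟩)

/-- The isomorphism `X / J ^ k ≅ Y / J ^ k` induced by an isomorphism `X ≅ Y`. -/
def isoModPow {X Y : SuperSpace.{u} m} (e : X ≅ Y) (k : ℕ) : X.modPow k ≅ Y.modPow k :=
  (modPowFunctor m k).mapIso e

end SuperSpace

end

/-! The whole proof rests on a grading operator. On `Λ V` the Euler derivation multiplies degree `k`
by `k`. A supermanifold has only the filtration by powers of `J`, but an even derivation `D` that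
acts as `k` on `J^k / J^(k+1)` is enough to recover a grading. Derivations with this symbol form an
affine space over the functions, so the local Euler operators can be averaged with a partition of
unity (`IsSupermanifold.exists_euler`).

Because the filtration is finite, `D` is annihilated by `∏ (X - k)` for `0 ≤ k ≤ n`, hence is
diagonalizable. An eigenvector of eigenvalue `k` lies in `F k` and is determined by its class modulo
`F (k + 1)`. Therefore the map `eulerConj` that matches the eigenspaces of two such derivations is
an algebra automorphism (`IsEuler.eulerConj_mul`). Composed with it, every chart turns the standard
Euler operator into `D` (`IsoOn.exists_graded`). The transition maps then preserve exterior degree,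
so they are `Λ` of a smooth linear cocycle (`GradedAtlas.eval_change`); the bundle of this cocycle
is an associated bundle `E`.

A section of `O / J^2` is a function together with a section of `E`; these are the coordinates `aug`
and `lin`. An endomorphism of `M / J^2` pulls functions back along its base map and acts on the
linear part fibrewise, by linear maps `E_(f x) → E_x` (`AssociatedBundle.lin_pull`). Applying `Λ` to
these maps yields a lift to `M`, functorial in the endomorphism, which gives the splitting and
surjectivity of `π`. Uniqueness holds because an automorphism induced by a bundle automorphism is
`Λ` of its degree-one part, which is visible modulo `J^2`
(`AssociatedBundle.eq_splitting_of_isInduced`). The semidirect product is then formal.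

Naturality already fails for the superpoint `Λ₃`. The shear `θ ↦ θ + f(θ) w`, with `w` of top
degree, is trivial modulo `J^2`, so a natural section would take values commuting with it. A lift of
the scaling by `2` multiplies `w` by `8` but a generator by `2` modulo higher terms, so it cannot
commute with the shear (`ExteriorAlgebra.eq_zero_of_shear_comm`). -/

noncomputable section

/-! ### Euler operators on filtered algebras -/

/-- A decreasing multiplicative filtration of an algebra with `F 0 = ⊤` and `F (n + 1) = ⊥`. -/
structure IsNilFiltration {A : Type*} [Ring A] [Algebra ℝ A] (n : ℕ)
    (F : ℕ → Submodule ℝ A) : Prop where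
  anti : Antitone F
  zero : F 0 = ⊤
  last : F (n + 1) = ⊥
  mul : ∀ {k l : ℕ} {a b : A}, a ∈ F k → b ∈ F l → a * b ∈ F (k + l)

/-- A derivation which acts on `F k / F (k + 1)` as multiplication by `k`. -/
structure IsEuler {A : Type*} [Ring A] [Algebra ℝ A] (F : ℕ → Submodule ℝ A)
    (D : Module.End ℝ A) : Prop where
  leibniz : ∀ a b, D (a * b) = D a * b + a * D b
  symbol : ∀ {k : ℕ} {a : A}, a ∈ F k → D a - (k : ℝ) • a ∈ F (k + 1)

/-- The projection to the eigenspace of eigenvalue `k`, for an operator with eigenvalues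
`0, …, n`. -/
def eulerProj {A : Type*} [AddCommGroup A] [Module ℝ A] (n k : ℕ) (D : Module.End ℝ A) :
    Module.End ℝ A :=
  Polynomial.aeval D (Lagrange.basis (Finset.range (n + 1)) (fun i : ℕ => (i : ℝ)) k)

/-- The operator which identifies the eigenspaces of `D₁` with those of `D₂`. -/
def eulerConj {A : Type*} [AddCommGroup A] [Module ℝ A] (n : ℕ) (D₁ D₂ : Module.End ℝ A) :
    Module.End ℝ A :=
  ∑ k ∈ Finset.range (n + 1), eulerProj n k D₂ * eulerProj n k D₁

/-- The spectral projections are polynomials in the derivation, so any map intertwining two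
derivations intertwines their projections. With `r` a restriction map, this makes chartwise
conjugations compatible with restriction. -/
theorem aeval_comm_of_comm {A B : Type*} [AddCommGroup A] [Module ℝ A] [AddCommGroup B]
    [Module ℝ B] {D : Module.End ℝ A} {D' : Module.End ℝ B} (r : A →ₗ[ℝ] B)
    (h : ∀ a, r (D a) = D' (r a)) (p : Polynomial ℝ) (a : A) :
    r (Polynomial.aeval D p a) = Polynomial.aeval D' p (r a) := by
  induction p using Polynomial.induction_on generalizing a with
  | C c => simp
  | add p q hp hq => simp [hp, hq]
  | monomial k c ih =>
    rw [pow_succ, ← mul_assoc, map_mul (Polynomial.aeval D) (_ * _), Module.End.mul_apply, ih,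
      map_mul (Polynomial.aeval D') (_ * _), Module.End.mul_apply, Polynomial.aeval_X,
      Polynomial.aeval_X, h]

theorem aeval_X_sub_C_apply {A : Type*} [AddCommGroup A] [Module ℝ A] (D : Module.End ℝ A)
    (c : ℝ) (a : A) :
    Polynomial.aeval D (Polynomial.X - Polynomial.C c) a = D a - c • a := by
  rw [map_sub, Polynomial.aeval_X, Polynomial.aeval_C, LinearMap.sub_apply,
    Module.algebraMap_end_apply]

theorem eulerConj_comm {A B : Type*} [AddCommGroup A] [Module ℝ A] [AddCommGroup B]
    [Module ℝ B] {n : ℕ} {D₁ D₂ : Module.End ℝ A} {D₁' D₂' : Module.End ℝ B} (r : A →ₗ[ℝ] B)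
    (h₁ : ∀ a, r (D₁ a) = D₁' (r a)) (h₂ : ∀ a, r (D₂ a) = D₂' (r a)) (a : A) :
    r (eulerConj n D₁ D₂ a) = eulerConj n D₁' D₂' (r a) := by
  simp only [eulerConj, LinearMap.sum_apply, map_sum, Module.End.mul_apply, eulerProj,
    aeval_comm_of_comm r h₁, aeval_comm_of_comm r h₂]

theorem aeval_mem_of_stable {A : Type*} [AddCommGroup A] [Module ℝ A] {D : Module.End ℝ A}
    {S : Submodule ℝ A} (h : ∀ a ∈ S, D a ∈ S) (p : Polynomial ℝ) {a : A} (ha : a ∈ S) :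
    Polynomial.aeval D p a ∈ S := by
  induction p using Polynomial.induction_on generalizing a with
  | C c => simpa using S.smul_mem c ha
  | add p q hp hq => simpa using S.add_mem (hp ha) (hq ha)
  | monomial k c ih =>
    rw [pow_succ, ← mul_assoc, map_mul, Module.End.mul_apply]
    exact ih (by simpa using h a ha)

/-- Used with `S` the even or the odd part, so that conjugation respects parity. -/
theorem eulerConj_mem_of_stable {A : Type*} [AddCommGroup A] [Module ℝ A] {n : ℕ}
    {D₁ D₂ : Module.End ℝ A} {S : Submodule ℝ A} (h₁ : ∀ a ∈ S, D₁ a ∈ S)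
    (h₂ : ∀ a ∈ S, D₂ a ∈ S) {a : A} (ha : a ∈ S) : eulerConj n D₁ D₂ a ∈ S := by
  rw [eulerConj, LinearMap.sum_apply]
  exact S.sum_mem fun k _ => aeval_mem_of_stable h₂ _ (aeval_mem_of_stable h₁ _ ha)

namespace IsEuler

variable {A : Type*} [Ring A] [Algebra ℝ A] {n : ℕ} {F : ℕ → Submodule ℝ A}
  {D D₁ D₂ : Module.End ℝ A}

theorem mem_of_mem (hF : IsNilFiltration n F) (hD : IsEuler F D) {k : ℕ} {a : A}
    (ha : a ∈ F k) : D a ∈ F k := by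
  have := (F k).add_mem (hF.anti k.le_succ (hD.symbol ha)) ((F k).smul_mem (k : ℝ) ha)
  simpa using this

/-- On `F k / F (k + 1)` the operator `D` is the scalar `k`, so `p(D)` is the scalar `p(k)`. -/
theorem aeval_symbol (hF : IsNilFiltration n F) (hD : IsEuler F D) (p : Polynomial ℝ) {k : ℕ}
    {a : A} (ha : a ∈ F k) :
    Polynomial.aeval D p a - p.eval (k : ℝ) • a ∈ F (k + 1) := by
  induction p using Polynomial.induction_on generalizing a with
  | C c => simp
  | add p q hp hq =>
    have := (F (k + 1)).add_mem (hp ha) (hq ha)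
    simp only [map_add, LinearMap.add_apply, Polynomial.eval_add, add_smul]
    convert this using 1
    abel
  | monomial j c ih =>
    have h1 := ih (hD.mem_of_mem hF ha)
    have h2 := (F (k + 1)).smul_mem (c * (k : ℝ) ^ j) (hD.symbol ha)
    have := (F (k + 1)).add_mem h1 h2
    rw [pow_succ, ← mul_assoc, map_mul, Module.End.mul_apply]
    simp only [Polynomial.eval_mul, Polynomial.eval_C, Polynomial.eval_pow, Polynomial.eval_X,
      Polynomial.aeval_X] at this ⊢
    convert this using 1
    rw [smul_sub, smul_smul]
    abel

/-- Comparing the eigenvalue `k` with the symbol `l` puts `(k - l) • a` in `F (l + 1)`, and `k - l`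
is invertible. -/
theorem mem_succ_of_eigen (hD : IsEuler F D) {k l : ℕ} (hkl : l ≠ k) {a : A}
    (h : D a = (k : ℝ) • a) (ha : a ∈ F l) : a ∈ F (l + 1) := by
  have h1 := hD.symbol ha
  rw [h, ← sub_smul] at h1
  have h2 : ((k : ℝ) - l) ≠ 0 := sub_ne_zero.2 (by exact_mod_cast hkl.symm)
  simpa [smul_smul, h2] using (F (l + 1)).smul_mem ((k : ℝ) - l)⁻¹ h1

theorem mem_of_eigen (hF : IsNilFiltration n F) (hD : IsEuler F D) {k : ℕ} {a : A}
    (h : D a = (k : ℝ) • a) : a ∈ F k := by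
  have : ∀ l ≤ k, a ∈ F l := by
    intro l
    induction l with
    | zero => intro; rw [hF.zero]; trivial
    | succ l ih => exact fun hl => hD.mem_succ_of_eigen (by omega) h (ih (by omega))
  exact this k le_rfl

/-- The rigidity behind all identities below: above level `k` the eigenvector never meets its own
eigenvalue as a symbol, so it climbs through the filtration until it vanishes. Two eigenvectors of
eigenvalue `k` that agree modulo `F (k + 1)` are thus equal. -/
theorem eq_zero_of_eigen (hF : IsNilFiltration n F) (hD : IsEuler F D) {k : ℕ} {a : A}
    (h : D a = (k : ℝ) • a) (ha : a ∈ F (k + 1)) : a = 0 := by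
  have : ∀ l, a ∈ F (k + 1 + l) := by
    intro l
    induction l with
    | zero => exact ha
    | succ l ih =>
      exact hD.mem_succ_of_eigen (by omega : k + 1 + l ≠ k) h ih
  have h2 := hF.anti (by omega : n + 1 ≤ k + 1 + n) (this n)
  rwa [hF.last, Submodule.mem_bot] at h2

/-- The factor `D - i` moves `F i` into `F (i + 1)`. For `m = n + 1` the product annihilates the
algebra. -/
theorem aeval_prod_mem (hF : IsNilFiltration n F) (hD : IsEuler F D) (m : ℕ) (a : A) :
    Polynomial.aeval D (∏ i ∈ Finset.range m, (Polynomial.X - Polynomial.C (i : ℝ))) a ∈ F m := by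
  induction m with
  | zero => rw [hF.zero]; trivial
  | succ m ih =>
    rw [Finset.prod_range_succ, mul_comm, map_mul, Module.End.mul_apply]
    rw [aeval_X_sub_C_apply]
    exact hD.symbol ih

/-- Multiplied by `X - k`, the Lagrange polynomial becomes a scalar multiple of the annihilating
product of `aeval_prod_mem`. -/
theorem apply_eulerProj (hF : IsNilFiltration n F) (hD : IsEuler F D) {k : ℕ}
    (hk : k ∈ Finset.range (n + 1)) (a : A) :
    D (eulerProj n k D a) = (k : ℝ) • eulerProj n k D a := by
  have h1 : (Polynomial.X - Polynomial.C (k : ℝ)) *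
      Lagrange.basis (Finset.range (n + 1)) (fun i : ℕ => (i : ℝ)) k =
      Polynomial.C (Lagrange.nodalWeight (Finset.range (n + 1)) (fun i : ℕ => (i : ℝ)) k) *
        ∏ i ∈ Finset.range (n + 1), (Polynomial.X - Polynomial.C (i : ℝ)) := by
    rw [Lagrange.basis_eq_prod_sub_inv_mul_nodal_div hk, ← Lagrange.nodal_eq,
      ← Lagrange.nodal_erase_eq_nodal_div hk,
      Lagrange.nodal_eq_mul_nodal_erase (v := fun i : ℕ => (i : ℝ)) hk]
    ring
  have h2 := congrArg (fun p => Polynomial.aeval D p a) h1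
  have h3 := hD.aeval_prod_mem hF (n + 1) a
  rw [hF.last, Submodule.mem_bot] at h3
  simp only [map_mul (Polynomial.aeval D), Module.End.mul_apply, h3, map_zero,
    aeval_X_sub_C_apply] at h2
  exact sub_eq_zero.1 h2

theorem eulerProj_sub_mem (hF : IsNilFiltration n F) (hD : IsEuler F D) {k : ℕ}
    (hk : k ∈ Finset.range (n + 1)) {a : A} (ha : a ∈ F k) :
    eulerProj n k D a - a ∈ F (k + 1) := by
  have := hD.aeval_symbol hF
    (Lagrange.basis (Finset.range (n + 1)) (fun i : ℕ => (i : ℝ)) k) ha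
  rwa [Lagrange.eval_basis_self (v := fun i : ℕ => (i : ℝ)) (Nat.cast_injective.injOn) hk,
    one_smul] at this

theorem aeval_eigen {p : Polynomial ℝ} {c : ℝ} {a : A} (h : D a = c • a) :
    Polynomial.aeval D p a = p.eval c • a := by
  induction p using Polynomial.induction_on with
  | C c => simp
  | add p q hp hq => simp [hp, hq, add_smul]
  | monomial j d ih =>
    rw [pow_succ, ← mul_assoc, mul_comm, map_mul, Module.End.mul_apply, ih]
    simp [h, smul_smul]
    ring_nf

theorem eulerProj_eigen (hF : IsNilFiltration n F) (hD : IsEuler F D) {j k : ℕ}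
    (hk : k ∈ Finset.range (n + 1)) {a : A} (ha : D a = (j : ℝ) • a) :
    eulerProj n k D a = if j = k then a else 0 := by
  rw [eulerProj, aeval_eigen ha]
  split_ifs with h
  · subst h
    rw [Lagrange.eval_basis_self (v := fun i : ℕ => (i : ℝ)) (Nat.cast_injective.injOn) hk,
      one_smul]
  · by_cases hj : j ∈ Finset.range (n + 1)
    · rw [Lagrange.eval_basis_of_ne (v := fun i : ℕ => (i : ℝ)) (Ne.symm h) hj, zero_smul]
    -- An eigenvalue larger than `n` occurs only on zero, since its eigenvectors lie in `F j = ⊥`.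
    · have h1 := hF.anti (by simpa using hj : n + 1 ≤ j) (hD.mem_of_eigen hF ha)
      rw [hF.last, Submodule.mem_bot] at h1
      rw [h1, smul_zero]

theorem eulerConj_of_eigen (hF : IsNilFiltration n F) (hD₁ : IsEuler F D₁)
    {k : ℕ} (hk : k ∈ Finset.range (n + 1)) {a : A} (ha : D₁ a = (k : ℝ) • a) :
    eulerConj n D₁ D₂ a = eulerProj n k D₂ a := by
  rw [eulerConj, LinearMap.sum_apply, Finset.sum_eq_single_of_mem k hk]
  · rw [Module.End.mul_apply, hD₁.eulerProj_eigen hF hk ha, if_pos rfl]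
  · intro j hj hjk
    rw [Module.End.mul_apply, hD₁.eulerProj_eigen hF hj ha, if_neg hjk.symm, map_zero]

theorem sum_eulerProj (D : Module.End ℝ A) (a : A) :
    ∑ k ∈ Finset.range (n + 1), eulerProj n k D a = a := by
  have := Lagrange.sum_basis (s := Finset.range (n + 1)) (v := fun i : ℕ => (i : ℝ))
    Nat.cast_injective.injOn ⟨0, by simp⟩
  have h2 := congrArg (fun p => Polynomial.aeval D p a) this
  simp only [map_sum, LinearMap.sum_apply, map_one, Module.End.one_apply] at h2
  exact h2

/-- For eigenvectors `a`, `b` of eigenvalues `k`, `l`, both sides are eigenvectors of `D₂` of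
eigenvalue `k + l`, by the Leibniz rule, and both are congruent to `a * b` modulo `F (k + l + 1)`.
Rigidity identifies them; the general case is bilinear. -/
theorem eulerConj_mul (hF : IsNilFiltration n F) (hD₁ : IsEuler F D₁) (hD₂ : IsEuler F D₂)
    (a b : A) : eulerConj n D₁ D₂ (a * b) = eulerConj n D₁ D₂ a * eulerConj n D₁ D₂ b := by
  have key : ∀ k ∈ Finset.range (n + 1), ∀ l ∈ Finset.range (n + 1), ∀ a b : A,
      D₁ a = (k : ℝ) • a → D₁ b = (l : ℝ) • b →
      eulerConj n D₁ D₂ (a * b) = eulerConj n D₁ D₂ a * eulerConj n D₁ D₂ b := by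
    intro k hk l hl a b ha hb
    have hab : D₁ (a * b) = ((k + l : ℕ) : ℝ) • (a * b) := by
      rw [hD₁.leibniz, ha, hb, smul_mul_assoc, mul_smul_comm, ← add_smul, Nat.cast_add]
    have haF := hD₁.mem_of_eigen hF ha
    have hbF := hD₁.mem_of_eigen hF hb
    have habF := hD₁.mem_of_eigen hF hab
    rw [hD₁.eulerConj_of_eigen hF hk ha, hD₁.eulerConj_of_eigen hF hl hb]
    have ha' := hD₂.apply_eulerProj hF hk a
    have hb' := hD₂.apply_eulerProj hF hl b
    have hab' : D₂ (eulerProj n k D₂ a * eulerProj n l D₂ b) =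
        ((k + l : ℕ) : ℝ) • (eulerProj n k D₂ a * eulerProj n l D₂ b) := by
      rw [hD₂.leibniz, ha', hb', smul_mul_assoc, mul_smul_comm, ← add_smul, Nat.cast_add]
    by_cases hkl : k + l ∈ Finset.range (n + 1)
    · rw [hD₁.eulerConj_of_eigen hF hkl hab, ← sub_eq_zero]
      refine hD₂.eq_zero_of_eigen hF (k := k + l) ?_ ?_
      · rw [map_sub, hab', hD₂.apply_eulerProj hF hkl, smul_sub]
      · have h1 := hD₂.eulerProj_sub_mem hF hkl habF
        have h2 := hF.mul (hD₂.eulerProj_sub_mem hF hk haF) hbF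
        have h3 := hF.mul (hD₂.mem_of_eigen hF ha') (hD₂.eulerProj_sub_mem hF hl hbF)
        rw [show k + 1 + l = k + l + 1 by ring] at h2
        rw [← add_assoc] at h3
        -- With `P` the projections of `D₂`: `P(ab) - Pa Pb = (P(ab) - ab) - ((Pa - a) b + Pa (Pb -
        -- b))`.
        convert (F (k + l + 1)).sub_mem h1 ((F (k + l + 1)).add_mem h2 h3) using 1
        noncomm_ring
    -- Beyond degree `n` both products lie in `F (k + l) = ⊥`.
    · have hn : n + 1 ≤ k + l := by simpa using hkl
      have h1 := hF.anti hn habF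
      have h2 := hF.anti hn (hD₂.mem_of_eigen hF hab')
      rw [hF.last, Submodule.mem_bot] at h1 h2
      rw [h1, h2, map_zero]
  conv_lhs => rw [← sum_eulerProj (n := n) D₁ a, ← sum_eulerProj (n := n) D₁ b,
    Finset.sum_mul_sum, map_sum]
  conv_rhs => rw [← sum_eulerProj (n := n) D₁ a, ← sum_eulerProj (n := n) D₁ b, map_sum, map_sum,
    Finset.sum_mul_sum]
  refine Finset.sum_congr rfl fun k hk => ?_
  rw [map_sum]
  exact Finset.sum_congr rfl fun l hl => key k hk l hl _ _ (hD₁.apply_eulerProj hF hk a)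
    (hD₁.apply_eulerProj hF hl b)

theorem eulerConj_intertwine (hF : IsNilFiltration n F) (hD₁ : IsEuler F D₁)
    (hD₂ : IsEuler F D₂) (a : A) : eulerConj n D₁ D₂ (D₁ a) = D₂ (eulerConj n D₁ D₂ a) := by
  conv_lhs => rw [← sum_eulerProj (n := n) D₁ a, map_sum, map_sum]
  conv_rhs => rw [← sum_eulerProj (n := n) D₁ a, map_sum, map_sum]
  refine Finset.sum_congr rfl fun k hk => ?_
  have h := hD₁.apply_eulerProj hF hk a
  rw [h, map_smul, hD₁.eulerConj_of_eigen hF hk h, hD₂.apply_eulerProj hF hk]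

/-- On an eigenvector, projecting to `D₂` and back changes nothing modulo `F (k + 1)`, so rigidity
applies once more. -/
theorem eulerConj_eulerConj (hF : IsNilFiltration n F) (hD₁ : IsEuler F D₁)
    (hD₂ : IsEuler F D₂) (a : A) : eulerConj n D₂ D₁ (eulerConj n D₁ D₂ a) = a := by
  conv_lhs => rw [← sum_eulerProj (n := n) D₁ a, map_sum, map_sum]
  conv_rhs => rw [← sum_eulerProj (n := n) D₁ a]
  refine Finset.sum_congr rfl fun k hk => ?_
  have ha := hD₁.apply_eulerProj hF hk a
  generalize eulerProj n k D₁ a = b at ha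
  have hb := hD₂.apply_eulerProj hF hk b
  have h1 := hD₂.eulerProj_sub_mem hF hk (hD₁.mem_of_eigen hF ha)
  rw [hD₁.eulerConj_of_eigen hF hk ha, hD₂.eulerConj_of_eigen hF hk hb, ← sub_eq_zero]
  refine hD₁.eq_zero_of_eigen hF (k := k) ?_ ?_
  · rw [map_sub, hD₁.apply_eulerProj hF hk, ha, smul_sub]
  · simpa using (F (k + 1)).add_mem
      (hD₁.eulerProj_sub_mem hF hk (hD₂.mem_of_eigen hF hb)) h1

/-- The automorphism of a filtered algebra which conjugates one Euler operator into another. -/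
def conjEquiv (hF : IsNilFiltration n F) (hD₁ : IsEuler F D₁) (hD₂ : IsEuler F D₂) :
    A ≃ₐ[ℝ] A :=
  AlgEquiv.ofBijective
    (AlgHom.ofLinearMap (eulerConj n D₁ D₂) (by
      -- A multiplicative map that hits `1` preserves `1`; the preimage is supplied by the reverse
      -- conjugation.
      have := hD₁.eulerConj_mul hF hD₂ 1 (eulerConj n D₂ D₁ 1)
      rwa [one_mul, hD₂.eulerConj_eulerConj hF hD₁, mul_one, eq_comm] at this)
      (hD₁.eulerConj_mul hF hD₂))
    (Function.bijective_iff_has_inverse.2 ⟨eulerConj n D₂ D₁, hD₁.eulerConj_eulerConj hF hD₂,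
      hD₂.eulerConj_eulerConj hF hD₁⟩)

theorem conjEquiv_apply (hF : IsNilFiltration n F) (hD₁ : IsEuler F D₁) (hD₂ : IsEuler F D₂)
    (a : A) : conjEquiv hF hD₁ hD₂ a = eulerConj n D₁ D₂ a := rfl

theorem conjEquiv_mem_iff (hF : IsNilFiltration n F) (hD₁ : IsEuler F D₁) (hD₂ : IsEuler F D₂)
    {S : Submodule ℝ A} (h₁ : ∀ a ∈ S, D₁ a ∈ S) (h₂ : ∀ a ∈ S, D₂ a ∈ S) {a : A} :
    conjEquiv hF hD₁ hD₂ a ∈ S ↔ a ∈ S := by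
  refine ⟨fun h => ?_, eulerConj_mem_of_stable h₁ h₂⟩
  have := eulerConj_mem_of_stable (n := n) h₂ h₁ h
  rwa [conjEquiv_apply, hD₁.eulerConj_eulerConj hF hD₂] at this

end IsEuler


/-! ### The filtration by degree and the Euler operator of an exterior algebra -/

namespace ExteriorAlgebra

variable {V W : Type*} [AddCommGroup V] [Module ℝ V] [AddCommGroup W] [Module ℝ W]

variable (V) in
/-- The sum of the homogeneous components of degree at least `k`. -/
def degGE (k : ℕ) : Submodule ℝ (ExteriorAlgebra ℝ V) :=
  ⨆ (j : ℕ) (_ : k ≤ j), LinearMap.range (ι ℝ : V →ₗ[ℝ] _) ^ j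

theorem pow_le_degGE {k j : ℕ} (h : k ≤ j) :
    LinearMap.range (ι ℝ : V →ₗ[ℝ] _) ^ j ≤ degGE V k :=
  le_iSup₂_of_le j h le_rfl

theorem degGE_le {k : ℕ} {S : Submodule ℝ (ExteriorAlgebra ℝ V)}
    (h : ∀ j, k ≤ j → LinearMap.range (ι ℝ : V →ₗ[ℝ] _) ^ j ≤ S) : degGE V k ≤ S :=
  iSup₂_le h

theorem degGE_anti : Antitone (degGE V) :=
  fun _ _ h => degGE_le fun _ hj => pow_le_degGE (h.trans hj)

theorem degGE_zero : degGE V 0 = ⊤ := by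
  rw [eq_top_iff, ← CliffordAlgebra.iSup_ι_range_eq_top]
  exact iSup_le fun j => pow_le_degGE j.zero_le

theorem mul_mem_degGE {k l : ℕ} {a b : ExteriorAlgebra ℝ V} (ha : a ∈ degGE V k)
    (hb : b ∈ degGE V l) : a * b ∈ degGE V (k + l) := by
  have : degGE V k * degGE V l ≤ degGE V (k + l) := by
    simp only [degGE, Submodule.iSup_mul, Submodule.mul_iSup, ← pow_add]
    exact iSup₂_le fun i hi => iSup₂_le fun j hj => le_iSup₂_of_le (j + i) (by omega) le_rfl
  exact this (Submodule.mul_mem_mul ha hb)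

/-- The dimension of `⋀^j V` is a binomial coefficient, which vanishes for `j` above the rank. -/
theorem degGE_eq_bot [FiniteDimensional ℝ V] {k : ℕ} (h : Module.finrank ℝ V < k) :
    degGE V k = ⊥ := by
  refine eq_bot_iff.2 (degGE_le fun j hj => ?_)
  have h1 : Module.finrank ℝ (⋀[ℝ]^j V) = 0 := by
    rw [exteriorPower.finrank_eq, Nat.choose_eq_zero_of_lt (by omega)]
  exact (Submodule.finrank_eq_zero.1 h1).le

theorem isNilFiltration_degGE [FiniteDimensional ℝ V] {n : ℕ} (h : Module.finrank ℝ V = n) :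
    IsNilFiltration n (degGE V) where
  anti := degGE_anti
  zero := degGE_zero
  last := degGE_eq_bot (by omega)
  mul := mul_mem_degGE

theorem evenOdd_one_le :
    CliffordAlgebra.evenOdd (0 : QuadraticForm ℝ V) 1 ≤ degGE V 1 := by
  refine iSup_le fun j => pow_le_degGE ?_
  rcases j with ⟨j, hj⟩
  rcases Nat.eq_zero_or_pos j with rfl | h
  · simp at hj
  · exact h

theorem map_mem_pow (f : V →ₗ[ℝ] W) {j : ℕ} {a : ExteriorAlgebra ℝ V}
    (ha : a ∈ LinearMap.range (ι ℝ : V →ₗ[ℝ] _) ^ j) :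
    map f a ∈ LinearMap.range (ι ℝ : W →ₗ[ℝ] _) ^ j := by
  have h1 := Submodule.mem_map_of_mem (f := (map f).toLinearMap) ha
  rw [Submodule.map_pow] at h1
  have h2 : (LinearMap.range (ι ℝ : V →ₗ[ℝ] _)).map (map f).toLinearMap ≤
      LinearMap.range (ι ℝ : W →ₗ[ℝ] _) := by
    rintro _ ⟨_, ⟨v, rfl⟩, rfl⟩
    exact ⟨f v, (map_apply_ι f v).symm⟩
  have h3 := pow_le_pow_left' h2 j
  exact h3 h1

theorem map_mem_evenOdd (f : V →ₗ[ℝ] W) {i : ZMod 2} {a : ExteriorAlgebra ℝ V}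
    (ha : a ∈ CliffordAlgebra.evenOdd (0 : QuadraticForm ℝ V) i) :
    map f a ∈ CliffordAlgebra.evenOdd (0 : QuadraticForm ℝ W) i := by
  have : CliffordAlgebra.evenOdd (0 : QuadraticForm ℝ V) i ≤
      (CliffordAlgebra.evenOdd (0 : QuadraticForm ℝ W) i).comap (map f).toLinearMap :=
    iSup_le fun j => fun a ha => le_iSup (f := fun j : {n : ℕ // (n : ZMod 2) = i} =>
      LinearMap.range (CliffordAlgebra.ι (0 : QuadraticForm ℝ W)) ^ (j : ℕ)) j (map_mem_pow f ha)
  exact this ha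

theorem map_mem_degGE (f : V →ₗ[ℝ] W) {k : ℕ} {a : ExteriorAlgebra ℝ V}
    (ha : a ∈ degGE V k) : map f a ∈ degGE W k := by
  have : degGE V k ≤ (degGE W k).comap (map f).toLinearMap :=
    degGE_le fun j hj a ha => pow_le_degGE hj (map_mem_pow f ha)
  exact this ha

variable (V) in
/-- The algebra map `a ↦ a + ε D a` into the dual numbers, for the Euler derivation `D`. -/
def eulerDual : ExteriorAlgebra ℝ V →ₐ[ℝ]
    TrivSqZeroExt (ExteriorAlgebra ℝ V) (ExteriorAlgebra ℝ V) :=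
  lift ℝ ⟨{ toFun := fun v => TrivSqZeroExt.inl (ι ℝ v) + TrivSqZeroExt.inr (ι ℝ v)
            map_add' := fun v w => by ext <;> simp
            map_smul' := fun c v => by ext <;> simp }, fun v => by ext <;> simp⟩

theorem fst_eulerDual (a : ExteriorAlgebra ℝ V) : (eulerDual V a).fst = a := by
  have : (TrivSqZeroExt.fstHom ℝ _ _).comp (eulerDual V) = AlgHom.id ℝ _ := by
    ext v
    simp [eulerDual]
  exact DFunLike.congr_fun this a

variable (V) in
/-- The Euler derivation of the exterior algebra: multiplication by `k` in degree `k`. -/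
def euler : Module.End ℝ (ExteriorAlgebra ℝ V) :=
  ((TrivSqZeroExt.sndHom (ExteriorAlgebra ℝ V) (ExteriorAlgebra ℝ V)).restrictScalars ℝ) ∘ₗ
    (eulerDual V).toLinearMap

theorem euler_mul (a b : ExteriorAlgebra ℝ V) :
    euler V (a * b) = euler V a * b + a * euler V b := by
  simp [euler, fst_eulerDual, add_comm]

theorem euler_ι (v : V) : euler V (ι ℝ v) = ι ℝ v := by
  simp [euler, eulerDual]

theorem euler_of_mem_pow {j : ℕ} {a : ExteriorAlgebra ℝ V}
    (ha : a ∈ LinearMap.range (ι ℝ : V →ₗ[ℝ] _) ^ j) : euler V a = (j : ℝ) • a := by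
  induction ha using Submodule.pow_induction_on_left' with
  | algebraMap r => rw [Algebra.algebraMap_eq_smul_one]; simp [euler]
  | add x y i hx hy h1 h2 => rw [map_add, h1, h2, smul_add]
  | mem_mul m hm i x hx h =>
    obtain ⟨v, rfl⟩ := hm
    rw [euler_mul, h, euler_ι]
    simp [add_smul, add_comm]

theorem isEuler_euler : IsEuler (degGE V) (euler V) where
  leibniz := euler_mul
  symbol := by
    intro k a ha
    have : degGE V k ≤ (degGE V (k + 1)).comap (euler V - (k : ℝ) • LinearMap.id) := by
      refine degGE_le fun j hj a ha => ?_
      simp only [Submodule.mem_comap, LinearMap.sub_apply, LinearMap.smul_apply,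
        LinearMap.id_apply, euler_of_mem_pow ha, ← sub_smul]
      rcases hj.eq_or_lt with rfl | h
      · simp
      · exact Submodule.smul_mem _ _ (pow_le_degGE h ha)
    exact this ha

theorem euler_mem_evenOdd {i : ZMod 2} {a : ExteriorAlgebra ℝ V}
    (ha : a ∈ CliffordAlgebra.evenOdd (0 : QuadraticForm ℝ V) i) :
    euler V a ∈ CliffordAlgebra.evenOdd (0 : QuadraticForm ℝ V) i := by
  have : CliffordAlgebra.evenOdd (0 : QuadraticForm ℝ V) i ≤
      (CliffordAlgebra.evenOdd (0 : QuadraticForm ℝ V) i).comap (euler V) :=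
    iSup_le fun j => fun a ha => by
      rw [Submodule.mem_comap, euler_of_mem_pow ha]
      exact Submodule.smul_mem _ _ (le_iSup (f := fun j : {n : ℕ // (n : ZMod 2) = i} =>
        LinearMap.range (CliffordAlgebra.ι (0 : QuadraticForm ℝ V)) ^ (j : ℕ)) j ha)
  exact this ha

theorem ιInv_one : ιInv (1 : ExteriorAlgebra ℝ V) = 0 := by
  -- The square-zero extension needs a right action on `V`; this is the one underlying `ιInv`.
  let _ : Module ℝᵐᵒᵖ V := Module.compHom _ ((RingHom.id ℝ).fromOpposite mul_comm)
  have _ : IsCentralScalar ℝ V := ⟨fun r m => rfl⟩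
  simp [ιInv]

theorem ιInv_ι (v : V) : ιInv (ι ℝ v) = v := ι_leftInverse v

theorem algebraMapInv_ι (v : V) : algebraMapInv (ι ℝ v) = 0 := by
  simp [algebraMapInv]

/-- Truncation to degree at most one is an algebra map into the square-zero extension of `ℝ` by `V`,
so the degree-one part is a derivation over the augmentation. -/
theorem ιInv_mul (a b : ExteriorAlgebra ℝ V) :
    ιInv (a * b) = algebraMapInv a • ιInv b + algebraMapInv b • ιInv a := by
  let _ : Module ℝᵐᵒᵖ V := Module.compHom _ ((RingHom.id ℝ).fromOpposite mul_comm)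
  have _ : IsCentralScalar ℝ V := ⟨fun r m => rfl⟩
  have h : ∀ a : ExteriorAlgebra ℝ V, (toTrivSqZeroExt a).fst = algebraMapInv a := by
    intro a
    have : (TrivSqZeroExt.fstHom ℝ ℝ V).comp toTrivSqZeroExt = algebraMapInv := by
      ext v
      simp [algebraMapInv]
    exact DFunLike.congr_fun this a
  simp [ιInv, h]

theorem ιInv_algebraMap (r : ℝ) : ιInv (algebraMap ℝ (ExteriorAlgebra ℝ V) r) = 0 := by
  rw [Algebra.algebraMap_eq_smul_one, map_smul, ιInv_one, smul_zero]

theorem algebraMapInv_algebraMap (r : ℝ) :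
    algebraMapInv (algebraMap ℝ (ExteriorAlgebra ℝ V) r) = r := by
  simp

theorem algebraMapInv_map (f : V →ₗ[ℝ] W) (a : ExteriorAlgebra ℝ V) :
    algebraMapInv (map f a) = algebraMapInv a := by
  have : algebraMapInv.comp (map f) = algebraMapInv (M := V) := by
    ext v
    simp [algebraMapInv]
  exact DFunLike.congr_fun this a

theorem ιInv_map (f : V →ₗ[ℝ] W) (a : ExteriorAlgebra ℝ V) : ιInv (map f a) = f (ιInv a) :=
  DFunLike.congr_fun (ιInv_comp_map f) a

theorem algebraMapInv_of_mem_pow {j : ℕ} (hj : 1 ≤ j) {a : ExteriorAlgebra ℝ V}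
    (ha : a ∈ LinearMap.range (ι ℝ : V →ₗ[ℝ] _) ^ j) : algebraMapInv a = 0 := by
  obtain ⟨j, rfl⟩ := Nat.exists_eq_add_of_le hj
  rw [pow_add, pow_one] at ha
  refine Submodule.mul_induction_on ha ?_ fun x y hx hy => by rw [map_add, hx, hy, add_zero]
  rintro _ ⟨v, rfl⟩ b -
  rw [map_mul, algebraMapInv_ι, zero_mul]

theorem algebraMapInv_of_mem_degGE {a : ExteriorAlgebra ℝ V} (ha : a ∈ degGE V 1) :
    algebraMapInv a = 0 := by
  have : degGE V 1 ≤ LinearMap.ker (algebraMapInv (R := ℝ) (M := V)).toLinearMap :=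
    degGE_le fun j hj a ha => algebraMapInv_of_mem_pow hj ha
  exact this ha

theorem ιInv_of_mem_pow {j : ℕ} (hj : j ≠ 1) {a : ExteriorAlgebra ℝ V}
    (ha : a ∈ LinearMap.range (ι ℝ : V →ₗ[ℝ] _) ^ j) : ιInv a = 0 := by
  rcases Nat.eq_zero_or_pos j with rfl | h0
  · rw [pow_zero, Submodule.one_eq_range] at ha
    obtain ⟨r, rfl⟩ := ha
    exact ιInv_algebraMap r
  · obtain ⟨j, rfl⟩ := Nat.exists_eq_add_of_le h0
    rw [pow_add, pow_one] at ha
    refine Submodule.mul_induction_on ha ?_ fun x y hx hy => by rw [map_add, hx, hy, add_zero]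
    rintro _ ⟨v, rfl⟩ b hb
    rw [ιInv_mul, algebraMapInv_ι, zero_smul, algebraMapInv_of_mem_pow (by omega) hb, zero_smul,
      add_zero]

theorem ιInv_of_mem_degGE {a : ExteriorAlgebra ℝ V} (ha : a ∈ degGE V 2) : ιInv a = 0 := by
  have : degGE V 2 ≤ LinearMap.ker (ιInv (R := ℝ) (M := V)) :=
    degGE_le fun j hj a ha => ιInv_of_mem_pow (by omega) ha
  exact this ha

theorem ιInv_of_even {a : ExteriorAlgebra ℝ V}
    (ha : a ∈ CliffordAlgebra.evenOdd (0 : QuadraticForm ℝ V) 0) : ιInv a = 0 := by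
  have : CliffordAlgebra.evenOdd (0 : QuadraticForm ℝ V) 0 ≤
      LinearMap.ker (ιInv (R := ℝ) (M := V)) :=
    iSup_le fun j a ha => ιInv_of_mem_pow (by
      rcases j with ⟨j, hj⟩
      rintro rfl
      simp at hj) ha
  exact this ha

theorem sub_mem_degGE_two (a : ExteriorAlgebra ℝ V) :
    a - algebraMap ℝ _ (algebraMapInv a) - ι ℝ (ιInv a) ∈ degGE V 2 := by
  have h0 : a ∈ (⊤ : Submodule ℝ (ExteriorAlgebra ℝ V)) := trivial
  rw [← degGE_zero] at h0
  have : degGE V 0 ≤ (degGE V 2).comap (LinearMap.id -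
      (Algebra.linearMap ℝ (ExteriorAlgebra ℝ V)) ∘ₗ algebraMapInv.toLinearMap -
        ι ℝ ∘ₗ ιInv) := by
    refine degGE_le fun j hj a ha => ?_
    simp only [Submodule.mem_comap, LinearMap.sub_apply, LinearMap.id_apply,
      LinearMap.comp_apply, AlgHom.toLinearMap_apply, Algebra.linearMap_apply]
    rcases j with _ | _ | j
    · rw [pow_zero, Submodule.one_eq_range] at ha
      obtain ⟨r, rfl⟩ := ha
      rw [Algebra.linearMap_apply, ιInv_algebraMap, algebraMapInv_algebraMap]
      simp
    · rw [algebraMapInv_of_mem_pow (by omega) ha]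
      rw [zero_add, pow_one] at ha
      obtain ⟨v, rfl⟩ := ha
      rw [ιInv_ι]
      simp
    · rw [algebraMapInv_of_mem_pow (by omega) ha, ιInv_of_mem_pow (by omega) ha]
      simpa using pow_le_degGE (by omega) ha
  exact this h0

theorem sub_mem_degGE_one (a : ExteriorAlgebra ℝ V) :
    a - algebraMap ℝ _ (algebraMapInv a) ∈ degGE V 1 := by
  have h1 := degGE_anti one_le_two (sub_mem_degGE_two a)
  have h2 : ι ℝ (ιInv a) ∈ degGE V 1 := pow_le_degGE (j := 1) le_rfl (by simp)
  simpa using (degGE V 1).add_mem h1 h2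

theorem mem_degGE_one_iff {a : ExteriorAlgebra ℝ V} :
    a ∈ degGE V 1 ↔ algebraMapInv a = 0 := by
  refine ⟨algebraMapInv_of_mem_degGE, fun h => ?_⟩
  simpa [h] using sub_mem_degGE_one a

/-- The augmentation and the degree-one part together detect membership in the second filtration
step; this is why they serve as coordinates on `O / J ^ 2`. -/
theorem mem_degGE_two_iff {a : ExteriorAlgebra ℝ V} :
    a ∈ degGE V 2 ↔ algebraMapInv a = 0 ∧ ιInv a = 0 := by
  refine ⟨fun h => ⟨algebraMapInv_of_mem_degGE (degGE_anti one_le_two h), ιInv_of_mem_degGE h⟩,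
    fun h => ?_⟩
  simpa [h.1, h.2] using sub_mem_degGE_two a

theorem eq_algebraMap_of_euler [FiniteDimensional ℝ V] {a : ExteriorAlgebra ℝ V}
    (h : euler V a = 0) : a = algebraMap ℝ _ (algebraMapInv a) := by
  rw [← sub_eq_zero]
  refine isEuler_euler.eq_zero_of_eigen (k := 0) (isNilFiltration_degGE rfl) ?_
    (sub_mem_degGE_one a)
  rw [map_sub, h, euler_of_mem_pow (j := 0) (by rw [pow_zero]; exact Submodule.algebraMap_mem _)]
  simp

theorem eq_ι_of_euler [FiniteDimensional ℝ V] {a : ExteriorAlgebra ℝ V}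
    (h : euler V a = a) : a = ι ℝ (ιInv a) := by
  have h1 : a ∈ degGE V 1 :=
    isEuler_euler.mem_of_eigen (k := 1) (isNilFiltration_degGE rfl) (by simpa using h)
  rw [← sub_eq_zero]
  refine isEuler_euler.eq_zero_of_eigen (k := 1) (isNilFiltration_degGE rfl) ?_ ?_
  · rw [map_sub, h, euler_ι]
    simp
  · simpa [algebraMapInv_of_mem_degGE h1] using sub_mem_degGE_two a

end ExteriorAlgebra

/-! ### Gluing of sections and isomorphisms of superalgebra presheaves -/

namespace SuperPresheaf

variable {M : Type u} [TopologicalSpace M] {P Q R : SuperPresheaf M}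

theorem exists_glue (hP : P.presheaf.IsSheaf) {ι : Type*} (U : ι → Opens M) (V : Opens M)
    (hU : ∀ i, U i ≤ V) (hV : V ≤ iSup U) (sf : ∀ i, P.Sec (U i))
    (h : ∀ i j, P.res (inf_le_left : U i ⊓ U j ≤ U i) (sf i) =
      P.res (inf_le_right : U i ⊓ U j ≤ U j) (sf j)) :
    ∃ s : P.Sec V, ∀ i, P.res (hU i) s = sf i := by
  obtain ⟨s, hs, -⟩ := TopCat.Sheaf.existsUnique_gluing' ⟨P.presheaf, hP⟩ U V
    (fun i => homOfLE (hU i)) hV sf h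
  exact ⟨s, hs⟩

theorem eq_of_locally (hP : P.presheaf.IsSheaf) {V : Opens M} (s t : P.Sec V)
    (h : ∀ x ∈ V, ∃ W : Opens M, x ∈ W ∧ ∃ hW : W ≤ V, P.res hW s = P.res hW t) : s = t := by
  choose W hx hW hst using h
  refine TopCat.Sheaf.eq_of_locally_eq' ⟨P.presheaf, hP⟩ (fun x : V => W x.1 x.2) V
    (fun x => homOfLE (hW x.1 x.2)) ?_ s t fun x => hst x.1 x.2
  intro x hxV
  exact Opens.mem_iSup.2 ⟨⟨x, hxV⟩, hx x hxV⟩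

theorem isSheaf_of_glue
    (h1 : ∀ (V : Opens M) (s t : P.Sec V), (∀ x ∈ V, ∃ W : Opens M, x ∈ W ∧ ∃ hW : W ≤ V,
      P.res hW s = P.res hW t) → s = t)
    (h2 : ∀ (ι : Type u) (U : ι → Opens M) (sf : ∀ i, P.Sec (U i)),
      (∀ i j, P.res (inf_le_left : U i ⊓ U j ≤ U i) (sf i) =
        P.res (inf_le_right : U i ⊓ U j ≤ U j) (sf j)) →
      ∃ s : P.Sec (iSup U), ∀ i, P.res (le_iSup U i) s = sf i) :
    P.presheaf.IsSheaf := by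
  rw [TopCat.Presheaf.isSheaf_iff_isSheafUniqueGluing]
  intro ι U sf h
  obtain ⟨s, hs⟩ := h2 ι U sf h
  refine ⟨s, hs, fun t ht => h1 _ _ _ fun x hx => ?_⟩
  obtain ⟨i, hi⟩ := Opens.mem_iSup.1 hx
  exact ⟨U i, hi, le_iSup U i, (ht i).trans (hs i).symm⟩

theorem mem_nilIdeal_of_locally {k : ℕ} {U : Opens M} {s : P.Sec U}
    (h : ∀ x ∈ U, ∃ V : Opens M, x ∈ V ∧ ∃ h : V ≤ U, P.res h s ∈ P.nilIdeal k V) :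
    s ∈ P.nilIdeal k U := by
  intro x hx
  obtain ⟨V, hxV, hV, h1⟩ := h x hx
  obtain ⟨W, hxW, hW, h2⟩ := h1 x hxV
  exact ⟨W, hxW, hW.trans hV, by rwa [res_res] at h2⟩

namespace IsoOn

/-- The restriction of an isomorphism to a smaller open set. -/
def restrict {U U' : Opens M} (e : IsoOn P Q U) (h : U' ≤ U) : IsoOn P Q U' where
  equiv V hV := e.equiv V (hV.trans h)
  equiv_res V W hVW hW s := e.equiv_res V W hVW (hW.trans h) s
  parity_iff V hV i s := e.parity_iff V (hV.trans h) i s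

/-- The inverse isomorphism. -/
def symm {U : Opens M} (e : IsoOn P Q U) : IsoOn Q P U where
  equiv V hV := (e.equiv V hV).symm
  equiv_res V W h hW s := by
    rw [AlgEquiv.symm_apply_eq, e.equiv_res V W h hW, AlgEquiv.apply_symm_apply]
  parity_iff V hV i s := by
    rw [← e.parity_iff V hV, AlgEquiv.apply_symm_apply]

/-- The composition of isomorphisms. -/
def trans {U : Opens M} (e : IsoOn P Q U) (f : IsoOn Q R U) : IsoOn P R U where
  equiv V hV := (e.equiv V hV).trans (f.equiv V hV)
  equiv_res V W h hW s := by
    rw [AlgEquiv.trans_apply, AlgEquiv.trans_apply, e.equiv_res V W h hW, f.equiv_res V W h hW]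
  parity_iff V hV i s := by
    rw [AlgEquiv.trans_apply, f.parity_iff V hV, e.parity_iff V hV]

theorem symm_res {U : Opens M} (e : IsoOn P Q U) {V W : Opens M} (h : V ≤ W) (hW : W ≤ U)
    (s : Q.Sec W) :
    (e.equiv V (h.trans hW)).symm (Q.res h s) = P.res h ((e.equiv W hW).symm s) :=
  e.symm.equiv_res V W h hW s

theorem mem_oddIdealPow {U : Opens M} (e : IsoOn P Q U) (k : ℕ) {V : Opens M} (hV : V ≤ U)
    {s : P.Sec V} (hs : s ∈ P.oddIdealPow k V) : e.equiv V hV s ∈ Q.oddIdealPow k V :=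
  span_pow_le (e.equiv V hV).toAlgHom.toRingHom _ _ (fun a ha => (e.parity_iff V hV 1 a).2 ha) k
    s hs

theorem mem_nilIdeal {U : Opens M} (e : IsoOn P Q U) (k : ℕ) {V : Opens M} (hV : V ≤ U)
    {s : P.Sec V} (hs : s ∈ P.nilIdeal k V) : e.equiv V hV s ∈ Q.nilIdeal k V := by
  intro x hx
  obtain ⟨W, hxW, hW, h⟩ := hs x hx
  refine ⟨W, hxW, hW, ?_⟩
  rw [← e.equiv_res W V hW hV]
  exact e.mem_oddIdealPow k (hW.trans hV) h

theorem mem_nilIdeal_iff {U : Opens M} (e : IsoOn P Q U) (k : ℕ) {V : Opens M} (hV : V ≤ U)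
    {s : P.Sec V} : e.equiv V hV s ∈ Q.nilIdeal k V ↔ s ∈ P.nilIdeal k V := by
  refine ⟨fun h => ?_, e.mem_nilIdeal k hV⟩
  have := e.symm.mem_nilIdeal k hV h
  simpa [symm] using this

end IsoOn

end SuperPresheaf

namespace SmoothVectorBundle

/-! ### Sections of the exterior algebra bundle of the product bundle -/

open ExteriorAlgebra

variable {m n : ℕ} {M : Type u} [TopologicalSpace M] [ChartedSpace (EuclideanSpace ℝ (Fin m)) M]

/-- The value of a section at a point. -/
def evalAt (E : SmoothVectorBundle m n M) {U : Opens M} (x : U) :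
    E.extSheaf.Sec U →ₐ[ℝ] ExteriorAlgebra ℝ (E.fiber x) :=
  (Pi.evalAlgHom ℝ (fun x : U => ExteriorAlgebra ℝ (E.fiber x)) x).comp (E.extAlgebra U).val

theorem sec_ext {E : SmoothVectorBundle m n M} {U : Opens M} {s t : E.extSheaf.Sec U}
    (h : ∀ x : U, E.evalAt x s = E.evalAt x t) : s = t :=
  Subtype.ext (funext h)

theorem mem_parity_iff {E : SmoothVectorBundle m n M} {U : Opens M} {i : ZMod 2}
    {s : E.extSheaf.Sec U} : s ∈ E.extSheaf.parity U i ↔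
      ∀ x : U, E.evalAt x s ∈ CliffordAlgebra.evenOdd (0 : QuadraticForm ℝ (E.fiber x)) i :=
  Iff.rfl

end SmoothVectorBundle

/-- The exterior algebra `Λ ℝⁿ`. -/
abbrev Lam (n : ℕ) : Type := ExteriorAlgebra ℝ (EuclideanSpace ℝ (Fin n))

instance (n : ℕ) : FiniteDimensional ℝ (Lam n) :=
  Module.Finite.of_basis (EuclideanSpace.basisFun (Fin n) ℝ).toBasis.ExteriorAlgebra

/-- The sheaf `C^∞_M ⊗ Λₙ`. -/
abbrev trivSheaf (m n : ℕ) (M : Type u) [TopologicalSpace M]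
    [ChartedSpace (EuclideanSpace ℝ (Fin m)) M] : SuperPresheaf M :=
  (SmoothVectorBundle.trivial m n M).extSheaf

namespace TrivSheaf

open ExteriorAlgebra

variable {m n : ℕ} {M : Type u} [TopologicalSpace M] [ChartedSpace (EuclideanSpace ℝ (Fin m)) M]
  {U V : Opens M}

theorem extCoord_trivial (x₀ x : M) (a : Lam n) :
    (SmoothVectorBundle.trivial m n M).extCoord x₀ x a = a := by
  have : ((trivializationAt (EuclideanSpace ℝ (Fin n))
      (SmoothVectorBundle.trivial m n M).fiber x₀).linearMapAt ℝ x) = LinearMap.id := by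
    ext v : 1
    rw [Trivialization.linearMapAt_apply]
    exact if_pos trivial
  unfold SmoothVectorBundle.extCoord
  rw [this]
  exact DFunLike.congr_fun (ExteriorAlgebra.map_id) a

/-- The value of a section of `C^∞ ⊗ Λₙ` at a point. -/
def eval (x : U) : (trivSheaf m n M).Sec U →ₐ[ℝ] Lam n :=
  (SmoothVectorBundle.trivial m n M).evalAt x

theorem contMDiff_eval (s : (trivSheaf m n M).Sec U) (l : Module.Dual ℝ (Lam n)) :
    ContMDiff (𝓡 m) 𝓘(ℝ, ℝ) ∞ (fun x : U => l (eval x s)) := by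
  intro x₀
  refine (s.2 x₀ l).congr_of_eventuallyEq (Filter.Eventually.of_forall fun x => ?_)
  exact congrArg l (extCoord_trivial x₀.1 x.1 _).symm

/-- The section of `C^∞ ⊗ Λₙ` with given smooth values. -/
def mk (s : U → Lam n)
    (hs : ∀ l : Module.Dual ℝ (Lam n), ContMDiff (𝓡 m) 𝓘(ℝ, ℝ) ∞ (fun x : U => l (s x))) :
    (trivSheaf m n M).Sec U :=
  ⟨s, fun x₀ l => (hs l x₀).congr_of_eventuallyEq (Filter.Eventually.of_forall fun x =>
    congrArg l (extCoord_trivial x₀.1 x.1 _))⟩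

@[simp]
theorem eval_mk (s : U → Lam n) (hs) (x : U) : eval x (mk (m := m) s hs) = s x := rfl

theorem ext {s t : (trivSheaf m n M).Sec U} (h : ∀ x : U, eval x s = eval x t) : s = t :=
  SmoothVectorBundle.sec_ext h

theorem mem_parity_iff {i : ZMod 2} {s : (trivSheaf m n M).Sec U} :
    s ∈ (trivSheaf m n M).parity U i ↔
      ∀ x : U, eval x s ∈ CliffordAlgebra.evenOdd (0 : QuadraticForm ℝ _) i :=
  Iff.rfl

variable (m U) in
/-- Constant sections. -/
def const : Lam n →ₐ[ℝ] (trivSheaf m n M).Sec U where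
  toFun a := mk (fun _ => a) fun _ => contMDiff_const
  map_one' := rfl
  map_mul' _ _ := rfl
  map_zero' := rfl
  map_add' _ _ := rfl
  commutes' _ := rfl

@[simp]
theorem eval_const (a : Lam n) (x : U) : eval x (const m U a) = a := rfl

theorem res_const (h : U ≤ V) (a : Lam n) :
    (trivSheaf m n M).res h (const m V a) = const m U a := rfl

/-- A smooth function as a section of `C^∞ ⊗ Λₙ`. -/
def ofFun (n : ℕ) (f : U → ℝ) (hf : ContMDiff (𝓡 m) 𝓘(ℝ, ℝ) ∞ f) : (trivSheaf m n M).Sec U :=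
  mk (fun x => algebraMap ℝ _ (f x)) fun l => by
    simp only [Algebra.algebraMap_eq_smul_one, map_smul, smul_eq_mul]
    exact hf.mul contMDiff_const

@[simp]
theorem eval_ofFun (f : U → ℝ) (hf) (x : U) :
    eval x (ofFun (m := m) n f hf) = algebraMap ℝ _ (f x) := rfl

/-- A linear map applied to the values of sections. -/
def mapVal (L : Lam n →ₗ[ℝ] Lam n) : (trivSheaf m n M).Sec U →ₗ[ℝ] (trivSheaf m n M).Sec U where
  toFun s := mk (fun x => L (eval x s)) fun l => contMDiff_eval s (l ∘ₗ L)
  map_add' s t := ext fun x => by simp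
  map_smul' c s := ext fun x => by simp

@[simp]
theorem eval_mapVal (L : Lam n →ₗ[ℝ] Lam n) (s : (trivSheaf m n M).Sec U) (x : U) :
    eval x (mapVal L s) = L (eval x s) := rfl

theorem res_mapVal (h : U ≤ V) (L : Lam n →ₗ[ℝ] Lam n) (s : (trivSheaf m n M).Sec V) :
    (trivSheaf m n M).res h (mapVal L s) = mapVal L ((trivSheaf m n M).res h s) := rfl

/-- A section with values in a subspace is a combination of constant sections. -/
theorem exists_eq_sum (S : Submodule ℝ (Lam n)) :
    ∃ (k : ℕ) (b : Fin k → Lam n) (l : Fin k → Module.Dual ℝ (Lam n)), (∀ i, b i ∈ S) ∧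
      (∀ a ∈ S, a = ∑ i, l i a • b i) ∧
      ∀ (U : Opens M) (s : (trivSheaf m n M).Sec U), (∀ x, eval x s ∈ S) →
        s = ∑ i, ofFun n (fun x => l i (eval x s)) (contMDiff_eval s (l i)) * const m U (b i) := by
  let B := Module.finBasis ℝ S
  have hl : ∀ i, ∃ l : Module.Dual ℝ (Lam n), l ∘ₗ S.subtype = B.coord i :=
    fun i => LinearMap.exists_extend _
  choose l hl using hl
  have key : ∀ a ∈ S, a = ∑ i, l i a • (B i : Lam n) := by
    intro a ha
    have h1 := congrArg S.subtype (B.sum_repr ⟨a, ha⟩)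
    rw [map_sum] at h1
    refine h1.symm.trans (Finset.sum_congr rfl fun i _ => ?_)
    rw [map_smul]
    congr 1
    exact (DFunLike.congr_fun (hl i) ⟨a, ha⟩).symm
  refine ⟨_, fun i => B i, l, fun i => (B i).2, key, fun U s hs => ext fun x => ?_⟩
  rw [map_sum]
  simp only [map_mul, eval_ofFun, eval_const, ← Algebra.smul_def]
  exact key _ (hs x)

/-- A `j`-vector is spanned by products of `j` generators, each a constant odd section. -/
theorem ofFun_mul_const_mem {k j : ℕ} (hkj : k ≤ j) (f : U → ℝ)
    (hf : ContMDiff (𝓡 m) 𝓘(ℝ, ℝ) ∞ f) {b : Lam n}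
    (hb : b ∈ LinearMap.range (ι ℝ : EuclideanSpace ℝ (Fin n) →ₗ[ℝ] _) ^ j) :
    ofFun n f hf * const m U b ∈ (trivSheaf m n M).oddIdealPow k U := by
  refine TwoSidedIdeal.mul_mem_left _ _ _ ?_
  change b ∈ ⋀[ℝ]^j (EuclideanSpace ℝ (Fin n)) at hb
  rw [← ιMulti_span_fixedDegree] at hb
  induction hb using Submodule.span_induction with
  | zero => rw [map_zero]; exact TwoSidedIdeal.zero_mem _
  | add x y _ _ hx hy => rw [map_add]; exact TwoSidedIdeal.add_mem _ hx hy
  | smul c x _ hx =>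
    rw [map_smul, Algebra.smul_def]
    exact TwoSidedIdeal.mul_mem_left _ _ _ hx
  | mem x hx =>
    obtain ⟨v, rfl⟩ := hx
    -- The first `k` of the `j` factors form the required `k`-fold product; the remaining ones are
    -- absorbed by the ideal.
    rw [ιMulti_apply, map_list_prod, ← List.take_append_drop k (List.map _ _), List.prod_append]
    refine TwoSidedIdeal.mul_mem_right _ _ _ (TwoSidedIdeal.subset_span ⟨_, ?_, ?_, rfl⟩)
    · simpa using hkj
    · intro b hb
      obtain ⟨c, hc, rfl⟩ := List.mem_map.1 (List.mem_of_mem_take hb)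
      obtain ⟨i, rfl⟩ := (List.mem_ofFn' _ _).1 hc
      exact TwoSidedIdeal.subset_span fun x => CliffordAlgebra.ι_mem_evenOdd_one _ _

/-- A section with values in the fixed finite-dimensional space `degGE k` is a finite sum of smooth
functions times constants from that space, and constants are treated by `ofFun_mul_const_mem`. -/
theorem mem_oddIdealPow_of_eval {k : ℕ} {s : (trivSheaf m n M).Sec U}
    (h : ∀ x, eval x s ∈ degGE _ k) : s ∈ (trivSheaf m n M).oddIdealPow k U := by
  have hsum : ∀ {ι : Type} (t : Finset ι) (f : ι → (trivSheaf m n M).Sec U),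
      (∀ i ∈ t, f i ∈ (trivSheaf m n M).oddIdealPow k U) →
      ∑ i ∈ t, f i ∈ (trivSheaf m n M).oddIdealPow k U :=
    fun t f hf => sum_mem hf
  obtain ⟨r, b, l, hb, -, hs⟩ := exists_eq_sum (m := m) (M := M) (degGE (EuclideanSpace ℝ (Fin n)) k)
  rw [hs U s h]
  refine hsum _ _ fun i _ => ?_
  have : degGE (EuclideanSpace ℝ (Fin n)) k ≤ Submodule.span ℝ {b | ∀ (f : U → ℝ)
      (hf : ContMDiff (𝓡 m) 𝓘(ℝ, ℝ) ∞ f),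
      ofFun n f hf * const m U b ∈ (trivSheaf m n M).oddIdealPow k U} :=
    degGE_le fun j hj b hb => Submodule.subset_span fun f hf => ofFun_mul_const_mem hj f hf hb
  have h2 := this (hb i)
  generalize b i = c at h2
  induction h2 using Submodule.span_induction with
  | zero => rw [map_zero, mul_zero]; exact TwoSidedIdeal.zero_mem _
  | add x y _ _ hx hy => rw [map_add, mul_add]; exact TwoSidedIdeal.add_mem _ hx hy
  | smul c x _ hx =>
    rw [map_smul, mul_smul_comm, Algebra.smul_def]
    exact TwoSidedIdeal.mul_mem_left _ _ _ hx
  | mem x hx => exact hx _ _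

end TrivSheaf

/-! ### Powers of the odd ideal and exterior degree -/

namespace SmoothVectorBundle

open ExteriorAlgebra

variable {m n : ℕ} {M : Type u} [TopologicalSpace M] [ChartedSpace (EuclideanSpace ℝ (Fin m)) M]

/-- Pointwise, `degGE k` is a two-sided ideal, odd elements lie in `degGE 1`, and the filtration is
multiplicative. -/
theorem evalAt_mem_degGE_of_mem_oddIdealPow (E : SmoothVectorBundle m n M) {k : ℕ} {U : Opens M}
    {s : E.extSheaf.Sec U} (h : s ∈ E.extSheaf.oddIdealPow k U) (x : U) :
    E.evalAt x s ∈ degGE (E.fiber x) k := by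
  let I (k : ℕ) : TwoSidedIdeal (ExteriorAlgebra ℝ (E.fiber x)) :=
    TwoSidedIdeal.mk' (degGE (E.fiber x) k) (Submodule.zero_mem _) (Submodule.add_mem _)
      (Submodule.neg_mem _)
      (fun {a b} hb => by simpa using mul_mem_degGE (k := 0) (by rw [degGE_zero]; trivial) hb)
      (fun {a b} ha => by simpa using mul_mem_degGE (l := 0) ha (by rw [degGE_zero]; trivial))
  have hI : ∀ k a, a ∈ I k ↔ a ∈ degGE (E.fiber x) k := fun k a => TwoSidedIdeal.mem_mk' _ _ _ _ _ _ a
  have h1 : E.extSheaf.oddIdeal U ≤ (I 1).comap (E.evalAt x) := by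
    refine TwoSidedIdeal.span_le.2 fun a ha => ?_
    exact (TwoSidedIdeal.mem_comap _).2 ((hI 1 _).2 (evenOdd_one_le (ha x)))
  have h2 : ∀ l : List (E.extSheaf.Sec U), (∀ b ∈ l, b ∈ E.extSheaf.oddIdeal U) →
      E.evalAt x l.prod ∈ degGE (E.fiber x) l.length := by
    intro l
    induction l with
    | nil => intro; rw [List.length_nil, degGE_zero]; trivial
    | cons a l ih =>
      intro hl
      rw [List.prod_cons, map_mul, List.length_cons, add_comm]
      exact mul_mem_degGE ((hI 1 _).1 ((TwoSidedIdeal.mem_comap _).1 (h1 (hl a (by simp)))))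
        (ih fun b hb => hl b (by simp [hb]))
  have h3 : E.extSheaf.oddIdealPow k U ≤ (I k).comap (E.evalAt x) := by
    refine TwoSidedIdeal.span_le.2 ?_
    rintro _ ⟨l, rfl, hl, rfl⟩
    exact (TwoSidedIdeal.mem_comap _).2 ((hI _ _).2 (h2 l hl))
  exact (hI _ _).1 ((TwoSidedIdeal.mem_comap _).1 (h3 h))

theorem evalAt_mem_degGE_of_mem_nilIdeal (E : SmoothVectorBundle m n M) {k : ℕ} {U : Opens M}
    {s : E.extSheaf.Sec U} (h : s ∈ E.extSheaf.nilIdeal k U) (x : U) :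
    E.evalAt x s ∈ degGE (E.fiber x) k := by
  obtain ⟨V, hxV, hV, h1⟩ := h x.1 x.2
  exact E.evalAt_mem_degGE_of_mem_oddIdealPow h1 ⟨x.1, hxV⟩

end SmoothVectorBundle

namespace TrivSheaf

open ExteriorAlgebra

variable {m n : ℕ} {M : Type u} [TopologicalSpace M] [ChartedSpace (EuclideanSpace ℝ (Fin m)) M]
  {U V : Opens M}

theorem mem_nilIdeal_iff {k : ℕ} {s : (trivSheaf m n M).Sec U} :
    s ∈ (trivSheaf m n M).nilIdeal k U ↔ ∀ x, eval x s ∈ degGE _ k :=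
  ⟨fun h x => (SmoothVectorBundle.trivial m n M).evalAt_mem_degGE_of_mem_nilIdeal h x,
    fun h _ hx => ⟨U, hx, le_rfl, mem_oddIdealPow_of_eval fun x => h ⟨x.1, x.2⟩⟩⟩

/-- A section of `C^∞ ⊗ Λₙ` is invertible near the points where its numerical part does not
vanish. -/
theorem exists_isUnit_res (s : (trivSheaf m n M).Sec U) (x : U)
    (h : algebraMapInv (eval x s) ≠ 0) :
    ∃ W : Opens M, x.1 ∈ W ∧ ∃ hW : W ≤ U, IsUnit ((trivSheaf m n M).res hW s) := by
  have hf := contMDiff_eval s algebraMapInv.toLinearMap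
  have hopen : IsOpen {y : U | algebraMapInv (eval y s) ≠ 0} :=
    isOpen_ne.preimage hf.continuous
  let W : Opens M := ⟨Subtype.val '' {y : U | algebraMapInv (eval y s) ≠ 0},
    U.2.isOpenMap_subtype_val _ hopen⟩
  have hW : W ≤ U := by rintro _ ⟨y, -, rfl⟩; exact y.2
  have hne : ∀ y : W, algebraMapInv (eval ⟨y.1, hW y.2⟩ s) ≠ 0 := by
    rintro ⟨_, y, hy, rfl⟩
    exact hy
  refine ⟨W, ⟨x, h, rfl⟩, hW, ?_⟩
  have hf' := contMDiff_eval ((trivSheaf m n M).res hW s) algebraMapInv.toLinearMap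
  have hinv : ContMDiff (𝓡 m) 𝓘(ℝ, ℝ) ∞
      (fun y : W => (algebraMapInv (eval y ((trivSheaf m n M).res hW s)))⁻¹) :=
    fun y => (hf' y).inv₀ (hne y)
  set t := (trivSheaf m n M).res hW s
  set a := ofFun n _ hf'
  set b := ofFun n _ hinv
  have hab : a * b = 1 := ext fun y => by
    simp only [a, b, map_mul, eval_ofFun, map_one]
    rw [← map_mul, ← map_one (algebraMap ℝ _)]
    exact congrArg _ (mul_inv_cancel₀ (hne y))
  have hba : b * a = 1 := ext fun y => by
    simp only [a, b, map_mul, eval_ofFun, map_one]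
    rw [← map_mul, ← map_one (algebraMap ℝ _)]
    exact congrArg _ (inv_mul_cancel₀ (hne y))
  -- The difference from the numerical part has degree at least one, so its power `n + 1` vanishes;
  -- a unit plus a commuting nilpotent is a unit.
  have hnil : IsNilpotent (t - a) := by
    refine ⟨n + 1, ext fun y => ?_⟩
    have h1 : eval y (t - a) ∈ degGE _ 1 := by
      rw [map_sub]
      exact sub_mem_degGE_one _
    have h2 : ∀ k, eval y (t - a) ^ k ∈ degGE _ k := by
      intro k
      induction k with
      | zero => rw [degGE_zero]; trivial
      | succ k ih => rw [pow_succ]; exact mul_mem_degGE ih h1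
    have h3 := h2 (n + 1)
    rw [degGE_eq_bot (by simp)] at h3
    rw [map_pow, map_zero]
    exact h3
  have hcomm : Commute (t - a) a := ext fun y => by
    simp only [map_mul, a, eval_ofFun]
    exact (Algebra.commutes _ _).symm
  have := hnil.isUnit_add_left_of_commute ⟨⟨a, b, hab, hba⟩, rfl⟩ hcomm
  simpa using this

/-- Every compatible family of real characters of the algebras of sections near `p` is the
evaluation at `p` of the numerical part. -/
theorem character_eq {W : Opens M} {p : M}
    (χ : ∀ V : Opens M, V ≤ W → p ∈ V → ((trivSheaf m n M).Sec V →ₐ[ℝ] ℝ))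
    (hχ : ∀ (V V' : Opens M) (h : V ≤ V') (hV' : V' ≤ W) (hp : p ∈ V)
      (s : (trivSheaf m n M).Sec V'),
      χ V (h.trans hV') hp ((trivSheaf m n M).res h s) = χ V' hV' (h hp) s)
    (V : Opens M) (hV : V ≤ W) (hp : p ∈ V) (s : (trivSheaf m n M).Sec V) :
    χ V hV hp s = algebraMapInv (eval ⟨p, hp⟩ s) := by
  -- If `χ s` differed from the numerical part at `p`, then `s - χ s` would be invertible near `p`
  -- although `χ` kills it.
  by_contra hne
  have h1 : algebraMapInv (eval ⟨p, hp⟩ (s - algebraMap ℝ _ (χ V hV hp s))) ≠ 0 := by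
    simp only [map_sub, AlgHom.commutes]
    exact sub_ne_zero.2 (Ne.symm hne)
  obtain ⟨V', hp', hV', hu⟩ := exists_isUnit_res _ _ h1
  have h2 := (hu.map (χ V' (hV'.trans hV) hp')).ne_zero
  rw [hχ V' V hV' hV hp'] at h2
  simp at h2

/-- A compatible family of linear maps which is compatible with the multiplication by functions
depends on the value at `p` only. -/
theorem apply_eq_const {W : Opens M} {p : M} {A : Type*} [AddCommGroup A] [Module ℝ A]
    (Θ : (trivSheaf m n M).Sec W →ₗ[ℝ] A) (hp : p ∈ W)
    (hΘ : ∀ (f : W → ℝ) (hf : ContMDiff (𝓡 m) 𝓘(ℝ, ℝ) ∞ f) (s : (trivSheaf m n M).Sec W),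
      Θ (ofFun n f hf * s) = f ⟨p, hp⟩ • Θ s)
    (s : (trivSheaf m n M).Sec W) : Θ s = Θ (const m W (eval ⟨p, hp⟩ s)) := by
  obtain ⟨r, b, l, -, hb, hs⟩ := exists_eq_sum (m := m) (M := M) (⊤ : Submodule ℝ (Lam n))
  conv_lhs => rw [hs W s fun _ => trivial, map_sum]
  conv_rhs => rw [hb _ (trivial : eval ⟨p, hp⟩ s ∈ _), map_sum, map_sum]
  refine Finset.sum_congr rfl fun i _ => ?_
  rw [hΘ, map_smul, map_smul]

end TrivSheaf


/-! ### Local frames of the exterior algebra bundle -/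

open ExteriorAlgebra in
theorem contMDiffAt_dual_mul {m n : ℕ} {N : Type*} [TopologicalSpace N]
    [ChartedSpace (EuclideanSpace ℝ (Fin m)) N] {a b : N → Lam n} {p : N}
    (ha : ∀ l : Module.Dual ℝ (Lam n), ContMDiffAt (𝓡 m) 𝓘(ℝ, ℝ) ∞ (fun x => l (a x)) p)
    (hb : ∀ l : Module.Dual ℝ (Lam n), ContMDiffAt (𝓡 m) 𝓘(ℝ, ℝ) ∞ (fun x => l (b x)) p)
    (l : Module.Dual ℝ (Lam n)) :
    ContMDiffAt (𝓡 m) 𝓘(ℝ, ℝ) ∞ (fun x => l (a x * b x)) p := by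
  let B := Module.finBasis ℝ (Lam n)
  have key : ∀ p q : Lam n,
      l (p * q) = ∑ i, ∑ j, B.coord i p * B.coord j q * l (B i * B j) := by
    intro p q
    conv_lhs => rw [← B.sum_repr p, ← B.sum_repr q, Finset.sum_mul_sum, map_sum]
    refine Finset.sum_congr rfl fun i _ => ?_
    rw [map_sum]
    refine Finset.sum_congr rfl fun j _ => ?_
    rw [smul_mul_smul_comm, map_smul, smul_eq_mul]
    rfl
  rw [show (fun x => l (a x * b x)) = _ from funext fun x => key (a x) (b x)]
  exact ContMDiffAt.sum fun i _ => ContMDiffAt.sum fun j _ =>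
    ((ha (B.coord i)).mul (hb (B.coord j))).mul contMDiffAt_const

/-- The matrix entries of `Λ f` are polynomials in those of `f`: smoothness holds on generators and
passes to sums and products, hence to a basis of `Λₙ`. -/
theorem contMDiffAt_dual_map {m n : ℕ} {N : Type*} [TopologicalSpace N]
    [ChartedSpace (EuclideanSpace ℝ (Fin m)) N]
    {f : N → EuclideanSpace ℝ (Fin n) →ₗ[ℝ] EuclideanSpace ℝ (Fin n)} {p : N}
    (hf : ∀ (v : EuclideanSpace ℝ (Fin n)) (l : Module.Dual ℝ (EuclideanSpace ℝ (Fin n))),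
      ContMDiffAt (𝓡 m) 𝓘(ℝ, ℝ) ∞ (fun x => l (f x v)) p) {t : N → Lam n}
    (ht : ∀ l : Module.Dual ℝ (Lam n), ContMDiffAt (𝓡 m) 𝓘(ℝ, ℝ) ∞ (fun x => l (t x)) p)
    (l : Module.Dual ℝ (Lam n)) :
    ContMDiffAt (𝓡 m) 𝓘(ℝ, ℝ) ∞ (fun x => l (ExteriorAlgebra.map (f x) (t x))) p := by
  have h1 : ∀ (a : Lam n) (l : Module.Dual ℝ (Lam n)),
      ContMDiffAt (𝓡 m) 𝓘(ℝ, ℝ) ∞ (fun x => l (ExteriorAlgebra.map (f x) a)) p := by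
    intro a
    induction a using ExteriorAlgebra.induction with
    | algebraMap r => intro l; simpa using contMDiffAt_const
    | ι v =>
      intro l
      simp only [ExteriorAlgebra.map_apply_ι]
      exact hf v (l ∘ₗ ExteriorAlgebra.ι ℝ)
    | mul a b ha hb => intro l; simpa only [map_mul] using contMDiffAt_dual_mul ha hb l
    | add a b ha hb => intro l; simp only [map_add]; exact (ha l).add (hb l)
  let B := Module.finBasis ℝ (Lam n)
  have key : ∀ x, l (ExteriorAlgebra.map (f x) (t x)) =
      ∑ i, B.coord i (t x) * l (ExteriorAlgebra.map (f x) (B i)) := by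
    intro x
    conv_lhs => rw [← B.sum_repr (t x), map_sum, map_sum]
    refine Finset.sum_congr rfl fun i _ => ?_
    rw [map_smul, map_smul, smul_eq_mul]
    rfl
  simp only [key]
  exact ContMDiffAt.sum fun i _ => (ht (B.coord i)).mul (h1 (B i) l)

theorem contMDiffAt_apply_of_clm {m n : ℕ} {N : Type*} [TopologicalSpace N]
    [ChartedSpace (EuclideanSpace ℝ (Fin m)) N]
    {f : N → EuclideanSpace ℝ (Fin n) →L[ℝ] EuclideanSpace ℝ (Fin n)} {p : N}
    (hf : ContMDiffAt (𝓡 m) 𝓘(ℝ, EuclideanSpace ℝ (Fin n) →L[ℝ] EuclideanSpace ℝ (Fin n)) ∞ f p)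
    (v : EuclideanSpace ℝ (Fin n)) (l : Module.Dual ℝ (EuclideanSpace ℝ (Fin n))) :
    ContMDiffAt (𝓡 m) 𝓘(ℝ, ℝ) ∞ (fun x => l (f x v)) p :=
  (((LinearMap.toContinuousLinearMap l).comp
    (ContinuousLinearMap.apply ℝ (EuclideanSpace ℝ (Fin n)) v)).contMDiff.contMDiffAt).comp p hf

/-- A family of matrices is smooth when its entries are; it is rebuilt from them as a sum of
rank-one operators. -/
theorem contMDiffAt_clm_of_apply {m n : ℕ} {N : Type*} [TopologicalSpace N]
    [ChartedSpace (EuclideanSpace ℝ (Fin m)) N]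
    {f : N → EuclideanSpace ℝ (Fin n) →L[ℝ] EuclideanSpace ℝ (Fin n)} {p : N}
    (hf : ∀ (v : EuclideanSpace ℝ (Fin n)) (l : Module.Dual ℝ (EuclideanSpace ℝ (Fin n))),
      ContMDiffAt (𝓡 m) 𝓘(ℝ, ℝ) ∞ (fun x => l (f x v)) p) :
    ContMDiffAt (𝓡 m) 𝓘(ℝ, EuclideanSpace ℝ (Fin n) →L[ℝ] EuclideanSpace ℝ (Fin n)) ∞ f p := by
  let B := (EuclideanSpace.basisFun (Fin n) ℝ).toBasis
  have key : ∀ x, f x = ∑ i, ∑ j, B.coord j (f x (B i)) •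
      (LinearMap.toContinuousLinearMap (B.coord i)).smulRight (B j) := by
    intro x
    ext1 v
    conv_lhs => rw [← B.sum_repr v, map_sum]
    simp only [sum_apply]
    refine Finset.sum_congr rfl fun i _ => ?_
    conv_lhs => rw [map_smul, ← B.sum_repr (f x (B i)), Finset.smul_sum]
    refine Finset.sum_congr rfl fun j _ => ?_
    rw [smul_apply, ContinuousLinearMap.smulRight_apply, smul_smul, smul_smul,
      mul_comm]
    rfl
  rw [show f = _ from funext key]
  exact ContMDiffAt.sum fun i _ => ContMDiffAt.sum fun j _ =>
    (hf (B i) (B.coord j)).smul contMDiffAt_const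

namespace SmoothVectorBundle

variable {m n : ℕ} {M : Type u} [TopologicalSpace M] [ChartedSpace (EuclideanSpace ℝ (Fin m)) M]
  (E : SmoothVectorBundle m n M)

/-- The preferred trivialization at `x₀`. -/
abbrev triv (x₀ : M) : Trivialization (EuclideanSpace ℝ (Fin n))
    (π (EuclideanSpace ℝ (Fin n)) E.fiber) :=
  trivializationAt (EuclideanSpace ℝ (Fin n)) E.fiber x₀

/-- The domain of the preferred trivialization at `x₀`. -/
def baseOpen (x₀ : M) : Opens M := ⟨(E.triv x₀).baseSet, (E.triv x₀).open_baseSet⟩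

theorem mem_baseOpen (x₀ : M) : x₀ ∈ E.baseOpen x₀ :=
  FiberBundle.mem_baseSet_trivializationAt' x₀

/-- The coordinates in the fibre at `x` given by the preferred trivialization at `x₀`. -/
def coordEquiv (x₀ : M) {x : M} (hx : x ∈ E.baseOpen x₀) :
    E.fiber x ≃ₗ[ℝ] EuclideanSpace ℝ (Fin n) :=
  (E.triv x₀).linearEquivAt ℝ x hx

theorem extCoord_eq (x₀ : M) {x : M} (hx : x ∈ E.baseOpen x₀) :
    E.extCoord x₀ x = ExteriorAlgebra.map (E.coordEquiv x₀ hx).toLinearMap := by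
  unfold extCoord
  rw [Trivialization.linearMapAt_def_of_mem _ hx]
  rfl

theorem map_symm_map {V W : Type*} [AddCommGroup V] [Module ℝ V] [AddCommGroup W] [Module ℝ W]
    (e : V ≃ₗ[ℝ] W) (a : ExteriorAlgebra ℝ V) :
    ExteriorAlgebra.map e.symm.toLinearMap (ExteriorAlgebra.map e.toLinearMap a) = a := by
  rw [← AlgHom.comp_apply, ExteriorAlgebra.map_comp_map]
  simp

theorem map_map_symm {V W : Type*} [AddCommGroup V] [Module ℝ V] [AddCommGroup W] [Module ℝ W]
    (e : V ≃ₗ[ℝ] W) (a : ExteriorAlgebra ℝ W) :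
    ExteriorAlgebra.map e.toLinearMap (ExteriorAlgebra.map e.symm.toLinearMap a) = a :=
  map_symm_map e.symm a

theorem contMDiffAt_coordChange (x₀ x₁ : M) {p : M} (h₀ : p ∈ E.baseOpen x₀)
    (h₁ : p ∈ E.baseOpen x₁) (v : EuclideanSpace ℝ (Fin n))
    (l : Module.Dual ℝ (EuclideanSpace ℝ (Fin n))) :
    ContMDiffAt (𝓡 m) 𝓘(ℝ, ℝ) ∞
      (fun x => l ((E.triv x₀).coordChangeL ℝ (E.triv x₁) x v)) p :=
  contMDiffAt_apply_of_clm (contMDiffAt_coordChangeL (IB := 𝓡 m) (n := ∞) h₀ h₁) v l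

theorem coordChangeL_coordEquiv (x₀ x₁ : M) {p : M} (h₀ : p ∈ E.baseOpen x₀)
    (h₁ : p ∈ E.baseOpen x₁) (v : E.fiber p) :
    (E.triv x₀).coordChangeL ℝ (E.triv x₁) p (E.coordEquiv x₀ h₀ v) = E.coordEquiv x₁ h₁ v := by
  rw [Trivialization.coordChangeL_apply _ _ ⟨h₀, h₁⟩]
  have : (E.triv x₀).symm p (E.coordEquiv x₀ h₀ v) = v :=
    (E.coordEquiv x₀ h₀).symm_apply_apply v
  rw [this]
  rfl

/-- `IsSmoothExt` tests a point only in its own preferred trivialization. Smoothness of the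
coordinate changes, carried through `Λ`, permits any other one. -/
theorem contMDiffAt_change {U : Opens M} (x₀ x₁ : M) {s : ∀ x : U, ExteriorAlgebra ℝ (E.fiber x)}
    {p : U} (h₀ : p.1 ∈ E.baseOpen x₀) (h₁ : p.1 ∈ E.baseOpen x₁)
    (h : ∀ l : Module.Dual ℝ (Lam n),
      ContMDiffAt (𝓡 m) 𝓘(ℝ, ℝ) ∞ (fun x : U => l (E.extCoord x₀ x (s x))) p)
    (l : Module.Dual ℝ (Lam n)) :
    ContMDiffAt (𝓡 m) 𝓘(ℝ, ℝ) ∞ (fun x : U => l (E.extCoord x₁ x (s x))) p := by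
  refine (contMDiffAt_dual_map (f := fun x : U =>
    ((E.triv x₀).coordChangeL ℝ (E.triv x₁) x.1 : _ →ₗ[ℝ] _)) (fun v l => ?_) h
      l).congr_of_eventuallyEq ?_
  · exact (contMDiffAt_subtype_iff (x := p)).2 (E.contMDiffAt_coordChange x₀ x₁ h₀ h₁ v l)
  · have h2 : ∀ᶠ x : U in nhds p, x.1 ∈ E.baseOpen x₀ ⊓ E.baseOpen x₁ :=
      continuous_subtype_val.continuousAt.eventually
        ((E.baseOpen x₀ ⊓ E.baseOpen x₁).2.mem_nhds ⟨h₀, h₁⟩)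
    filter_upwards [h2] with x hx
    rw [E.extCoord_eq x₀ hx.1, E.extCoord_eq x₁ hx.2, ← AlgHom.comp_apply,
      ExteriorAlgebra.map_comp_map]
    congr 3
    ext1 v
    exact (E.coordChangeL_coordEquiv x₀ x₁ hx.1 hx.2 v).symm

theorem contMDiff_extCoord {U : Opens M} (x₀ : M) (s : E.extSheaf.Sec U) {p : U}
    (hp : p.1 ∈ E.baseOpen x₀) (l : Module.Dual ℝ (Lam n)) :
    ContMDiffAt (𝓡 m) 𝓘(ℝ, ℝ) ∞ (fun x : U => l (E.extCoord x₀ x (E.evalAt x s))) p :=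
  E.contMDiffAt_change p.1 x₀ (E.mem_baseOpen p.1) hp (s.2 p) l

/-- The coordinates of sections in the preferred trivialization at `x₀`. -/
def frameHom (x₀ : M) {V : Opens M} (hV : V ≤ E.baseOpen x₀) :
    E.extSheaf.Sec V →ₐ[ℝ] (trivSheaf m n M).Sec V where
  toFun s := TrivSheaf.mk (fun x : V => E.extCoord x₀ x (E.evalAt x s))
    fun l x => E.contMDiff_extCoord x₀ s (hV x.2) l
  map_one' := TrivSheaf.ext fun x => by simp
  map_mul' s t := TrivSheaf.ext fun x =>
    map_mul (E.extCoord x₀ x.1) (E.evalAt x s) (E.evalAt x t)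
  map_zero' := TrivSheaf.ext fun x => by simp
  map_add' s t := TrivSheaf.ext fun x =>
    map_add (E.extCoord x₀ x.1) (E.evalAt x s) (E.evalAt x t)
  commutes' r := TrivSheaf.ext fun x => by simp

/-- The section with given coordinates in the preferred trivialization at `x₀`. -/
def frameInv (x₀ : M) {V : Opens M} (hV : V ≤ E.baseOpen x₀) :
    (trivSheaf m n M).Sec V →ₐ[ℝ] E.extSheaf.Sec V where
  toFun t := ⟨fun x : V => ExteriorAlgebra.map
      (E.coordEquiv x₀ (hV x.2)).symm.toLinearMap (TrivSheaf.eval x t), by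
    intro x
    refine E.contMDiffAt_change x₀ x.1 (hV x.2) (E.mem_baseOpen x.1) fun l => ?_
    refine (TrivSheaf.contMDiff_eval t l x).congr_of_eventuallyEq
      (Filter.Eventually.of_forall fun y => ?_)
    change l (E.extCoord x₀ y.1 _) = _
    rw [E.extCoord_eq x₀ (hV y.2), map_map_symm]⟩
  map_one' := sec_ext fun x => map_one
    (ExteriorAlgebra.map (E.coordEquiv x₀ (hV x.2)).symm.toLinearMap)
  map_mul' s t := sec_ext fun x => map_mul
    (ExteriorAlgebra.map (E.coordEquiv x₀ (hV x.2)).symm.toLinearMap) (TrivSheaf.eval x s)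
      (TrivSheaf.eval x t)
  map_zero' := sec_ext fun x => map_zero
    (ExteriorAlgebra.map (E.coordEquiv x₀ (hV x.2)).symm.toLinearMap)
  map_add' s t := sec_ext fun x => map_add
    (ExteriorAlgebra.map (E.coordEquiv x₀ (hV x.2)).symm.toLinearMap) (TrivSheaf.eval x s)
      (TrivSheaf.eval x t)
  commutes' r := sec_ext fun x =>
    (ExteriorAlgebra.map (E.coordEquiv x₀ (hV x.2)).symm.toLinearMap).commutes r

theorem eval_frameHom (x₀ : M) {V : Opens M} (hV : V ≤ E.baseOpen x₀) (s : E.extSheaf.Sec V)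
    (x : V) : TrivSheaf.eval x (E.frameHom x₀ hV s) =
      ExteriorAlgebra.map (E.coordEquiv x₀ (hV x.2)).toLinearMap (E.evalAt x s) := by
  rw [← E.extCoord_eq x₀ (hV x.2)]
  rfl

theorem evalAt_frameInv (x₀ : M) {V : Opens M} (hV : V ≤ E.baseOpen x₀)
    (t : (trivSheaf m n M).Sec V) (x : V) : E.evalAt x (E.frameInv x₀ hV t) =
      ExteriorAlgebra.map (E.coordEquiv x₀ (hV x.2)).symm.toLinearMap (TrivSheaf.eval x t) :=
  rfl

/-- The isomorphism `Γ(Λ E) ≅ C^∞ ⊗ Λₙ` given by the preferred trivialization at `x₀`. -/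
def frame (x₀ : M) : SuperPresheaf.IsoOn E.extSheaf (trivSheaf m n M) (E.baseOpen x₀) where
  equiv V hV := AlgEquiv.ofAlgHom (E.frameHom x₀ hV) (E.frameInv x₀ hV)
    (AlgHom.ext fun t => TrivSheaf.ext fun x => by
      rw [AlgHom.comp_apply, eval_frameHom, evalAt_frameInv, map_map_symm]
      rfl)
    (AlgHom.ext fun s => sec_ext fun x => by
      rw [AlgHom.comp_apply, evalAt_frameInv, eval_frameHom, map_symm_map]
      rfl)
  equiv_res _ _ _ _ _ := rfl
  parity_iff V hV i s := by
    rw [TrivSheaf.mem_parity_iff, mem_parity_iff]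
    refine forall_congr' fun x => ?_
    change TrivSheaf.eval x (E.frameHom x₀ hV s) ∈ _ ↔ _
    rw [eval_frameHom]
    refine ⟨fun h => ?_, ExteriorAlgebra.map_mem_evenOdd _⟩
    have := ExteriorAlgebra.map_mem_evenOdd (E.coordEquiv x₀ (hV x.2)).symm.toLinearMap h
    rwa [map_symm_map] at this

theorem eval_frame (x₀ : M) {V : Opens M} (hV : V ≤ E.baseOpen x₀) (s : E.extSheaf.Sec V)
    (x : V) : TrivSheaf.eval x ((E.frame x₀).equiv V hV s) =
      ExteriorAlgebra.map (E.coordEquiv x₀ (hV x.2)).toLinearMap (E.evalAt x s) :=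
  E.eval_frameHom x₀ hV s x

theorem evalAt_frame_symm (x₀ : M) {V : Opens M} (hV : V ≤ E.baseOpen x₀)
    (t : (trivSheaf m n M).Sec V) (x : V) :
    E.evalAt x (((E.frame x₀).equiv V hV).symm t) =
      ExteriorAlgebra.map (E.coordEquiv x₀ (hV x.2)).symm.toLinearMap (TrivSheaf.eval x t) :=
  E.evalAt_frameInv x₀ hV t x

/-- The sections of the `k`-th power of the odd ideal are those without components of degree less
than `k`. -/
theorem mem_nilIdeal_iff {k : ℕ} {U : Opens M} {s : E.extSheaf.Sec U} :
    s ∈ E.extSheaf.nilIdeal k U ↔ ∀ x : U, E.evalAt x s ∈ ExteriorAlgebra.degGE (E.fiber x.1) k := by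
  refine ⟨fun h => E.evalAt_mem_degGE_of_mem_nilIdeal h, fun h =>
    SuperPresheaf.mem_nilIdeal_of_locally fun x hx => ⟨U ⊓ E.baseOpen x,
      ⟨hx, E.mem_baseOpen x⟩, inf_le_left, ?_⟩⟩
  rw [← (E.frame x).mem_nilIdeal_iff k inf_le_right, TrivSheaf.mem_nilIdeal_iff]
  intro y
  rw [E.eval_frame]
  exact ExteriorAlgebra.map_mem_degGE _ (h ⟨y.1, y.2.1⟩)

end SmoothVectorBundle


/-! ### Local operators and the global Euler operator of a supermanifold -/

namespace SuperPresheaf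

variable {M : Type u} [TopologicalSpace M] {P Q : SuperPresheaf M}

/-- A linear endomorphism of the restriction of a presheaf to `W`. -/
structure LocalOp (P : SuperPresheaf M) (W : Opens M) where
  op (V : Opens M) (hV : V ≤ W) : Module.End ℝ (P.Sec V)
  op_res : ∀ (V V' : Opens M) (h : V ≤ V') (hV' : V' ≤ W) (s : P.Sec V'),
    op V (h.trans hV') (P.res h s) = P.res h (op V' hV' s)

/-- The value on a section over `V` is glued from `L` on `V ∩ W` and zero on `V ∩ C`. It is applied
to an operator multiplied by a cutoff, with `C` the complement of the support of the cutoff. -/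
theorem LocalOp.exists_zeroExt (hP : P.presheaf.IsSheaf) {W C : Opens M} (hWC : ⊤ ≤ W ⊔ C)
    (L : LocalOp P W) (hL : ∀ (V : Opens M) (hV : V ≤ W), V ≤ C → ∀ s, L.op V hV s = 0) :
    ∃ D : LocalOp P ⊤, (∀ (V : Opens M) (hV : V ≤ W) (s), D.op V le_top s = L.op V hV s) ∧
      ∀ V : Opens M, V ≤ C → ∀ s, D.op V le_top s = 0 := by
  classical
  have huniq : ∀ {V : Opens M} (t t' : P.Sec V), (∀ (V' : Opens M) (h : V' ≤ V),
      V' ≤ W ∨ V' ≤ C → P.res h t = P.res h t') → t = t' := by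
    intro V t t' h
    refine eq_of_locally hP _ _ fun x hx => ?_
    rcases hWC (show x ∈ (⊤ : Opens M) from trivial) with hxW | hxC
    · exact ⟨V ⊓ W, ⟨hx, hxW⟩, inf_le_left, h _ _ (Or.inl inf_le_right)⟩
    · exact ⟨V ⊓ C, ⟨hx, hxC⟩, inf_le_left, h _ _ (Or.inr inf_le_right)⟩
  have hex : ∀ (V : Opens M) (s : P.Sec V), ∃ t : P.Sec V, ∀ (V' : Opens M) (h : V' ≤ V),
      (∀ hW : V' ≤ W, P.res h t = L.op V' hW (P.res h s)) ∧ (V' ≤ C → P.res h t = 0) := by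
    intro V s
    -- Gluing over all admissible open subsets, instead of just two, gives the restriction formula
    -- on each of them at once.
    let I := {V' : Opens M // V' ≤ V ∧ (V' ≤ W ∨ V' ≤ C)}
    -- The default `0` is consistent: an index not inside `W` lies inside `C`, where the operator
    -- vanishes.
    let sf (i : I) : P.Sec i.1 := if h : i.1 ≤ W then L.op i.1 h (P.res i.2.1 s) else 0
    have hsf : ∀ (i : I) (V' : Opens M) (h : V' ≤ i.1),
        (∀ hW : V' ≤ W, P.res h (sf i) = L.op V' hW (P.res (h.trans i.2.1) s)) ∧
        (V' ≤ C → P.res h (sf i) = 0) := by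
      intro i V' h
      by_cases hi : i.1 ≤ W
      · have h1 : P.res h (sf i) = L.op V' (h.trans hi) (P.res (h.trans i.2.1) s) := by
          simp only [sf, dif_pos hi, ← L.op_res V' i.1 h hi, res_res]
        exact ⟨fun _ => h1, fun hC => h1.trans (hL _ _ hC _)⟩
      · have h1 : P.res h (sf i) = 0 := by
          simp only [sf, dif_neg hi, map_zero]
        exact ⟨fun hW => h1.trans (hL _ _ (h.trans (i.2.2.resolve_left hi)) _).symm, fun _ => h1⟩
    obtain ⟨t, ht⟩ := exists_glue hP (fun i : I => i.1) V (fun i => i.2.1) (by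
      intro x hx
      rcases hWC (show x ∈ (⊤ : Opens M) from trivial) with hxW | hxC
      · exact Opens.mem_iSup.2 ⟨⟨V ⊓ W, inf_le_left, Or.inl inf_le_right⟩, hx, hxW⟩
      · exact Opens.mem_iSup.2 ⟨⟨V ⊓ C, inf_le_left, Or.inr inf_le_right⟩, hx, hxC⟩) sf (by
      intro i j
      by_cases hi : i.1 ≤ W
      · rw [(hsf i _ inf_le_left).1 (inf_le_left.trans hi),
          (hsf j _ inf_le_right).1 (inf_le_left.trans hi)]
      · have hC : i.1 ≤ C := i.2.2.resolve_left hi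
        rw [(hsf i _ inf_le_left).2 (inf_le_left.trans hC),
          (hsf j _ inf_le_right).2 (inf_le_left.trans hC)])
    refine ⟨t, fun V' h => ⟨fun hW => ?_, fun hC => ?_⟩⟩
    · have h1 := ht ⟨V', h, Or.inl hW⟩
      rw [h1]
      simpa only [res_self] using (hsf ⟨V', h, Or.inl hW⟩ V' le_rfl).1 hW
    · have h1 := ht ⟨V', h, Or.inr hC⟩
      rw [h1]
      simpa only [res_self] using (hsf ⟨V', h, Or.inr hC⟩ V' le_rfl).2 hC
  choose t ht using hex
  refine ⟨⟨fun V _ => { toFun := t V, map_add' := fun a b => ?_, map_smul' := fun c a => ?_ },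
    fun V V' h _ s => ?_⟩, fun V hV s => ?_, fun V hV s => ?_⟩
  · refine huniq _ _ fun V' h hV' => ?_
    rcases hV' with hW | hC
    · simp only [map_add, (ht _ _ V' h).1 hW]
    · simp only [map_add, (ht _ _ V' h).2 hC, add_zero]
  · refine huniq _ _ fun V' h hV' => ?_
    rcases hV' with hW | hC
    · simp only [map_smul, (ht _ _ V' h).1 hW, RingHom.id_apply]
    · simp only [map_smul, (ht _ _ V' h).2 hC, smul_zero]
  · refine huniq _ _ fun V'' h' hV' => ?_
    rw [LinearMap.coe_mk, AddHom.coe_mk, LinearMap.coe_mk, AddHom.coe_mk, res_res]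
    rcases hV' with hW | hC
    · simp only [(ht _ _ V'' _).1 hW, res_res]
    · simp only [(ht _ _ V'' _).2 hC]
  · change t V s = _
    simpa only [res_self] using (ht V s V le_rfl).1 hV
  · change t V s = _
    simpa only [res_self] using (ht V s V le_rfl).2 hV

end SuperPresheaf

/-! ### Cut-off operators in a chart -/

namespace TrivSheaf

open ExteriorAlgebra SuperPresheaf

variable {m n : ℕ} {M : Type u} [TopologicalSpace M] [ChartedSpace (EuclideanSpace ℝ (Fin m)) M]
  {U V : Opens M}

/-- The restriction to `V` of a smooth function, as a section of `C^∞ ⊗ Λₙ`. -/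
def resFun (n : ℕ) (ρ : M → ℝ) (hρ : ContMDiff (𝓡 m) 𝓘(ℝ, ℝ) ∞ ρ) (V : Opens M) :
    (trivSheaf m n M).Sec V :=
  ofFun n (fun x : V => ρ x) (hρ.comp contMDiff_subtype_val)

theorem ofFun_mul_comm (f : U → ℝ) (hf) (s : (trivSheaf m n M).Sec U) :
    ofFun n f hf * s = s * ofFun n f hf :=
  ext fun x => by
    simp only [map_mul, eval_ofFun]
    exact Algebra.commutes _ _

/-- The operator `s ↦ ρ · L s`, in a local trivialization `τ` of a superalgebra presheaf. -/
def chartOp {P : SuperPresheaf M} (τ : IsoOn (trivSheaf m n M) P U) (ρ : M → ℝ)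
    (hρ : ContMDiff (𝓡 m) 𝓘(ℝ, ℝ) ∞ ρ) (L : Lam n →ₗ[ℝ] Lam n) : LocalOp P U where
  op V hV := (τ.equiv V hV).toLinearMap ∘ₗ LinearMap.mulLeft ℝ (resFun n ρ hρ V) ∘ₗ mapVal L ∘ₗ
    (τ.equiv V hV).symm.toLinearMap
  op_res V V' h hV' s := by
    simp only [LinearMap.comp_apply, AlgEquiv.toLinearMap_apply, LinearMap.mulLeft_apply]
    rw [τ.symm_res h hV', ← res_mapVal, ← τ.equiv_res V V' h hV',
      map_mul ((trivSheaf m n M).res h)]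
    rfl

theorem chartOp_apply {P : SuperPresheaf M} (τ : IsoOn (trivSheaf m n M) P U) (ρ : M → ℝ)
    (hρ : ContMDiff (𝓡 m) 𝓘(ℝ, ℝ) ∞ ρ) (L : Lam n →ₗ[ℝ] Lam n) (hV : V ≤ U) (s : P.Sec V) :
    (chartOp τ ρ hρ L).op V hV s =
      τ.equiv V hV (resFun n ρ hρ V * mapVal L ((τ.equiv V hV).symm s)) := rfl

theorem chartOp_eq_zero {P : SuperPresheaf M} (τ : IsoOn (trivSheaf m n M) P U) (ρ : M → ℝ)
    (hρ : ContMDiff (𝓡 m) 𝓘(ℝ, ℝ) ∞ ρ) (L : Lam n →ₗ[ℝ] Lam n) (hV : V ≤ U)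
    (h : ∀ x ∈ V, ρ x = 0) (s : P.Sec V) : (chartOp τ ρ hρ L).op V hV s = 0 := by
  have : resFun n ρ hρ V = 0 := ext fun x => by
    rw [resFun, eval_ofFun, h x x.2, map_zero, map_zero]
  rw [chartOp_apply, this, zero_mul, map_zero]

/-- Taking the numerical part in either chart gives a compatible family of characters, and
`character_eq` leaves only one. Hence the numerical part of a section does not depend on the chart.
-/
theorem character_symm {P : SuperPresheaf M} {U' : Opens M} (τ : IsoOn (trivSheaf m n M) P U)
    (τ' : IsoOn (trivSheaf m n M) P U') (hV : V ≤ U) (hV' : V ≤ U') (x : V)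
    (s : (trivSheaf m n M).Sec V) :
    algebraMapInv (eval x ((τ'.equiv V hV').symm (τ.equiv V hV s))) =
      algebraMapInv (eval x s) :=
  character_eq (W := V) (p := x.1)
    (fun W hW hp => algebraMapInv.comp ((eval ⟨x.1, hp⟩).comp
      ((τ'.equiv W (hW.trans hV')).symm.toAlgHom.comp (τ.equiv W (hW.trans hV)).toAlgHom)))
    (fun W W' h hW' hp t => by
      have h1 := τ.equiv_res W W' h (hW'.trans hV) t
      have h2 := τ'.symm_res h (hW'.trans hV') (τ.equiv W' (hW'.trans hV) t)
      simp only [AlgHom.comp_apply, AlgEquiv.toAlgHom_apply]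
      rw [h1, h2]
      rfl) V le_rfl x.2 s

end TrivSheaf

namespace SuperSpace

open ExteriorAlgebra SuperPresheaf TrivSheaf

variable {m n : ℕ} {X : SuperSpace.{u} m}

theorem IsSupermanifold.isCompl_parity (hX : X.IsSupermanifold n) (V : Opens X.carrier)
    (i : ZMod 2) : IsCompl (X.O.parity V i) (X.O.parity V (i + 1)) := by
  refine (DirectSum.isInternal_submodule_iff_isCompl (X.O.parity V) (by simp) ?_).1
    (hX.isInternal V)
  ext j
  revert i j
  simp only [Set.mem_univ, Set.mem_insert_iff, Set.mem_singleton_iff, true_iff]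
  decide

/-- The component of the opposite parity vanishes locally, hence vanishes by the sheaf property. -/
theorem IsSupermanifold.mem_parity_of_locally (hX : X.IsSupermanifold n) {V : Opens X.carrier}
    {i : ZMod 2} {s : X.O.Sec V} (h : ∀ x ∈ V, ∃ W : Opens X.carrier, x ∈ W ∧
      ∃ hW : W ≤ V, X.O.res hW s ∈ X.O.parity W i) : s ∈ X.O.parity V i := by
  obtain ⟨a, b, ha, hb, rfl⟩ := Submodule.codisjoint_iff_exists_add_eq.1
    (hX.isCompl_parity V i).codisjoint s
  have hb0 : b = 0 := by
    refine eq_of_locally hX.isSheaf _ _ fun x hx => ?_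
    obtain ⟨W, hxW, hW, h1⟩ := h x hx
    refine ⟨W, hxW, hW, ?_⟩
    rw [map_zero]
    refine Submodule.disjoint_def.1 (hX.isCompl_parity W i).disjoint _ ?_
      (X.O.map_parity W V hW (i + 1) b hb)
    rw [map_add] at h1
    exact (Submodule.add_mem_iff_right _ (X.O.map_parity W V hW i a ha)).1 h1
  rw [hb0, add_zero]
  exact ha

/-- A family of local trivializations indexed by the points. -/
theorem IsSupermanifold.exists_charts (hX : X.IsSupermanifold n) :
    ∃ U : X.carrier → Opens X.carrier, (∀ x, x ∈ U x) ∧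
      Nonempty (∀ x, IsoOn (trivSheaf m n X.carrier) X.O (U x)) := by
  choose U hU hτ using hX.locally_split
  exact ⟨U, hU, ⟨fun x => (hτ x).some⟩⟩

/-- On a compact supermanifold there is a global even derivation which acts as multiplication by
`k` on `J ^ k / J ^ (k + 1)`. -/
theorem IsSupermanifold.exists_euler [CompactSpace X.carrier] (hX : X.IsSupermanifold n) :
    ∃ D : LocalOp X.O ⊤,
      (∀ (V : Opens X.carrier) (a b : X.O.Sec V),
        D.op V le_top (a * b) = D.op V le_top a * b + a * D.op V le_top b) ∧
      (∀ (V : Opens X.carrier) (i : ZMod 2), ∀ a ∈ X.O.parity V i,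
        D.op V le_top a ∈ X.O.parity V i) ∧
      ∀ (V : Opens X.carrier) (k : ℕ), ∀ a ∈ X.O.nilIdeal k V,
        D.op V le_top a - (k : ℝ) • a ∈ X.O.nilIdeal (k + 1) V := by
  classical
  have := hX.isManifold
  have := hX.t2
  obtain ⟨U, hU, ⟨τ⟩⟩ := hX.exists_charts
  obtain ⟨t, ht⟩ := CompactSpace.elim_nhds_subcover (fun x => (U x : Set X.carrier))
    fun x => (U x).2.mem_nhds (hU x)
  obtain ⟨f, hf⟩ := SmoothPartitionOfUnity.exists_isSubordinate (𝓡 m)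
    (isClosed_univ (X := X.carrier)) (fun i : t => (U i.1 : Set X.carrier)) (fun i => (U i.1).2)
    (by
      rw [← Set.top_eq_univ, ← ht]
      intro x hx
      obtain ⟨i, hi, hx⟩ := Set.mem_iUnion₂.1 hx
      exact Set.mem_iUnion.2 ⟨⟨i, hi⟩, hx⟩)
  let C (i : t) : Opens X.carrier := ⟨(tsupport (f i))ᶜ, (isClosed_tsupport _).isOpen_compl⟩
  have hC : ∀ (i : t) (x), x ∈ C i → f i x = 0 := fun i x hx => image_eq_zero_of_notMem_tsupport hx
  have hsum : ∀ x, ∑ i : t, f i x = 1 := by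
    intro x
    rw [← finsum_eq_sum_of_fintype]
    exact f.sum_eq_one (Set.mem_univ x)
  have hUC : ∀ i, (⊤ : Opens X.carrier) ≤ U i.1 ⊔ C i := by
    intro i x _
    by_cases hx : x ∈ tsupport (f i)
    · exact Or.inl (hf i hx)
    · exact Or.inr hx
  have hext : ∀ (L : Lam n →ₗ[ℝ] Lam n) (i : t), ∃ D : LocalOp X.O ⊤,
      (∀ (V : Opens X.carrier) (hV : V ≤ U i.1) (s), D.op V le_top s =
        (chartOp (τ i.1) (f i) (f i).contMDiff L).op V hV s) ∧
      ∀ V : Opens X.carrier, V ≤ C i → ∀ s, D.op V le_top s = 0 := fun L i =>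
    LocalOp.exists_zeroExt hX.isSheaf (hUC i) _ fun V hV hVC s =>
      chartOp_eq_zero _ _ _ _ _ (fun x hx => hC i x (hVC hx)) s
  -- In chart `i`, `D i` is the cutoff `f i` times the Euler operator and `R i` is multiplication by
  -- `f i`. Smooth functions have no canonical action on `O`, so the operators `R i` record what
  -- each chart means by such a product.
  choose D hDU hDC using hext (euler _)
  choose R hRU hRC using hext LinearMap.id
  -- small neighbourhoods
  have hgood : ∀ (V : Opens X.carrier) (x), x ∈ V → ∃ W : Opens X.carrier, x ∈ W ∧ W ≤ V ∧
      W ≤ U x ∧ ∀ i : t, W ≤ U i.1 ∨ W ≤ C i := by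
    intro V x hx
    -- For each `i` the neighbourhood lies either in the chart, where the formulas for `D i` and `R
    -- i` apply, or off the support of `f i`, where both vanish.
    let G (i : t) : Opens X.carrier := if x ∈ U i.1 then U i.1 else C i
    have hG : ∀ i, x ∈ G i := by
      intro i
      by_cases h : x ∈ U i.1
      · simpa only [G, if_pos h] using h
      · simp only [G, if_neg h]
        exact (hUC i (show x ∈ (⊤ : Opens _) from trivial)).resolve_left h
    refine ⟨V ⊓ U x ⊓ ⟨⋂ i, (G i : Set X.carrier), isOpen_iInter_of_finite fun i => (G i).2⟩,
      ⟨⟨hx, hU x⟩, Set.mem_iInter.2 hG⟩, inf_le_left.trans inf_le_left,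
      inf_le_left.trans inf_le_right, fun i => ?_⟩
    have h1 : V ⊓ U x ⊓ ⟨⋂ i, (G i : Set X.carrier), isOpen_iInter_of_finite fun i => (G i).2⟩ ≤
        G i := fun y hy => Set.mem_iInter.1 hy.2 i
    by_cases h : x ∈ U i.1
    · exact Or.inl (by simpa only [G, if_pos h] using h1)
    · exact Or.inr (by simpa only [G, if_neg h] using h1)
  let DD : LocalOp X.O ⊤ := ⟨fun V hV => ∑ i, (D i).op V hV, fun V V' h hV' s => by
    simp only [LinearMap.sum_apply, map_sum, ← (D _).op_res V V' h hV']⟩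
  have hDD : ∀ V s, DD.op V le_top s = ∑ i, (D i).op V le_top s := fun V s =>
    LinearMap.sum_apply _ _ _
  refine ⟨DD, fun V a b => ?_, fun V i a ha => ?_, fun V k a ha => ?_⟩
  · refine eq_of_locally hX.isSheaf _ _ fun x hx => ?_
    obtain ⟨W, hxW, hWV, -, hW⟩ := hgood V x hx
    refine ⟨W, hxW, hWV, ?_⟩
    rw [map_add, map_mul (X.O.res hWV) _ b, map_mul (X.O.res hWV) a, ← DD.op_res W V hWV,
      ← DD.op_res W V hWV, ← DD.op_res W V hWV, map_mul (X.O.res hWV), hDD, hDD, hDD, Finset.sum_mul, Finset.mul_sum,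
      ← Finset.sum_add_distrib]
    refine Finset.sum_congr rfl fun i _ => ?_
    generalize X.O.res hWV a = a
    generalize X.O.res hWV b = b
    rcases hW i with h | h
    · rw [hDU i W h, hDU i W h, hDU i W h, chartOp_apply, chartOp_apply, chartOp_apply]
      obtain ⟨a, rfl⟩ := ((τ i.1).equiv W h).surjective a
      obtain ⟨b, rfl⟩ := ((τ i.1).equiv W h).surjective b
      rw [← map_mul, AlgEquiv.symm_apply_apply, AlgEquiv.symm_apply_apply,
        AlgEquiv.symm_apply_apply, ← map_mul, ← map_mul, ← map_add]
      congr 1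
      -- The cutoff is central, so it moves to the front and leaves the Leibniz rule of `euler`.
      rw [resFun, ← mul_assoc a, ← ofFun_mul_comm, mul_assoc, mul_assoc, ← mul_add]
      congr 1
      refine TrivSheaf.ext fun x => ?_
      simp [euler_mul]
    · rw [hDC i W h, hDC i W h, hDC i W h, zero_mul, mul_zero, add_zero]
  · refine hX.mem_parity_of_locally fun x hx => ?_
    obtain ⟨W, hxW, hWV, -, hW⟩ := hgood V x hx
    refine ⟨W, hxW, hWV, ?_⟩
    rw [← DD.op_res W V hWV, hDD]
    refine Submodule.sum_mem _ fun j _ => ?_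
    have ha' := X.O.map_parity W V hWV i a ha
    change X.O.res hWV a ∈ _ at ha'
    generalize X.O.res hWV a = a at ha'
    rcases hW j with h | h
    · rw [hDU j W h, chartOp_apply, (τ j.1).parity_iff, TrivSheaf.mem_parity_iff]
      obtain ⟨a, rfl⟩ := ((τ j.1).equiv W h).surjective a
      rw [(τ j.1).parity_iff, TrivSheaf.mem_parity_iff] at ha'
      intro x
      rw [AlgEquiv.symm_apply_apply, map_mul, resFun, eval_ofFun, ← Algebra.smul_def]
      exact Submodule.smul_mem _ _ (euler_mem_evenOdd (ha' x))
    · rw [hDC j W h]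
      exact Submodule.zero_mem _
  · refine mem_nilIdeal_of_locally fun x hx => ?_
    obtain ⟨W, hxW, hWV, hWx, hW⟩ := hgood V x hx
    refine ⟨W, hxW, hWV, ?_⟩
    have ha' := X.O.res_mem_nilIdeal k hWV a ha
    rw [map_sub, map_smul, ← DD.op_res W V hWV, hDD]
    generalize X.O.res hWV a = a at ha'
    -- The sum of the `R i` is multiplication by a section whose numerical part is `∑ f i = 1`. It
    -- therefore differs from the identity by multiplication by an element of `J`, which maps `J^k`
    -- into `J^(k+1)`.
    have hR : ∑ i, (R i).op W le_top a - a ∈ X.O.nilIdeal (k + 1) W := by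
      have hmul : ∀ i, (R i).op W le_top a = (R i).op W le_top 1 * a := by
        intro i
        rcases hW i with h | h
        · rw [hRU i W h, hRU i W h, chartOp_apply, chartOp_apply]
          obtain ⟨a, rfl⟩ := ((τ i.1).equiv W h).surjective a
          rw [← map_mul, AlgEquiv.symm_apply_apply, map_one]
          congr 1
          refine TrivSheaf.ext fun x => ?_
          simp
        · rw [hRC i W h, hRC i W h, zero_mul]
      simp only [hmul]
      rw [← Finset.sum_mul]
      obtain ⟨a, rfl⟩ := ((τ x).equiv W hWx).surjective a
      obtain ⟨r, hr⟩ := ((τ x).equiv W hWx).surjective (∑ i, (R i).op W le_top 1)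
      have hr1 : ∀ y : W, algebraMapInv (eval y r) = 1 := by
        intro y
        have h1 : r = ∑ i, ((τ x).equiv W hWx).symm ((R i).op W le_top 1) := by
          rw [← map_sum, ← hr, AlgEquiv.symm_apply_apply]
        rw [h1, map_sum, map_sum, ← hsum y.1]
        refine Finset.sum_congr rfl fun i _ => ?_
        rcases hW i with h | h
        · rw [hRU i W h, chartOp_apply, character_symm, map_one, map_mul, resFun, eval_ofFun]
          simp
        · rw [hRC i W h, map_zero, map_zero, map_zero, hC i y.1 (h y.2)]
      rw [← hr, ← map_mul, ← map_sub, (τ x).mem_nilIdeal_iff, TrivSheaf.mem_nilIdeal_iff]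
      rw [(τ x).mem_nilIdeal_iff, TrivSheaf.mem_nilIdeal_iff] at ha'
      intro y
      have h2 : eval y (r - 1) ∈ degGE _ 1 := by
        rw [mem_degGE_one_iff, map_sub, map_one, map_sub, map_one, hr1, sub_self]
      have h3 := mul_mem_degGE h2 (ha' y)
      rw [add_comm 1 k] at h3
      simpa [sub_mul] using h3
    have hDR : ∑ i, ((D i).op W le_top a - (k : ℝ) • (R i).op W le_top a) ∈
        X.O.nilIdeal (k + 1) W := by
      refine sum_mem fun i _ => ?_
      rcases hW i with h | h
      · rw [hDU i W h, hRU i W h, chartOp_apply, chartOp_apply]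
        obtain ⟨a, rfl⟩ := ((τ i.1).equiv W h).surjective a
        rw [(τ i.1).mem_nilIdeal_iff, TrivSheaf.mem_nilIdeal_iff] at ha'
        rw [← map_smul, ← map_sub, (τ i.1).mem_nilIdeal_iff, TrivSheaf.mem_nilIdeal_iff]
        intro y
        rw [AlgEquiv.symm_apply_apply, ← mul_smul_comm, ← mul_sub, map_mul, resFun, eval_ofFun,
          ← Algebra.smul_def]
        exact Submodule.smul_mem _ _ (by simpa using isEuler_euler.symbol (ha' y))
      · rw [hDC i W h, hRC i W h, smul_zero, sub_zero]
        exact Submodule.zero_mem _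
    have hk : (k : ℝ) • (∑ i, (R i).op W le_top a - a) ∈ X.O.nilIdeal (k + 1) W := by
      rw [Algebra.smul_def]
      exact Ideal.mul_mem_left _ _ hR
    -- `∑ D i a - k a = ∑ (D i a - k R i a) + k (∑ R i a - a)`.
    convert Ideal.add_mem _ hDR hk using 1
    rw [Finset.sum_sub_distrib, smul_sub, Finset.smul_sum]
    abel

end SuperSpace


/-! ### Graded atlases and the associated vector bundle -/

namespace TrivSheaf

open ExteriorAlgebra SuperPresheaf

variable {m n : ℕ} {M : Type u} [TopologicalSpace M] [ChartedSpace (EuclideanSpace ℝ (Fin m)) M]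
  {U V : Opens M}

variable (m n V) in
/-- The filtration of the sections of `C^∞ ⊗ Λₙ` by the powers of the odd ideal. -/
def filt (k : ℕ) : Submodule ℝ ((trivSheaf m n M).Sec V) :=
  ((trivSheaf m n M).nilIdeal k V).restrictScalars ℝ

theorem mem_filt {k : ℕ} {s : (trivSheaf m n M).Sec V} :
    s ∈ filt m n V k ↔ ∀ x, eval x s ∈ degGE _ k := mem_nilIdeal_iff

theorem isNilFiltration_filt : IsNilFiltration n (filt m n V) where
  anti k l h s hs := mem_filt.2 fun x => degGE_anti h (mem_filt.1 hs x)
  zero := eq_top_iff.2 fun s _ => mem_filt.2 fun x => by rw [degGE_zero]; trivial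
  last := by
    refine eq_bot_iff.2 fun s hs => ext fun x => ?_
    have := mem_filt.1 hs x
    rw [degGE_eq_bot (by simp)] at this
    rw [map_zero]
    exact this
  mul ha hb := mem_filt.2 fun x => by
    rw [map_mul]
    exact mul_mem_degGE (mem_filt.1 ha x) (mem_filt.1 hb x)

theorem isEuler_mapVal : IsEuler (filt m n V) (mapVal (euler (EuclideanSpace ℝ (Fin n)))) where
  leibniz a b := ext fun x => by simp [euler_mul]
  symbol ha := mem_filt.2 fun x => by simpa using isEuler_euler.symbol (mem_filt.1 ha x)

end TrivSheaf

namespace SuperPresheaf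

open ExteriorAlgebra TrivSheaf

variable {m n : ℕ} {M : Type u} [TopologicalSpace M] [ChartedSpace (EuclideanSpace ℝ (Fin m)) M]
  {P : SuperPresheaf M} {U V : Opens M}

/-- An operator on sections, in a local trivialization. -/
def LocalOp.pull (D : LocalOp P ⊤) (τ : IsoOn (trivSheaf m n M) P U) (hV : V ≤ U) :
    Module.End ℝ ((trivSheaf m n M).Sec V) :=
  (τ.equiv V hV).symm.toLinearMap ∘ₗ D.op V le_top ∘ₗ (τ.equiv V hV).toLinearMap

theorem LocalOp.pull_apply (D : LocalOp P ⊤) (τ : IsoOn (trivSheaf m n M) P U) (hV : V ≤ U)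
    (s : (trivSheaf m n M).Sec V) :
    D.pull τ hV s = (τ.equiv V hV).symm (D.op V le_top (τ.equiv V hV s)) := rfl

theorem LocalOp.res_pull (D : LocalOp P ⊤) (τ : IsoOn (trivSheaf m n M) P U) {W : Opens M}
    (h : V ≤ W) (hW : W ≤ U) (s : (trivSheaf m n M).Sec W) :
    (trivSheaf m n M).res h (D.pull τ hW s) =
      D.pull τ (h.trans hW) ((trivSheaf m n M).res h s) := by
  rw [D.pull_apply, D.pull_apply, ← τ.symm_res h hW, τ.equiv_res V W h hW, ← D.op_res V W h]

/-- Every local trivialization can be made compatible with the degrees. -/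
theorem IsoOn.exists_graded (D : LocalOp P ⊤)
    (hD : ∀ (V : Opens M) (a b : P.Sec V),
        D.op V le_top (a * b) = D.op V le_top a * b + a * D.op V le_top b)
    (hpar : ∀ (V : Opens M) (i : ZMod 2), ∀ a ∈ P.parity V i, D.op V le_top a ∈ P.parity V i)
    (hsymb : ∀ (V : Opens M) (k : ℕ), ∀ a ∈ P.nilIdeal k V,
        D.op V le_top a - (k : ℝ) • a ∈ P.nilIdeal (k + 1) V)
    (τ : IsoOn (trivSheaf m n M) P U) :
    ∃ τ' : IsoOn (trivSheaf m n M) P U, ∀ (V : Opens M) (hV : V ≤ U) (s),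
      τ'.equiv V hV (mapVal (euler _) s) = D.op V le_top (τ'.equiv V hV s) := by
  -- Transported to the chart, `D` has the same symbol as the standard Euler operator, so the two
  -- can be conjugated.
  have hE : ∀ (V : Opens M) (hV : V ≤ U), IsEuler (filt m n V) (D.pull τ hV) := by
    intro V hV
    refine ⟨fun a b => ?_, fun {k a} ha => ?_⟩
    · simp only [D.pull_apply, map_mul, hD, map_add, AlgEquiv.symm_apply_apply]
    · change _ ∈ (trivSheaf m n M).nilIdeal (k + 1) V
      rw [← τ.mem_nilIdeal_iff (k + 1) hV, map_sub, map_smul, D.pull_apply,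
        AlgEquiv.apply_symm_apply]
      exact hsymb V k _ (τ.mem_nilIdeal k hV ha)
  -- The new chart is the old one preceded by the conjugation of the standard Euler operator into
  -- the transported `D`. Both operators commute with restriction and preserve parity, so the
  -- conjugation does too.
  refine ⟨⟨fun V hV => (isEuler_mapVal.conjEquiv isNilFiltration_filt (hE V hV)).trans
    (τ.equiv V hV), fun V W h hW s => ?_, fun V hV i s => ?_⟩, fun V hV s => ?_⟩
  · rw [AlgEquiv.trans_apply, AlgEquiv.trans_apply, ← τ.equiv_res V W h hW]
    congr 1
    exact (eulerConj_comm ((trivSheaf m n M).res h).toLinearMap (fun a => res_mapVal h _ a)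
      (fun a => D.res_pull τ h hW a) s).symm
  · rw [AlgEquiv.trans_apply, τ.parity_iff]
    refine IsEuler.conjEquiv_mem_iff _ _ _ (fun a ha => ?_) fun a ha => ?_
    · exact TrivSheaf.mem_parity_iff.2 fun x => euler_mem_evenOdd (TrivSheaf.mem_parity_iff.1 ha x)
    · rw [← τ.parity_iff V hV, D.pull_apply, AlgEquiv.apply_symm_apply]
      exact hpar V i _ ((τ.parity_iff V hV i a).2 ha)
  · rw [AlgEquiv.trans_apply, AlgEquiv.trans_apply, IsEuler.conjEquiv_apply,
      IsEuler.conjEquiv_apply,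
      isEuler_mapVal.eulerConj_intertwine isNilFiltration_filt (hE V hV), D.pull_apply,
      AlgEquiv.apply_symm_apply]

/-- A family of local trivializations with transition maps which preserve the degree. -/
structure GradedAtlas (m n : ℕ) {M : Type u} [TopologicalSpace M]
    [ChartedSpace (EuclideanSpace ℝ (Fin m)) M] (P : SuperPresheaf M) where
  U : M → Opens M
  mem_U : ∀ x, x ∈ U x
  τ : ∀ x, IsoOn (trivSheaf m n M) P (U x)
  graded : ∀ (x y : M) (V : Opens M) (hx : V ≤ U x) (hy : V ≤ U y) (s),
    ((τ y).equiv V hy).symm ((τ x).equiv V hx (mapVal (euler _) s)) =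
      mapVal (euler _) (((τ y).equiv V hy).symm ((τ x).equiv V hx s))

namespace GradedAtlas

variable (A : GradedAtlas m n P)

/-- The transition maps. -/
def change (x y : M) {V : Opens M} (hx : V ≤ A.U x) (hy : V ≤ A.U y) :
    (trivSheaf m n M).Sec V ≃ₐ[ℝ] (trivSheaf m n M).Sec V :=
  ((A.τ x).equiv V hx).trans ((A.τ y).equiv V hy).symm

theorem change_res (x y : M) {V W : Opens M} (h : V ≤ W) (hx : W ≤ A.U x) (hy : W ≤ A.U y)
    (s : (trivSheaf m n M).Sec W) :
    A.change x y (h.trans hx) (h.trans hy) ((trivSheaf m n M).res h s) =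
      (trivSheaf m n M).res h (A.change x y hx hy s) :=
  (((A.τ x).restrict (inf_le_left : A.U x ⊓ A.U y ≤ _)).trans
    ((A.τ y).restrict inf_le_right).symm).equiv_res V W h (le_inf hx hy) s

theorem change_mapVal (x y : M) {V : Opens M} (hx : V ≤ A.U x) (hy : V ≤ A.U y)
    (s : (trivSheaf m n M).Sec V) : A.change x y hx hy (mapVal (euler _) s) =
      mapVal (euler _) (A.change x y hx hy s) :=
  A.graded x y V hx hy s

/-- The linear part of the transition maps at a point. -/
def jac (x y : M) {p : M} (hp : p ∈ A.U x ⊓ A.U y) :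
    EuclideanSpace ℝ (Fin n) →ₗ[ℝ] EuclideanSpace ℝ (Fin n) :=
  ιInv ∘ₗ (eval (⟨p, hp⟩ : (A.U x ⊓ A.U y : Opens M))).toLinearMap ∘ₗ
    (A.change x y inf_le_left inf_le_right).toLinearMap ∘ₗ (const m (A.U x ⊓ A.U y)).toLinearMap ∘ₗ
      ι ℝ

/-- A transition map commuting with the Euler operators keeps a function in degree zero, and
`character_symm` fixes its numerical part. Transition maps are therefore linear over functions. -/
theorem eval_change_ofFun (x y : M) {V : Opens M} (hx : V ≤ A.U x) (hy : V ≤ A.U y) (p : V)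
    (f : V → ℝ) (hf : ContMDiff (𝓡 m) 𝓘(ℝ, ℝ) ∞ f) :
    eval p (A.change x y hx hy (ofFun n f hf)) = algebraMap ℝ _ (f p) := by
  have h1 : mapVal (euler _) (ofFun n f hf) = 0 := TrivSheaf.ext fun q => by
    rw [eval_mapVal, eval_ofFun, euler_of_mem_pow (j := 0)
      (by rw [pow_zero]; exact Submodule.algebraMap_mem _)]
    simp
  have h2 : euler _ (eval p (A.change x y hx hy (ofFun n f hf))) = 0 := by
    rw [← eval_mapVal, ← change_mapVal, h1, map_zero, map_zero]
  rw [eq_algebraMap_of_euler h2]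
  congr 1
  exact (character_symm (A.τ x) (A.τ y) hx hy p (ofFun n f hf)).trans (by simp)

/-- Linearity over functions makes the transition map act pointwise. It is an algebra map on each
`Λₙ` that sends generators to degree one, hence is `Λ` of its linear part. -/
theorem eval_change (x y : M) {V : Opens M} (hx : V ≤ A.U x) (hy : V ≤ A.U y) (p : V)
    (t : (trivSheaf m n M).Sec V) : eval p (A.change x y hx hy t) =
      ExteriorAlgebra.map (A.jac x y (le_inf hx hy p.2)) (eval p t) := by
  have h1 := apply_eq_const (p := p.1) ((eval p).toLinearMap ∘ₗ (A.change x y hx hy).toLinearMap)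
    p.2 (fun f hf s => by
      simp only [LinearMap.comp_apply, AlgEquiv.toLinearMap_apply, AlgHom.toLinearMap_apply,
        map_mul, A.eval_change_ofFun x y hx hy p f hf]
      exact (Algebra.smul_def _ _).symm) t
  refine h1.trans ?_
  have h2 : (eval p).comp ((A.change x y hx hy).toAlgHom.comp (const m V)) =
      ExteriorAlgebra.map (A.jac x y (le_inf hx hy p.2)) := by
    ext1
    ext1 v
    have h3 : euler _ (eval p (A.change x y hx hy (const m V (ι ℝ v)))) =
        eval p (A.change x y hx hy (const m V (ι ℝ v))) := by
      rw [← eval_mapVal, ← change_mapVal]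
      congr 2
      exact TrivSheaf.ext fun q => by simp [euler_ι]
    have h4 : A.change x y hx hy (const m V (ι ℝ v)) = (trivSheaf m n M).res (le_inf hx hy)
        (A.change x y inf_le_left inf_le_right (const m (A.U x ⊓ A.U y) (ι ℝ v))) := by
      rw [← change_res, res_const]
    refine (eq_ι_of_euler h3).trans ?_
    rw [LinearMap.comp_apply, AlgHom.toLinearMap_apply, map_apply_ι, h4]
    rfl
  exact DFunLike.congr_fun h2 (eval p t)

theorem eval_symm_eq (x y : M) {V : Opens M} (hx : V ≤ A.U x) (hy : V ≤ A.U y) (p : V)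
    (o : P.Sec V) : eval p (((A.τ y).equiv V hy).symm o) =
      ExteriorAlgebra.map (A.jac x y (le_inf hx hy p.2))
        (eval p (((A.τ x).equiv V hx).symm o)) := by
  rw [← A.eval_change x y hx hy p, change, AlgEquiv.trans_apply, AlgEquiv.apply_symm_apply]

theorem jac_self (x : M) {p : M} (hp : p ∈ A.U x ⊓ A.U x) (v : EuclideanSpace ℝ (Fin n)) :
    A.jac x x hp v = v := by
  have := A.eval_change x x (V := A.U x ⊓ A.U x) inf_le_left inf_le_right ⟨p, hp⟩
    (const m _ (ι ℝ v))
  rw [change, AlgEquiv.self_trans_symm, AlgEquiv.coe_refl, id, eval_const, map_apply_ι, ι_inj] at this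
  exact this.symm

theorem jac_jac (x y z : M) {p : M} (hx : p ∈ A.U x) (hy : p ∈ A.U y) (hz : p ∈ A.U z)
    (v : EuclideanSpace ℝ (Fin n)) :
    A.jac y z ⟨hy, hz⟩ (A.jac x y ⟨hx, hy⟩ v) = A.jac x z ⟨hx, hz⟩ v := by
  let V := A.U x ⊓ A.U y ⊓ A.U z
  have hVx : V ≤ A.U x := inf_le_left.trans inf_le_left
  have hVy : V ≤ A.U y := inf_le_left.trans inf_le_right
  have hVz : V ≤ A.U z := inf_le_right
  let q : V := ⟨p, ⟨hx, hy⟩, hz⟩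
  let o := (A.τ x).equiv V hVx (const m _ (ι ℝ v))
  have h0 : eval q (((A.τ x).equiv V hVx).symm o) = ι ℝ v := by
    rw [AlgEquiv.symm_apply_apply, eval_const]
  have h1 := A.eval_symm_eq x y hVx hVy q o
  have h2 := A.eval_symm_eq x z hVx hVz q o
  have h3 := A.eval_symm_eq y z hVy hVz q o
  rw [h0, map_apply_ι] at h1 h2
  rw [h1, h2, map_apply_ι, ι_inj] at h3
  exact h3.symm

theorem map_jac_map_jac (x y z : M) {p : M} (hx : p ∈ A.U x) (hy : p ∈ A.U y) (hz : p ∈ A.U z)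
    (a : Lam n) : ExteriorAlgebra.map (A.jac y z ⟨hy, hz⟩)
      (ExteriorAlgebra.map (A.jac x y ⟨hx, hy⟩) a) =
        ExteriorAlgebra.map (A.jac x z ⟨hx, hz⟩) a := by
  rw [← AlgHom.comp_apply, ExteriorAlgebra.map_comp_map]
  congr 2
  ext1 v
  exact A.jac_jac x y z hx hy hz v

theorem contMDiffAt_jac (x y : M) (p : (A.U x ⊓ A.U y : Opens M)) (v : EuclideanSpace ℝ (Fin n))
    (l : Module.Dual ℝ (EuclideanSpace ℝ (Fin n))) :
    ContMDiffAt (𝓡 m) 𝓘(ℝ, ℝ) ∞ (fun q : (A.U x ⊓ A.U y : Opens M) => l (A.jac x y q.2 v)) p :=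
  contMDiff_eval (A.change x y inf_le_left inf_le_right (const m (A.U x ⊓ A.U y) (ι ℝ v)))
    (l ∘ₗ ιInv) p

open scoped Classical in
/-- The transition maps of the associated vector bundle. -/
def coordChange (x y p : M) : EuclideanSpace ℝ (Fin n) →L[ℝ] EuclideanSpace ℝ (Fin n) :=
  if hp : p ∈ A.U x ⊓ A.U y then LinearMap.toContinuousLinearMap (A.jac x y hp) else 0

theorem coordChange_apply {x y p : M} (hp : p ∈ A.U x ⊓ A.U y) (v : EuclideanSpace ℝ (Fin n)) :
    A.coordChange x y p v = A.jac x y hp v := by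
  rw [coordChange, dif_pos hp]
  rfl

theorem contMDiffOn_coordChange (x y : M) :
    ContMDiffOn (𝓡 m) 𝓘(ℝ, EuclideanSpace ℝ (Fin n) →L[ℝ] EuclideanSpace ℝ (Fin n)) ∞
      (A.coordChange x y) (A.U x ∩ A.U y : Set M) := by
  intro p hp
  refine ContMDiffAt.contMDiffWithinAt (contMDiffAt_clm_of_apply fun v l => ?_)
  refine (contMDiffAt_subtype_iff (U := A.U x ⊓ A.U y) (x := ⟨p, hp⟩)).1 ?_
  refine (A.contMDiffAt_jac x y ⟨p, hp⟩ v l).congr_of_eventuallyEq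
    (Filter.Eventually.of_forall fun q => ?_)
  exact congrArg l (A.coordChange_apply q.2 v)

/-- The cocycle of the associated vector bundle. -/
def core : VectorBundleCore ℝ M (EuclideanSpace ℝ (Fin n)) M where
  baseSet x := A.U x
  isOpen_baseSet x := (A.U x).2
  -- Each point indexes its own chart: the fibre at `x` is `ℝⁿ` as seen through `τ x`.
  indexAt := id
  mem_baseSet_at := A.mem_U
  coordChange := A.coordChange
  coordChange_self x p hp v := by
    rw [A.coordChange_apply ⟨hp, hp⟩]
    exact A.jac_self x _ v
  continuousOn_coordChange x y := (A.contMDiffOn_coordChange x y).continuousOn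
  coordChange_comp x y z p hp v := by
    obtain ⟨⟨hx, hy⟩, hz⟩ := hp
    rw [A.coordChange_apply ⟨hx, hy⟩, A.coordChange_apply ⟨hy, hz⟩, A.coordChange_apply ⟨hx, hz⟩]
    exact A.jac_jac x y z hx hy hz v

instance : A.core.IsContMDiff (𝓡 m) ∞ := ⟨A.contMDiffOn_coordChange⟩

/-- The associated vector bundle. -/
def bundle : SmoothVectorBundle m n M where
  fiber := A.core.Fiber

theorem coordEquiv_bundle (x₀ : M) {x : M} (hx : x ∈ A.U x₀) (v : EuclideanSpace ℝ (Fin n)) :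
    A.bundle.coordEquiv x₀ (x := x) hx v = A.jac x x₀ ⟨A.mem_U x, hx⟩ v :=
  A.coordChange_apply ⟨A.mem_U x, hx⟩ v

theorem map_coordEquiv_bundle (x₀ : M) {x : M} (hx : x ∈ A.U x₀) (a : Lam n) :
    ExteriorAlgebra.map (A.bundle.coordEquiv x₀ (x := x) hx).toLinearMap a =
      ExteriorAlgebra.map (A.jac x x₀ ⟨A.mem_U x, hx⟩) a := by
  have : (A.bundle.coordEquiv x₀ (x := x) hx).toLinearMap = A.jac x x₀ ⟨A.mem_U x, hx⟩ :=
    LinearMap.ext fun v => A.coordEquiv_bundle x₀ hx v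
  exact congrArg (fun f => ExteriorAlgebra.map f a) this

/-- The value of a section of `P` at a point. -/
def ev {V : Opens M} (x : V) : P.Sec V →ₐ[ℝ] Lam n :=
  (eval (⟨x.1, x.2, A.mem_U x.1⟩ : (V ⊓ A.U x.1 : Opens M))).comp
    (((A.τ x.1).equiv (V ⊓ A.U x.1) inf_le_right).symm.toAlgHom.comp (P.res inf_le_left))

/-- `ev` reads each point in that point's own chart; the coordinates in a fixed chart are recovered
by the cocycle. Smoothness and gluing are checked in fixed charts. -/
theorem eval_symm_res (x₀ : M) {V W : Opens M} (hWV : W ≤ V) (hW : W ≤ A.U x₀) (x : W)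
    (o : P.Sec V) : eval x (((A.τ x₀).equiv W hW).symm (P.res hWV o)) =
      ExteriorAlgebra.map (A.jac x x₀ ⟨A.mem_U x, hW x.2⟩) (A.ev ⟨x.1, hWV x.2⟩ o) := by
  have h1 := A.eval_symm_eq x.1 x₀ (V := W ⊓ A.U x.1) inf_le_right (inf_le_left.trans hW)
    ⟨x.1, x.2, A.mem_U x.1⟩ (P.res (inf_le_left.trans hWV) o)
  have h2 := (A.τ x₀).symm_res (inf_le_left : W ⊓ A.U x.1 ≤ W) hW (P.res hWV o)
  have h3 := (A.τ x.1).symm_res (inf_le_inf_right _ hWV : W ⊓ A.U x.1 ≤ V ⊓ A.U x.1) inf_le_right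
    (P.res inf_le_left o)
  rw [P.res_res] at h2 h3
  rw [h2, h3] at h1
  exact h1

theorem eval_symm_res_self {V : Opens M} (x : V) (o : P.Sec V) :
    eval (⟨x.1, x.2, A.mem_U x.1⟩ : (V ⊓ A.U x.1 : Opens M))
      (((A.τ x.1).equiv (V ⊓ A.U x.1) inf_le_right).symm (P.res inf_le_left o)) = A.ev x o := rfl

theorem _root_.contMDiffAt_of_restrict {V W : Opens M} (h : W ≤ V) {f : V → ℝ} {x : W}
    (hf : ContMDiffAt (𝓡 m) 𝓘(ℝ, ℝ) ∞ (fun y : W => f ⟨y.1, h y.2⟩) x) :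
    ContMDiffAt (𝓡 m) 𝓘(ℝ, ℝ) ∞ f ⟨x.1, h x.2⟩ := by
  classical
  -- The extension by zero only serves to compare smoothness on two open subsets through `M`.
  let F : M → ℝ := fun y => if hy : y ∈ V then f ⟨y, hy⟩ else 0
  have h1 : f = fun y : V => F y := funext fun y => by
    simp only [F]; rw [dif_pos y.2]
  have h2 : (fun y : W => f ⟨y.1, h y.2⟩) = fun y : W => F y :=
    funext fun y => by
      simp only [F]; rw [dif_pos (h y.2)]
  rw [h2] at hf
  rw [h1]
  exact (contMDiffAt_subtype_iff (x := ⟨x.1, h x.2⟩)).2 ((contMDiffAt_subtype_iff (x := x)).1 hf)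

theorem isSmoothExt_ev {V : Opens M} (o : P.Sec V) :
    A.bundle.IsSmoothExt (U := V) fun x => A.ev x o := by
  intro x₀ l
  refine contMDiffAt_of_restrict (inf_le_left : V ⊓ A.U x₀.1 ≤ V)
    (x := ⟨x₀.1, x₀.2, A.mem_U x₀.1⟩) ?_
  refine (contMDiff_eval (((A.τ x₀.1).equiv (V ⊓ A.U x₀.1) inf_le_right).symm
    (P.res inf_le_left o)) l _).congr_of_eventuallyEq (Filter.Eventually.of_forall fun x => ?_)
  have h := A.eval_symm_res x₀.1 (inf_le_left : V ⊓ A.U x₀.1 ≤ V) inf_le_right x o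
  refine congrArg l (Eq.trans ?_ ((A.map_coordEquiv_bundle x₀.1 x.2.2 _).trans h.symm))
  exact DFunLike.congr_fun (A.bundle.extCoord_eq x₀.1 (x := x.1) x.2.2)
    (A.ev (⟨x.1, x.2.1⟩ : V) o)

/-- The sections of `P` as sections of the exterior algebra bundle. -/
def toBundle (V : Opens M) : P.Sec V →ₐ[ℝ] A.bundle.extSheaf.Sec V where
  toFun o := ⟨fun x => A.ev x o, A.isSmoothExt_ev o⟩
  map_one' := SmoothVectorBundle.sec_ext fun x => map_one (A.ev x)
  map_mul' a b := SmoothVectorBundle.sec_ext fun x => map_mul (A.ev x) a b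
  map_zero' := SmoothVectorBundle.sec_ext fun x => map_zero (A.ev x)
  map_add' a b := SmoothVectorBundle.sec_ext fun x => map_add (A.ev x) a b
  commutes' r := SmoothVectorBundle.sec_ext fun x => (A.ev x).commutes r

theorem evalAt_toBundle {V : Opens M} (o : P.Sec V) (x : V) :
    A.bundle.evalAt x (A.toBundle V o) = A.ev x o := rfl

theorem ev_res {V W : Opens M} (h : W ≤ V) (x : W) (o : P.Sec V) :
    A.ev x (P.res h o) = A.ev ⟨x.1, h x.2⟩ o := by
  have h3 := (A.τ x.1).symm_res (inf_le_inf_right _ h : W ⊓ A.U x.1 ≤ V ⊓ A.U x.1) inf_le_right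
    (P.res inf_le_left o)
  rw [P.res_res] at h3
  rw [← eval_symm_res_self, P.res_res, h3]
  rfl

theorem eq_of_ev (hP : P.presheaf.IsSheaf) {V : Opens M} {a b : P.Sec V}
    (h : ∀ x : V, A.ev x a = A.ev x b) : a = b := by
  refine eq_of_locally hP _ _ fun x hx => ⟨V ⊓ A.U x, ⟨hx, A.mem_U x⟩, inf_le_left, ?_⟩
  refine ((A.τ x).equiv (V ⊓ A.U x) inf_le_right).symm.injective (TrivSheaf.ext fun y => ?_)
  rw [A.eval_symm_res, A.eval_symm_res, h]

/-- Values determine a section because they determine its coordinates in every chart. Conversely,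
the frame coordinates of a bundle section define sections of `P` in the charts, and the cocycle
identity makes these agree on overlaps. -/
theorem toBundle_bijective (hP : P.presheaf.IsSheaf) (V : Opens M) :
    Function.Bijective (A.toBundle V) := by
  refine ⟨fun a b h => A.eq_of_ev hP fun x => ?_, fun s => ?_⟩
  · rw [← A.evalAt_toBundle, h, A.evalAt_toBundle]
  · let t (x : M) : (trivSheaf m n M).Sec (V ⊓ A.U x) :=
      (A.bundle.frame x).equiv (V ⊓ A.U x) inf_le_right (A.bundle.extSheaf.res inf_le_left s)
    have ht : ∀ (x : M) (y : (V ⊓ A.U x : Opens M)), eval y (t x) =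
        ExteriorAlgebra.map (A.jac y.1 x ⟨A.mem_U y.1, y.2.2⟩)
          (A.bundle.evalAt (⟨y.1, y.2.1⟩ : V) s : Lam n) := by
      intro x y
      refine (A.bundle.eval_frame x inf_le_right _ y).trans ?_
      exact A.map_coordEquiv_bundle x y.2.2 _
    have htt : ∀ x y (p : ((V ⊓ A.U x) ⊓ (V ⊓ A.U y) : Opens M)),
        ExteriorAlgebra.map (A.jac x y ⟨p.2.1.2, p.2.2.2⟩) (eval ⟨p.1, p.2.1⟩ (t x)) =
          eval ⟨p.1, p.2.2⟩ (t y) := by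
      intro x y p
      rw [ht, ht]
      exact A.map_jac_map_jac p.1 x y (A.mem_U p.1) p.2.1.2 p.2.2.2 _
    obtain ⟨o, ho⟩ := exists_glue hP (fun x => V ⊓ A.U x) V (fun x => inf_le_left)
      (fun x hx => Opens.mem_iSup.2 ⟨x, hx, A.mem_U x⟩)
      (fun x => (A.τ x).equiv (V ⊓ A.U x) inf_le_right (t x)) (by
        intro x y
        rw [← (A.τ x).equiv_res _ _ inf_le_left inf_le_right,
          ← (A.τ y).equiv_res _ _ inf_le_right inf_le_right]
        refine ((A.τ y).equiv _ (inf_le_right.trans inf_le_right)).symm.injective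
          (TrivSheaf.ext fun p => ?_)
        rw [AlgEquiv.symm_apply_apply]
        exact (A.eval_change x y (inf_le_left.trans inf_le_right)
          (inf_le_right.trans inf_le_right) p _).trans (htt x y p))
    refine ⟨o, SmoothVectorBundle.sec_ext fun x => ?_⟩
    rw [evalAt_toBundle, ← eval_symm_res_self, ho x.1, AlgEquiv.symm_apply_apply, ht]
    have : A.jac x.1 x.1 ⟨A.mem_U x.1, A.mem_U x.1⟩ = LinearMap.id :=
      LinearMap.ext fun v => A.jac_self x.1 _ v
    rw [this, ExteriorAlgebra.map_id]
    rfl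

/-- The isomorphism of `P` with the sheaf of sections of the exterior algebra bundle. -/
def bundleIso (hP : P.presheaf.IsSheaf)
    (hpar : ∀ (V : Opens M) (i : ZMod 2) (s : P.Sec V), (∀ x ∈ V, ∃ W : Opens M, x ∈ W ∧
      ∃ hW : W ≤ V, P.res hW s ∈ P.parity W i) → s ∈ P.parity V i) :
    IsoOn P A.bundle.extSheaf ⊤ where
  equiv V _ := AlgEquiv.ofBijective (A.toBundle V) (A.toBundle_bijective hP V)
  equiv_res V W h _ s := SmoothVectorBundle.sec_ext fun x => A.ev_res h x s
  parity_iff V _ i s := by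
    rw [SmoothVectorBundle.mem_parity_iff]
    constructor
    · intro h
      refine hpar V i s fun x hx => ⟨V ⊓ A.U x, ⟨hx, A.mem_U x⟩, inf_le_left, ?_⟩
      rw [← (A.τ x).symm.parity_iff _ inf_le_right, TrivSheaf.mem_parity_iff]
      intro y
      refine (A.eval_symm_res x inf_le_left inf_le_right y s).symm ▸ ?_
      exact map_mem_evenOdd _ (h ⟨y.1, y.2.1⟩)
    · intro h x
      have h1 := P.map_parity (V ⊓ A.U x.1) V inf_le_left i s h
      change P.res _ s ∈ _ at h1
      rw [← (A.τ x.1).symm.parity_iff _ inf_le_right, TrivSheaf.mem_parity_iff] at h1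
      exact h1 ⟨x.1, x.2, A.mem_U x.1⟩

end GradedAtlas

end SuperPresheaf

/-! ### Existence of an associated bundle -/

namespace SuperSpace

open SuperPresheaf

variable {m n : ℕ} {X : SuperSpace.{u} m}

/-- Every compact supermanifold is isomorphic to the exterior algebra bundle of a vector bundle. -/
theorem IsSupermanifold.nonempty_associatedBundle [CompactSpace X.carrier]
    (hX : X.IsSupermanifold n) : Nonempty (X.AssociatedBundle n) := by
  obtain ⟨D, hD, hpar, hsymb⟩ := hX.exists_euler
  obtain ⟨U, hU, ⟨τ⟩⟩ := hX.exists_charts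
  choose τ' hτ' using fun x => (τ x).exists_graded D hD hpar hsymb
  let A : GradedAtlas m n X.O :=
    { U := U
      mem_U := hU
      τ := τ'
      graded := fun x y V hx hy s => by
        rw [AlgEquiv.symm_apply_eq, hτ', hτ', AlgEquiv.apply_symm_apply] }
  exact ⟨⟨A.bundle, (A.bundleIso hX.isSheaf fun V i s h => hX.mem_parity_of_locally h).symm⟩⟩

end SuperSpace


/-! ### The action of automorphisms of `X / J ^ 2` on the associated bundle -/

namespace SmoothVectorBundle

variable {m n : ℕ} {M : Type u} [TopologicalSpace M] [ChartedSpace (EuclideanSpace ℝ (Fin m)) M]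
  (E : SmoothVectorBundle m n M)

/-- The section over the domain of the frame at `x₀` with constant coordinates. -/
def frameConst (x₀ : M) (a : Lam n) : E.extSheaf.Sec (E.baseOpen x₀) :=
  ((E.frame x₀).equiv _ le_rfl).symm (TrivSheaf.const m _ a)

theorem evalAt_frameConst (x₀ : M) (a : Lam n) (x : E.baseOpen x₀) :
    E.evalAt x (E.frameConst x₀ a) =
      ExteriorAlgebra.map (E.coordEquiv x₀ x.2).symm.toLinearMap a := by
  rw [frameConst, evalAt_frame_symm, TrivSheaf.eval_const]

theorem finiteDimensional_fiber (x : M) : FiniteDimensional ℝ (E.fiber x) :=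
  (E.coordEquiv x (E.mem_baseOpen x)).symm.finiteDimensional

theorem finrank_fiber (x : M) : Module.finrank ℝ (E.fiber x) = n := by
  rw [(E.coordEquiv x (E.mem_baseOpen x)).finrank_eq, finrank_euclideanSpace_fin]

end SmoothVectorBundle

namespace SuperSpace

open ExteriorAlgebra SuperPresheaf

variable {m n : ℕ} {X Y : SuperSpace.{u} m}

/-- The two pullbacks live over preimages that are equal only propositionally, so they are compared
after restriction to a common open set. -/
theorem Hom.ext_of_base (f g : Hom X Y) (h : f.hom.base = g.hom.base)
    (hp : ∀ (U : Opens Y.carrier) (s : Y.O.Sec U) (V : Opens X.carrier)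
      (hf : V ≤ preimageOf f.hom U) (hg : V ≤ preimageOf g.hom U),
      X.O.res hf (pullbackOf f.hom U s) = X.O.res hg (pullbackOf g.hom U s)) : f = g := by
  obtain ⟨⟨b, c⟩, hf, hf'⟩ := f
  obtain ⟨⟨b', c'⟩, hg, hg'⟩ := g
  obtain rfl : b = b' := h
  have : c = c' := by
    ext U s
    have h1 := hp U s _ le_rfl le_rfl
    exact (res_self X.O _).symm.trans (h1.trans (res_self X.O _))
  subst this
  rfl

/-! ### Numerical and linear parts of sections of `O / J ^ 2` -/

namespace AssociatedBundle

variable (A : X.AssociatedBundle n)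

/-- The value at a point of a section of `O`, through `ξ`. -/
def val {V : Opens X.carrier} (x : V) : X.O.Sec V →ₐ[ℝ] ExteriorAlgebra ℝ (A.E.fiber x) :=
  (A.E.evalAt x).comp (A.ξ.equiv V le_top).symm.toAlgHom

theorem val_ξ {V : Opens X.carrier} (x : V) (s : A.E.extSheaf.Sec V) :
    A.val x (A.ξ.equiv V le_top s) = A.E.evalAt x s :=
  congrArg (A.E.evalAt x) (AlgEquiv.symm_apply_apply _ s)

theorem val_res {U V : Opens X.carrier} (h : U ≤ V) (x : U) (o : X.O.Sec V) :
    A.val x (X.O.res h o) = A.val ⟨x.1, h x.2⟩ o :=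
  congrArg (A.E.evalAt x) (A.ξ.symm_res h le_top o)

theorem eq_of_val {V : Opens X.carrier} {a b : X.O.Sec V} (h : ∀ x : V, A.val x a = A.val x b) :
    a = b :=
  (A.ξ.equiv V le_top).symm.injective (SmoothVectorBundle.sec_ext h)

theorem mem_nilIdeal_iff {V : Opens X.carrier} {k : ℕ} {a : X.O.Sec V} :
    a ∈ X.O.nilIdeal k V ↔ ∀ x : V, A.val x a ∈ degGE (A.E.fiber x.1) k := by
  rw [← A.ξ.symm.mem_nilIdeal_iff k le_top, A.E.mem_nilIdeal_iff]
  rfl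

theorem mem_parity_iff {V : Opens X.carrier} {i : ZMod 2} {a : X.O.Sec V} :
    a ∈ X.O.parity V i ↔
      ∀ x : V, A.val x a ∈ CliffordAlgebra.evenOdd (0 : QuadraticForm ℝ (A.E.fiber x)) i := by
  rw [← A.ξ.symm.parity_iff V le_top, SmoothVectorBundle.mem_parity_iff]
  rfl

/-- The numerical part at a point of a section of `O / J ^ 2`. -/
def aug {V : Opens X.carrier} (x : V) : X.O.QuotSec 2 V →ₐ[ℝ] ℝ :=
  Ideal.Quotient.liftₐ _ (algebraMapInv.comp (A.val x)) fun _ ha =>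
    (mem_degGE_two_iff.1 (A.mem_nilIdeal_iff.1 ha x)).1

theorem aug_mk {V : Opens X.carrier} (x : V) (o : X.O.Sec V) :
    A.aug x (X.O.quotMk 2 V o) = algebraMapInv (A.val x o) := rfl

/-- The linear part at a point of a section of `O / J ^ 2`. -/
def lin {V : Opens X.carrier} (x : V) : X.O.QuotSec 2 V →ₗ[ℝ] A.E.fiber x :=
  Submodule.liftQ ((X.O.nilIdeal 2 V).restrictScalars ℝ) (ιInv ∘ₗ (A.val x).toLinearMap)
    fun _ ha => (mem_degGE_two_iff.1 (A.mem_nilIdeal_iff.1 ha x)).2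

theorem lin_mk {V : Opens X.carrier} (x : V) (o : X.O.Sec V) :
    A.lin x (X.O.quotMk 2 V o) = ιInv (A.val x o) := rfl

theorem lin_mul {V : Opens X.carrier} (x : V) (p q : X.O.QuotSec 2 V) :
    A.lin x (p * q) = A.aug x p • A.lin x q + A.aug x q • A.lin x p := by
  obtain ⟨a, rfl⟩ := X.O.quotMk_surjective 2 V p
  obtain ⟨b, rfl⟩ := X.O.quotMk_surjective 2 V q
  rw [← map_mul, lin_mk, lin_mk, lin_mk, aug_mk, aug_mk, map_mul, ιInv_mul]

theorem lin_res {U V : Opens X.carrier} (h : U ≤ V) (x : U) (q : X.O.QuotSec 2 V) :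
    A.lin x (X.O.quotRes 2 h q) = A.lin ⟨x.1, h x.2⟩ q := by
  obtain ⟨o, rfl⟩ := X.O.quotMk_surjective 2 V q
  rw [quotRes_mk, lin_mk, lin_mk, val_res]

theorem aug_res {U V : Opens X.carrier} (h : U ≤ V) (x : U) (q : X.O.QuotSec 2 V) :
    A.aug x (X.O.quotRes 2 h q) = A.aug ⟨x.1, h x.2⟩ q := by
  obtain ⟨o, rfl⟩ := X.O.quotMk_surjective 2 V q
  rw [quotRes_mk, aug_mk, aug_mk, val_res]

theorem eq_of_aug_lin {V : Opens X.carrier} {p q : X.O.QuotSec 2 V}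
    (h0 : ∀ x : V, A.aug x p = A.aug x q) (h1 : ∀ x : V, A.lin x p = A.lin x q) : p = q := by
  obtain ⟨a, rfl⟩ := X.O.quotMk_surjective 2 V p
  obtain ⟨b, rfl⟩ := X.O.quotMk_surjective 2 V q
  refine Ideal.Quotient.eq.2 (A.mem_nilIdeal_iff.2 fun x => mem_degGE_two_iff.2 ?_)
  have h2 := h0 x
  have h3 := h1 x
  rw [aug_mk, aug_mk] at h2
  rw [lin_mk, lin_mk] at h3
  simp only [map_sub, h2, h3, sub_self, and_self]

/-- This is where preservation of the grading enters: the pullback of a function stays even and so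
acquires no linear part. -/
theorem lin_of_even {V : Opens X.carrier} (x : V) {q : X.O.QuotSec 2 V}
    (hq : q ∈ (X.O.quot 2).parity V 0) : A.lin x q = 0 := by
  obtain ⟨o, ho, rfl⟩ := hq
  exact ιInv_of_even (A.mem_parity_iff.1 ho x)

end AssociatedBundle

/-! The underlying data of an endomorphism of `X / J ^ 2`. -/

namespace QuotHom

/-- The underlying map. -/
def base (g : X.modPow 2 ⟶ X.modPow 2) : X.carrier → X.carrier :=
  baseMap (X := X.modPow 2) (Y := X.modPow 2) (Hom.hom g)

/-- Preimages of open sets. -/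
def pre (g : X.modPow 2 ⟶ X.modPow 2) (U : Opens X.carrier) : Opens X.carrier :=
  preimageOf (X := X.modPow 2) (Y := X.modPow 2) (Hom.hom g) U

theorem mem_pre {g : X.modPow 2 ⟶ X.modPow 2} {x : X.carrier} {U : Opens X.carrier} :
    x ∈ pre g U ↔ base g x ∈ U := Iff.rfl

theorem pre_mono (g : X.modPow 2 ⟶ X.modPow 2) {U V : Opens X.carrier} (h : U ≤ V) :
    pre g U ≤ pre g V := fun _ hx => h hx

/-- The action on sections. -/
def pull (g : X.modPow 2 ⟶ X.modPow 2) (U : Opens X.carrier) :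
    X.O.QuotSec 2 U →ₐ[ℝ] X.O.QuotSec 2 (pre g U) :=
  pullbackOf (X := X.modPow 2) (Y := X.modPow 2) (Hom.hom g) U

variable (g h : X.modPow 2 ⟶ X.modPow 2)

theorem contMDiff_base : ContMDiff (𝓡 m) (𝓡 m) ∞ (base g) := Hom.smooth g

theorem pull_res {U V : Opens X.carrier} (hUV : U ≤ V) (q : X.O.QuotSec 2 V) :
    pull g U (X.O.quotRes 2 hUV q) =
      X.O.quotRes 2 (pre_mono g hUV) (pull g V q) :=
  pullbackOf_res (Hom.hom g) hUV q

theorem pull_mem_parity {U : Opens X.carrier} {i : ZMod 2} {q : X.O.QuotSec 2 U}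
    (hq : q ∈ (X.O.quot 2).parity U i) : pull g U q ∈ (X.O.quot 2).parity (pre g U) i :=
  Hom.map_parity g U i q hq

end QuotHom

/-! ### The fibrewise linear maps of an endomorphism of `X / J ^ 2` -/

namespace AssociatedBundle

open QuotHom

variable (A : X.AssociatedBundle n) (g h : X.modPow 2 ⟶ X.modPow 2)

/-- A section of `C^∞ ⊗ Λₙ` over a set where `E` has a frame, as a section of `O / J ^ 2`. -/
def ofFrame (x₀ : X.carrier) {V : Opens X.carrier} (hV : V ≤ A.E.baseOpen x₀) :
    (trivSheaf m n X.carrier).Sec V →ₐ[ℝ] X.O.QuotSec 2 V :=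
  (X.O.quotMk 2 V).comp
    ((A.ξ.equiv V le_top).toAlgHom.comp ((A.E.frame x₀).equiv V hV).symm.toAlgHom)

theorem ofFrame_res (x₀ : X.carrier) {V W : Opens X.carrier} (hVW : V ≤ W)
    (hW : W ≤ A.E.baseOpen x₀) (t : (trivSheaf m n X.carrier).Sec W) :
    A.ofFrame x₀ (hVW.trans hW) ((trivSheaf m n X.carrier).res hVW t) =
      X.O.quotRes 2 hVW (A.ofFrame x₀ hW t) := by
  have h1 := (A.E.frame x₀).symm_res hVW hW t
  have h2 := A.ξ.equiv_res V W hVW le_top (((A.E.frame x₀).equiv W hW).symm t)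
  exact congrArg (X.O.quotMk 2 V) ((congrArg (A.ξ.equiv V le_top) h1).trans h2)

theorem ofFrame_mem_parity (x₀ : X.carrier) {V : Opens X.carrier} (hV : V ≤ A.E.baseOpen x₀)
    {i : ZMod 2} {t : (trivSheaf m n X.carrier).Sec V}
    (ht : t ∈ (trivSheaf m n X.carrier).parity V i) :
    A.ofFrame x₀ hV t ∈ (X.O.quot 2).parity V i :=
  ⟨_, (A.ξ.parity_iff V le_top i _).2 (((A.E.frame x₀).symm.parity_iff V hV i t).2 ht), rfl⟩

theorem ofFrame_eq_zero (x₀ : X.carrier) {V : Opens X.carrier} (hV : V ≤ A.E.baseOpen x₀)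
    {t : (trivSheaf m n X.carrier).Sec V} (ht : ∀ x, TrivSheaf.eval x t ∈ degGE _ 2) :
    A.ofFrame x₀ hV t = 0 :=
  Ideal.Quotient.eq_zero_iff_mem.2 (A.ξ.mem_nilIdeal 2 le_top
    ((A.E.frame x₀).symm.mem_nilIdeal 2 hV (TrivSheaf.mem_nilIdeal_iff.2 ht)))

/-- The coordinates of a section in a frame. -/
def coords (x₀ : X.carrier) {V : Opens X.carrier} (hV : V ≤ A.E.baseOpen x₀) (o : X.O.Sec V) :
    (trivSheaf m n X.carrier).Sec V :=
  (A.E.frame x₀).equiv V hV ((A.ξ.equiv V le_top).symm o)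

theorem ofFrame_coords (x₀ : X.carrier) {V : Opens X.carrier} (hV : V ≤ A.E.baseOpen x₀)
    (o : X.O.Sec V) : A.ofFrame x₀ hV (A.coords x₀ hV o) = X.O.quotMk 2 V o := by
  refine congrArg (X.O.quotMk 2 V) ?_
  change A.ξ.equiv V le_top (((A.E.frame x₀).equiv V hV).symm _) = _
  rw [coords, AlgEquiv.symm_apply_apply, AlgEquiv.apply_symm_apply]

theorem eval_coords (x₀ : X.carrier) {V : Opens X.carrier} (hV : V ≤ A.E.baseOpen x₀)
    (o : X.O.Sec V) (x : V) : TrivSheaf.eval x (A.coords x₀ hV o) =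
      ExteriorAlgebra.map (A.E.coordEquiv x₀ (hV x.2)).toLinearMap (A.val x o) :=
  A.E.eval_frame x₀ hV _ x

/-- Pulling back and evaluating at `x` is a compatible family of characters near `base g x`, so
`character_eq` identifies it with evaluation there. -/
theorem aug_pull_ofFrame (x : X.carrier) {V : Opens X.carrier} (hV : V ≤ A.E.baseOpen (base g x))
    (hx : base g x ∈ V) (t : (trivSheaf m n X.carrier).Sec V) :
    A.aug (⟨x, mem_pre.2 hx⟩ : pre g V) (pull g V (A.ofFrame (base g x) hV t)) =
      algebraMapInv (TrivSheaf.eval ⟨base g x, hx⟩ t) := by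
  refine TrivSheaf.character_eq (W := V) (p := base g x)
    (fun V' hV' hp => (A.aug (⟨x, mem_pre.2 hp⟩ : pre g V')).comp
      ((pull g V').comp (A.ofFrame (base g x) (hV'.trans hV)))) ?_ V le_rfl hx t
  intro V₁ V₂ h12 hV₂ hp s
  simp only [AlgHom.comp_apply]
  rw [A.ofFrame_res (base g x) h12 (hV₂.trans hV), pull_res, A.aug_res]

theorem aug_pull {U : Opens X.carrier} (x : pre g U) (q : X.O.QuotSec 2 U) :
    A.aug x (pull g U q) = A.aug (⟨base g x.1, mem_pre.1 x.2⟩ : U) q := by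
  obtain ⟨o, rfl⟩ := X.O.quotMk_surjective 2 U q
  let V := U ⊓ A.E.baseOpen (base g x.1)
  have hx : base g x.1 ∈ V := ⟨mem_pre.1 x.2, A.E.mem_baseOpen _⟩
  have h1 := A.aug_pull_ofFrame g x.1 (V := V) inf_le_right hx
    (A.coords _ inf_le_right (X.O.res inf_le_left o))
  rw [ofFrame_coords, ← quotRes_mk, pull_res, aug_res, eval_coords, algebraMapInv_map,
    val_res] at h1
  exact h1

/-- The linear map `E_{f x} → E_x` induced by an endomorphism of `X / J ^ 2` over `f`. -/
def fiberMap (x : X.carrier) : A.E.fiber (base g x) →ₗ[ℝ] A.E.fiber x :=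
  A.lin (⟨x, mem_pre.2 (A.E.mem_baseOpen (base g x))⟩ : pre g (A.E.baseOpen (base g x))) ∘ₗ
    (pull g _).toLinearMap ∘ₗ (A.ofFrame (base g x) le_rfl).toLinearMap ∘ₗ
      (TrivSheaf.const m _).toLinearMap ∘ₗ ι ℝ ∘ₗ
        (A.E.coordEquiv (base g x) (A.E.mem_baseOpen _)).toLinearMap

/-- By the derivation rule `lin_mul` and the vanishing of `lin` on even sections, the map `Θ` is
linear over functions evaluated at `base g x`; hence it sees only the value of `t` there. Of this
value the scalar part is even and the part of degree at least two dies in the quotient, so only the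
linear part remains. -/
theorem lin_pull_ofFrame (x : X.carrier) {V : Opens X.carrier} (hV : V ≤ A.E.baseOpen (base g x))
    (hx : base g x ∈ V) (t : (trivSheaf m n X.carrier).Sec V) :
    A.lin (⟨x, mem_pre.2 hx⟩ : pre g V) (pull g V (A.ofFrame (base g x) hV t)) =
      A.lin (⟨x, mem_pre.2 hx⟩ : pre g V) (pull g V (A.ofFrame (base g x) hV
        (TrivSheaf.const m V (ι ℝ (ιInv (TrivSheaf.eval ⟨base g x, hx⟩ t)))))) := by
  let Θ : (trivSheaf m n X.carrier).Sec V →ₗ[ℝ] A.E.fiber x :=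
    A.lin (⟨x, mem_pre.2 hx⟩ : pre g V) ∘ₗ (pull g V).toLinearMap ∘ₗ
      (A.ofFrame (base g x) hV).toLinearMap
  have heven : ∀ t ∈ (trivSheaf m n X.carrier).parity V 0, Θ t = 0 := fun t ht =>
    A.lin_of_even _ (pull_mem_parity g (A.ofFrame_mem_parity _ hV ht))
  have halg : ∀ r : ℝ, algebraMap ℝ (Lam n) r ∈
      CliffordAlgebra.evenOdd (0 : QuadraticForm ℝ (EuclideanSpace ℝ (Fin n))) 0 := fun r => by
    rw [Algebra.algebraMap_eq_smul_one]
    exact Submodule.smul_mem _ _ (CliffordAlgebra.one_le_evenOdd_zero _ (Submodule.one_le.1 le_rfl))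
  have h1 := TrivSheaf.apply_eq_const (p := base g x) Θ hx (fun f hf s => by
    have h2 : Θ (TrivSheaf.ofFun n f hf) = 0 :=
      heven _ (TrivSheaf.mem_parity_iff.2 fun y => halg (f y))
    have h3 := A.aug_pull_ofFrame g x hV hx (TrivSheaf.ofFun n f hf)
    rw [TrivSheaf.eval_ofFun, algebraMapInv_algebraMap] at h3
    change A.lin _ (pull g V (A.ofFrame (base g x) hV _)) = _
    rw [map_mul, map_mul, A.lin_mul, h3]
    change _ + _ • Θ (TrivSheaf.ofFun n f hf) = _
    rw [h2, smul_zero, add_zero]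
    rfl) t
  refine h1.trans ?_
  set a := TrivSheaf.eval (⟨base g x, hx⟩ : V) t
  have h4 : Θ (TrivSheaf.const m V (algebraMap ℝ _ (algebraMapInv a))) = 0 :=
    heven _ (TrivSheaf.mem_parity_iff.2 fun y => halg _)
  have h5 : Θ (TrivSheaf.const m V (a - algebraMap ℝ _ (algebraMapInv a) - ι ℝ (ιInv a))) = 0 := by
    change A.lin _ (pull g V (A.ofFrame (base g x) hV _)) = _
    rw [A.ofFrame_eq_zero _ hV fun y => sub_mem_degGE_two a, map_zero, map_zero]
  rw [map_sub, map_sub, map_sub, map_sub, h4, sub_zero, sub_eq_zero] at h5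
  exact h5

theorem lin_pull {U : Opens X.carrier} (x : pre g U) (q : X.O.QuotSec 2 U) :
    A.lin x (pull g U q) = A.fiberMap g x.1 (A.lin (⟨base g x.1, mem_pre.1 x.2⟩ : U) q) := by
  obtain ⟨o, rfl⟩ := X.O.quotMk_surjective 2 U q
  let V := U ⊓ A.E.baseOpen (base g x.1)
  have hx : base g x.1 ∈ V := ⟨mem_pre.1 x.2, A.E.mem_baseOpen _⟩
  have h1 := A.lin_pull_ofFrame g x.1 (V := V) inf_le_right hx
    (A.coords _ inf_le_right (X.O.res inf_le_left o))
  rw [ofFrame_coords, ← quotRes_mk, pull_res, lin_res, eval_coords, ιInv_map, val_res] at h1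
  refine h1.trans ?_
  rw [← TrivSheaf.res_const (inf_le_right : V ≤ A.E.baseOpen (base g x.1)),
    A.ofFrame_res _ _ le_rfl, pull_res, lin_res]
  rfl

theorem exists_lin (x : X.carrier) (v : A.E.fiber x) :
    ∃ q : X.O.QuotSec 2 (A.E.baseOpen x), A.lin ⟨x, A.E.mem_baseOpen x⟩ q = v := by
  refine ⟨X.O.quotMk 2 _ (A.ξ.equiv _ le_top
    (A.E.frameConst x (ι ℝ (A.E.coordEquiv x (A.E.mem_baseOpen x) v)))), ?_⟩
  rw [lin_mk, val_ξ, A.E.evalAt_frameConst, map_apply_ι, ιInv_ι]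
  exact LinearEquiv.symm_apply_apply _ v

theorem fiberMap_comp (x : X.carrier) (v : A.E.fiber (base h (base g x))) :
    A.fiberMap (g ≫ h) x v = A.fiberMap g x (A.fiberMap h (base g x) v) := by
  obtain ⟨q, rfl⟩ := A.exists_lin _ v
  have hx := A.E.mem_baseOpen (base h (base g x))
  have h1 := A.lin_pull (g ≫ h) (U := A.E.baseOpen (base h (base g x))) ⟨x, hx⟩ q
  have h2 := A.lin_pull g (U := pre h (A.E.baseOpen (base h (base g x)))) ⟨x, hx⟩ (pull h _ q)
  have h3 := A.lin_pull h (U := A.E.baseOpen (base h (base g x))) ⟨base g x, hx⟩ q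
  rw [h3] at h2
  exact h1.symm.trans h2

theorem fiberMap_id (x : X.carrier) (v : A.E.fiber x) :
    A.fiberMap (𝟙 (X.modPow 2)) x v = v := by
  obtain ⟨q, rfl⟩ := A.exists_lin _ v
  exact (A.lin_pull (𝟙 (X.modPow 2)) (U := A.E.baseOpen x) ⟨x, A.E.mem_baseOpen x⟩ q).symm

/-- Stated for a morphism merely equal to the identity because the source fibre sits over `base k
x`; it is applied to a composite `g ≫ h`. -/
theorem fiberMap_surjective_of_eq_id {k : X.modPow 2 ⟶ X.modPow 2} (hk : k = 𝟙 _) (x : X.carrier) :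
    Function.Surjective (A.fiberMap k x) := by
  subst hk
  exact fun v => ⟨v, A.fiberMap_id x v⟩

/-- The composite fibre map for `g ≫ h` ends with that of `g`, which is thus surjective; the fibres
have equal dimension. -/
theorem fiberMap_bijective (hgh : g ≫ h = 𝟙 _) (x : X.carrier) :
    Function.Bijective (A.fiberMap g x) := by
  have _ := A.E.finiteDimensional_fiber x
  have _ := A.E.finiteDimensional_fiber (base g x)
  have h1 : Function.Surjective (A.fiberMap g x) := fun v => by
    obtain ⟨w, hw⟩ := A.fiberMap_surjective_of_eq_id hgh x v
    exact ⟨_, (A.fiberMap_comp g h x w).symm.trans hw⟩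
  exact ⟨(LinearMap.injective_iff_surjective_of_finrank_eq_finrank
    (by rw [A.E.finrank_fiber, A.E.finrank_fiber])).2 h1, h1⟩

end AssociatedBundle

end SuperSpace


/-! ### The splitting given by an associated bundle -/

theorem contMDiffAt_comp_opens {m : ℕ} {M : Type*} [TopologicalSpace M]
    [ChartedSpace (EuclideanSpace ℝ (Fin m)) M] {f : M → M} (hf : ContMDiff (𝓡 m) (𝓡 m) ∞ f)
    {U U' : Opens M} (h : ∀ x ∈ U', f x ∈ U) {φ : U → ℝ} {x₀ : U'}
    (hφ : ContMDiffAt (𝓡 m) 𝓘(ℝ, ℝ) ∞ φ ⟨f x₀.1, h x₀.1 x₀.2⟩) :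
    ContMDiffAt (𝓡 m) 𝓘(ℝ, ℝ) ∞ (fun x : U' => φ ⟨f x.1, h x.1 x.2⟩) x₀ := by
  classical
  let F : M → ℝ := fun y => if hy : y ∈ U then φ ⟨y, hy⟩ else 0
  have h1 : φ = fun y : U => F y := funext fun y => by
    simp only [F]; rw [dif_pos y.2]
  have h2 : (fun x : U' => φ ⟨f x.1, h x.1 x.2⟩) = fun x : U' => F (f x) := funext fun x => by
    simp only [F]; rw [dif_pos (h x.1 x.2)]
  rw [h1] at hφ
  rw [h2]
  have h3 := (contMDiffAt_subtype_iff (f := F) (x := ⟨f x₀.1, h x₀.1 x₀.2⟩)).1 hφ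
  exact (contMDiffAt_subtype_iff (f := F ∘ f) (x := x₀)).2 (h3.comp x₀.1 (hf x₀.1))

namespace SuperSpace

open ExteriorAlgebra SuperPresheaf

variable {m n : ℕ} {X : SuperSpace.{u} m}

namespace AssociatedBundle

open QuotHom

variable (A : X.AssociatedBundle n) (g h : X.modPow 2 ⟶ X.modPow 2)

theorem lin_ofFrame_const (x₀ : X.carrier) (x : A.E.baseOpen x₀) (v : EuclideanSpace ℝ (Fin n)) :
    A.lin x (A.ofFrame x₀ le_rfl (TrivSheaf.const m _ (ι ℝ v))) =
      (A.E.coordEquiv x₀ x.2).symm v := by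
  change A.lin x (X.O.quotMk 2 _ (A.ξ.equiv _ le_top (A.E.frameConst x₀ (ι ℝ v)))) = _
  rw [lin_mk, val_ξ, A.E.evalAt_frameConst, map_apply_ι, ιInv_ι]
  rfl

/-- The maps `E_{f x} → E_x` in the frames at `f x₀` and `x₀`. -/
def coordMap (x₀ x : X.carrier) : EuclideanSpace ℝ (Fin n) →L[ℝ] EuclideanSpace ℝ (Fin n) :=
  LinearMap.toContinuousLinearMap ((A.E.triv x₀).linearMapAt ℝ x ∘ₗ A.fiberMap g x ∘ₗ
    (A.E.triv (base g x₀)).symmₗ ℝ (base g x))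

theorem coordMap_eq {x₀ x : X.carrier} (hx : x ∈ A.E.baseOpen x₀)
    (hx' : base g x ∈ A.E.baseOpen (base g x₀)) :
    (A.coordMap g x₀ x : EuclideanSpace ℝ (Fin n) →ₗ[ℝ] EuclideanSpace ℝ (Fin n)) =
      (A.E.coordEquiv x₀ hx).toLinearMap ∘ₗ A.fiberMap g x ∘ₗ
        (A.E.coordEquiv (base g x₀) hx').symm.toLinearMap := by
  ext1 v
  change (A.E.triv x₀).linearMapAt ℝ x (A.fiberMap g x
    ((A.E.triv (base g x₀)).symmₗ ℝ (base g x) v)) = _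
  have h1 : (A.E.triv (base g x₀)).symmₗ ℝ (base g x) v =
      (A.E.coordEquiv (base g x₀) hx').symm v := by
    rw [Trivialization.coe_symmₗ _ hx']
    rfl
  rw [Trivialization.linearMapAt_def_of_mem _ hx, h1]
  rfl

theorem coordMap_apply {x₀ x : X.carrier} (hx : x ∈ A.E.baseOpen x₀)
    (hx' : base g x ∈ A.E.baseOpen (base g x₀)) (v : EuclideanSpace ℝ (Fin n)) :
    A.coordMap g x₀ x v = A.E.coordEquiv x₀ hx (A.fiberMap g x
      ((A.E.coordEquiv (base g x₀) hx').symm v)) :=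
  DFunLike.congr_fun (A.coordMap_eq g hx hx') v

/-- The set where the frames at `x₀` and `f x₀` are defined. -/
def coordOpen (x₀ : X.carrier) : Opens X.carrier :=
  A.E.baseOpen x₀ ⊓ pre g (A.E.baseOpen (base g x₀))

theorem mem_coordOpen (x₀ : X.carrier) : x₀ ∈ A.coordOpen g x₀ :=
  ⟨A.E.mem_baseOpen x₀, mem_pre.2 (A.E.mem_baseOpen _)⟩

/-- The columns of the matrix are the degree-one parts of pulled-back constant frame sections. These
pullbacks lift to sections of `O`, whose coordinates are smooth. -/
theorem contMDiffAt_coordMap {x₀ x : X.carrier} (hx : x ∈ A.coordOpen g x₀) :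
    ContMDiffAt (𝓡 m) 𝓘(ℝ, EuclideanSpace ℝ (Fin n) →L[ℝ] EuclideanSpace ℝ (Fin n)) ∞
      (A.coordMap g x₀) x := by
  refine contMDiffAt_clm_of_apply fun v l => ?_
  refine (contMDiffAt_subtype_iff (U := A.coordOpen g x₀) (x := ⟨x, hx⟩)).1 ?_
  obtain ⟨o, ho⟩ := X.O.quotMk_surjective 2 _
    (pull g _ (A.ofFrame (base g x₀) le_rfl (TrivSheaf.const m _ (ι ℝ v))))
  have h1 := A.E.contMDiff_extCoord x₀ ((A.ξ.equiv _ le_top).symm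
    (X.O.res (inf_le_right : A.coordOpen g x₀ ≤ _) o)) (p := ⟨x, hx⟩) hx.1 (l ∘ₗ ιInv)
  refine h1.congr_of_eventuallyEq (Filter.Eventually.of_forall fun y => ?_)
  have h2 := A.val_res (inf_le_right : A.coordOpen g x₀ ≤ _) y o
  have h3 := A.lin_pull g (⟨y.1, y.2.2⟩ : pre g (A.E.baseOpen (base g x₀)))
    (A.ofFrame (base g x₀) le_rfl (TrivSheaf.const m _ (ι ℝ v)))
  rw [← ho, lin_mk, ← h2] at h3
  have h4 := A.lin_ofFrame_const (base g x₀) ⟨base g y.1, y.2.2⟩ v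
  change l (A.coordMap g x₀ y v) = l (ιInv (A.E.extCoord x₀ y.1 (A.val y _)))
  rw [A.E.extCoord_eq x₀ y.2.1, ιInv_map, h3, A.coordMap_apply g y.2.1 y.2.2]
  exact congrArg (fun w => l (A.E.coordEquiv x₀ y.2.1 (A.fiberMap g y.1 w))) h4.symm

/-- In the frames at `x₀` and at its image, the section is `Λ` of a smooth matrix applied to
coordinates that are smooth by composition with the base map. -/
theorem isSmoothExt_lift {U : Opens X.carrier} (o : X.O.Sec U) :
    A.E.IsSmoothExt (U := pre g U) fun x => ExteriorAlgebra.map (A.fiberMap g x.1)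
      (A.val (⟨base g x.1, mem_pre.1 x.2⟩ : U) o) := by
  intro x₀ l
  have hB := (contMDiffAt_subtype_iff (U := pre g U) (x := x₀)).2
    (A.contMDiffAt_coordMap g (A.mem_coordOpen g x₀.1))
  have ht : ∀ l : Module.Dual ℝ (Lam n), ContMDiffAt (𝓡 m) 𝓘(ℝ, ℝ) ∞
      (fun x : pre g U => l (A.E.extCoord (base g x₀.1) (base g x.1)
        (A.val (⟨base g x.1, mem_pre.1 x.2⟩ : U) o))) x₀ := fun l =>
    contMDiffAt_comp_opens (contMDiff_base g) (U := U) (U' := pre g U) (fun _ hx => mem_pre.1 hx)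
      (φ := fun y : U => l (A.E.extCoord (base g x₀.1) y.1 (A.val y o)))
      (A.E.contMDiff_extCoord (base g x₀.1) _ (A.E.mem_baseOpen _) l)
  have h1 := contMDiffAt_dual_map (fun v l => contMDiffAt_apply_of_clm hB v l) ht l
  refine h1.congr_of_eventuallyEq ?_
  have hnhds : ∀ᶠ x : pre g U in nhds x₀, x.1 ∈ A.coordOpen g x₀.1 :=
    continuousAt_subtype_val.eventually
      ((A.coordOpen g x₀.1).isOpen.mem_nhds (A.mem_coordOpen g x₀.1))
  filter_upwards [hnhds] with x hx
  have hx1 : x.1 ∈ A.E.baseOpen x₀.1 := hx.1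
  have hx2 : base g x.1 ∈ A.E.baseOpen (base g x₀.1) := hx.2
  refine congrArg l ?_
  have h2 : (A.coordMap g x₀.1 x.1 : EuclideanSpace ℝ (Fin n) →ₗ[ℝ] EuclideanSpace ℝ (Fin n)) ∘ₗ
      (A.E.coordEquiv (base g x₀.1) hx2).toLinearMap =
      (A.E.coordEquiv x₀.1 hx1).toLinearMap ∘ₗ A.fiberMap g x.1 := by
    rw [A.coordMap_eq g hx1 hx2]
    ext1 v
    simp
  have h3 := congrArg (fun f => ExteriorAlgebra.map f
    (A.val (⟨base g x.1, mem_pre.1 x.2⟩ : U) o)) h2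
  simp only [← ExteriorAlgebra.map_comp_map, AlgHom.comp_apply] at h3
  rw [A.E.extCoord_eq _ hx1, A.E.extCoord_eq _ hx2]
  exact h3.symm

/-- The action on sections of the lift of an endomorphism of `X / J ^ 2`. -/
def liftPull (U : Opens X.carrier) : X.O.Sec U →ₐ[ℝ] X.O.Sec (pre g U) :=
  (A.ξ.equiv (pre g U) le_top).toAlgHom.comp
    { toFun := fun o => ⟨_, A.isSmoothExt_lift g o⟩
      map_one' := SmoothVectorBundle.sec_ext fun x => map_one
        ((ExteriorAlgebra.map (A.fiberMap g x.1)).comp (A.val ⟨base g x.1, mem_pre.1 x.2⟩))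
      map_mul' := fun a b => SmoothVectorBundle.sec_ext fun x => map_mul
        ((ExteriorAlgebra.map (A.fiberMap g x.1)).comp (A.val ⟨base g x.1, mem_pre.1 x.2⟩)) a b
      map_zero' := SmoothVectorBundle.sec_ext fun x => map_zero
        ((ExteriorAlgebra.map (A.fiberMap g x.1)).comp (A.val ⟨base g x.1, mem_pre.1 x.2⟩))
      map_add' := fun a b => SmoothVectorBundle.sec_ext fun x => map_add
        ((ExteriorAlgebra.map (A.fiberMap g x.1)).comp (A.val ⟨base g x.1, mem_pre.1 x.2⟩)) a b
      commutes' := fun r => SmoothVectorBundle.sec_ext fun x => AlgHom.commutes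
        ((ExteriorAlgebra.map (A.fiberMap g x.1)).comp (A.val ⟨base g x.1, mem_pre.1 x.2⟩)) r }

theorem val_liftPull {U : Opens X.carrier} (x : pre g U) (o : X.O.Sec U) :
    A.val x (A.liftPull g U o) = ExteriorAlgebra.map (A.fiberMap g x.1)
      (A.val (⟨base g x.1, mem_pre.1 x.2⟩ : U) o) :=
  A.val_ξ x _

theorem liftPull_res {U V : Opens X.carrier} (hUV : U ≤ V) (o : X.O.Sec V) :
    A.liftPull g U (X.O.res hUV o) = X.O.res (pre_mono g hUV) (A.liftPull g V o) :=
  A.eq_of_val fun x => by rw [val_liftPull, val_res, val_res, val_liftPull]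

theorem liftPull_mem_parity {U : Opens X.carrier} {i : ZMod 2} {o : X.O.Sec U}
    (ho : o ∈ X.O.parity U i) : A.liftPull g U o ∈ X.O.parity (pre g U) i :=
  A.mem_parity_iff.2 fun x => by
    rw [val_liftPull]
    exact map_mem_evenOdd _ (A.mem_parity_iff.1 ho ⟨base g x.1, mem_pre.1 x.2⟩)

/-- The lift of an endomorphism of `X / J ^ 2`, as a morphism of presheafed spaces. -/
def liftPresheafed : X.toPresheafed ⟶ X.toPresheafed where
  base := (Hom.hom g).base
  c :=
    { app := fun U => AlgCat.ofHom (A.liftPull g U.unop)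
      naturality := by
        intro U V i
        ext s
        exact A.liftPull_res g i.unop.le s }

/-- The lift of an endomorphism of `X / J ^ 2` to an endomorphism of `X`. -/
def liftHom : X ⟶ X :=
  Hom.mk (A.liftPresheafed g) (contMDiff_base g) fun U i s hs =>
    A.liftPull_mem_parity g (U := U) (i := i) (o := s) hs

theorem val_liftHom (U : Opens X.carrier) (s : X.O.Sec U) (x : X.carrier)
    (hx : x ∈ preimageOf (Hom.hom (A.liftHom g)) U) :
    A.val (⟨x, hx⟩ : preimageOf (Hom.hom (A.liftHom g)) U)
      (pullbackOf (Hom.hom (A.liftHom g)) U s) =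
      ExteriorAlgebra.map (A.fiberMap g x) (A.val (⟨base g x, hx⟩ : U) s) :=
  A.val_liftPull g ⟨x, hx⟩ s

theorem hom_ext_val (f k : X ⟶ X) (hb : (Hom.hom f).base = (Hom.hom k).base)
    (hv : ∀ (U : Opens X.carrier) (s : X.O.Sec U) (x : X.carrier)
      (hx : x ∈ preimageOf (Hom.hom f) U) (hx' : x ∈ preimageOf (Hom.hom k) U),
      A.val (⟨x, hx⟩ : preimageOf (Hom.hom f) U) (pullbackOf (Hom.hom f) U s) =
        A.val (⟨x, hx'⟩ : preimageOf (Hom.hom k) U) (pullbackOf (Hom.hom k) U s)) : f = k :=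
  Hom.ext_of_base _ _ hb fun U s V hV hV' => A.eq_of_val fun x => by
    rw [val_res, val_res]
    exact hv U s x.1 (hV x.2) (hV' x.2)

theorem map_fiberMap_id (x : X.carrier) (a : ExteriorAlgebra ℝ (A.E.fiber x)) :
    ExteriorAlgebra.map (A.fiberMap (𝟙 (X.modPow 2)) x) a = a := by
  have : A.fiberMap (𝟙 (X.modPow 2)) x = LinearMap.id := LinearMap.ext (A.fiberMap_id x)
  rw [this]
  exact DFunLike.congr_fun ExteriorAlgebra.map_id a

theorem map_fiberMap_comp (x : X.carrier) (a : ExteriorAlgebra ℝ (A.E.fiber (base h (base g x)))) :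
    ExteriorAlgebra.map (A.fiberMap (g ≫ h) x) a =
      ExteriorAlgebra.map (A.fiberMap g x) (ExteriorAlgebra.map (A.fiberMap h (base g x)) a) := by
  have h3 : A.fiberMap (g ≫ h) x = A.fiberMap g x ∘ₗ A.fiberMap h (base g x) :=
    LinearMap.ext (A.fiberMap_comp g h x)
  have h4 := ExteriorAlgebra.map_comp_map (A.fiberMap h (base g x)) (A.fiberMap g x)
  rw [← h3] at h4
  exact DFunLike.congr_fun h4.symm a

theorem liftHom_id : A.liftHom (𝟙 _) = 𝟙 X := by
  refine A.hom_ext_val _ _ rfl fun U s x hx hx' => ?_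
  exact (A.val_liftHom (𝟙 _) U s x hx).trans (A.map_fiberMap_id x _)

theorem val_pullback_comp (f k : X ⟶ X) (U : Opens X.carrier) (s : X.O.Sec U) (x : X.carrier)
    (hx : x ∈ preimageOf (Hom.hom (f ≫ k)) U) :
    A.val (⟨x, hx⟩ : preimageOf (Hom.hom (f ≫ k)) U) (pullbackOf (Hom.hom (f ≫ k)) U s) =
      A.val (⟨x, hx⟩ : preimageOf (Hom.hom f) (preimageOf (Hom.hom k) U))
        (pullbackOf (Hom.hom f) _ (pullbackOf (Hom.hom k) U s)) := rfl

theorem hom_base_comp {X Y Z : SuperSpace.{u} m} (f : X ⟶ Y) (k : Y ⟶ Z) :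
    (Hom.hom (f ≫ k)).base = (Hom.hom f).base ≫ (Hom.hom k).base := rfl

theorem liftHom_base : (Hom.hom (A.liftHom g)).base = (Hom.hom g).base := rfl

theorem liftHom_comp_base : (Hom.hom (A.liftHom (g ≫ h))).base =
    (Hom.hom (A.liftHom g ≫ A.liftHom h)).base :=
  (A.liftHom_base (g ≫ h)).trans ((hom_base_comp g h).trans
    (hom_base_comp (A.liftHom g) (A.liftHom h)).symm)

theorem val_liftHom_comp (U : Opens X.carrier) (s : X.O.Sec U) (x : X.carrier)
    (hx : x ∈ preimageOf (Hom.hom (A.liftHom g ≫ A.liftHom h)) U) :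
    A.val (⟨x, hx⟩ : preimageOf (Hom.hom (A.liftHom g ≫ A.liftHom h)) U)
      (pullbackOf (Hom.hom (A.liftHom g ≫ A.liftHom h)) U s) =
    ExteriorAlgebra.map (A.fiberMap g x) (ExteriorAlgebra.map (A.fiberMap h (base g x))
      (A.val (⟨base h (base g x), hx⟩ : U) s)) :=
  (A.val_pullback_comp _ _ U s x hx).trans
    ((A.val_liftHom g (preimageOf (Hom.hom (A.liftHom h)) U) _ x hx).trans
      (congrArg (ExteriorAlgebra.map (A.fiberMap g x)) (A.val_liftHom h U s (base g x) hx)))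

theorem liftHom_comp : A.liftHom (g ≫ h) = A.liftHom g ≫ A.liftHom h :=
  A.hom_ext_val _ _ (A.liftHom_comp_base g h) fun U s x hx hx' =>
    ((A.val_liftHom (g ≫ h) U s x hx).trans (A.map_fiberMap_comp g h x _)).trans
      (A.val_liftHom_comp g h U s x hx').symm

/-- `Λ` of a linear map preserves the augmentation and acts as that map in degree one; by `aug_pull`
and `lin_pull`, so does `g`. -/
theorem quotPullback_liftHom (U : Opens X.carrier) (q : X.O.QuotSec 2 U) :
    Hom.quotPullback (A.liftHom g) 2 U q = pull g U q := by
  refine A.eq_of_aug_lin (V := pre g U) (fun x => ?_) fun x => ?_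
  · rw [aug_pull]
    obtain ⟨o, rfl⟩ := X.O.quotMk_surjective 2 U q
    refine (congrArg algebraMapInv (A.val_liftHom g U o x.1 x.2)).trans ?_
    rw [algebraMapInv_map, aug_mk]
  · rw [lin_pull]
    obtain ⟨o, rfl⟩ := X.O.quotMk_surjective 2 U q
    refine (congrArg ιInv (A.val_liftHom g U o x.1 x.2)).trans ?_
    rw [ιInv_map, lin_mk]

theorem modPow_liftHom : Hom.modPow (A.liftHom g) 2 = g :=
  Hom.ext_of_base (X := X.modPow 2) (Y := X.modPow 2) _ _ rfl fun U q _ hV _ =>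
    congrArg (X.O.quotRes 2 (V := pre g U) hV) (A.quotPullback_liftHom g U q)

/-- The homomorphism `Aut(X / J ^ 2) → Aut(X)` given by the bundle `E`. -/
def splitting : Aut (X.modPow 2) →* Aut X where
  toFun g := ⟨A.liftHom g.hom, A.liftHom g.inv, by rw [← liftHom_comp, g.hom_inv_id, liftHom_id],
    by rw [← liftHom_comp, g.inv_hom_id, liftHom_id]⟩
  map_one' := Aut.ext A.liftHom_id
  -- The product in `Aut` composes from right to left, hence the exchange of `g` and `h`.
  map_mul' g h := Aut.ext (A.liftHom_comp h.hom g.hom)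

theorem autModPow_splitting (g : Aut (X.modPow 2)) : X.autModPow 2 (A.splitting g) = g :=
  Aut.ext (A.modPow_liftHom g.hom)

/-- The inverse fibre maps of the bundle automorphism are the degree-one part of the action of `a`,
which by `lin_pull` depends only on `a` modulo `J^2`. -/
theorem eq_splitting_of_isInduced (a : Aut X) (ha : A.IsInduced a) :
    a = A.splitting (X.autModPow 2 a) := by
  obtain ⟨φ, hφ⟩ := ha
  let g : X.modPow 2 ⟶ X.modPow 2 := Hom.modPow a.hom 2
  have hval : ∀ (U : Opens X.carrier) (o : X.O.Sec U) (x : pre g U),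
      A.val x (pullbackOf (Hom.hom a.hom) U o) =
        ExteriorAlgebra.map (φ.fiberEquiv x.1).symm.toLinearMap
          (A.val (⟨base g x.1, mem_pre.1 x.2⟩ : U) o) := by
    intro U o x
    have := hφ U ((A.ξ.equiv U le_top).symm o) x
    rw [AlgEquiv.apply_symm_apply] at this
    exact this
  have hfib : ∀ x, (φ.fiberEquiv x).symm.toLinearMap = A.fiberMap g x := by
    intro x
    ext1 v
    obtain ⟨q, rfl⟩ := A.exists_lin (base g x) v
    have hx : x ∈ pre g (A.E.baseOpen (base g x)) := mem_pre.2 (A.E.mem_baseOpen _)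
    have h1 := A.lin_pull g ⟨x, hx⟩ q
    obtain ⟨o, rfl⟩ := X.O.quotMk_surjective 2 _ q
    refine Eq.trans ?_ h1
    refine Eq.trans ?_ (congrArg ιInv (hval _ o ⟨x, hx⟩)).symm
    exact (ιInv_map _ _).symm
  refine Aut.ext (A.hom_ext_val _ _ rfl fun U s x hx hx' => ?_)
  refine (hval U s ⟨x, hx⟩).trans (Eq.trans ?_ (A.val_liftHom g U s x hx).symm)
  exact congrArg (fun f => ExteriorAlgebra.map f _) (hfib x)

end AssociatedBundle

end SuperSpace


/-! ### The bundle automorphism behind the splitting -/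

namespace SuperSpace

open ExteriorAlgebra SuperPresheaf

variable {m n : ℕ} {X : SuperSpace.{u} m}

namespace AssociatedBundle

open QuotHom

variable (A : X.AssociatedBundle n) (g h : Aut (X.modPow 2))

/-- The action of an automorphism of `X / J ^ 2` on the fibres of `E`. -/
def fiberEquiv (x : X.carrier) : A.E.fiber x ≃ₗ[ℝ] A.E.fiber (base g.hom x) :=
  (LinearEquiv.ofBijective (A.fiberMap g.hom x) (A.fiberMap_bijective _ _ g.hom_inv_id x)).symm

theorem fiberMap_fiberEquiv (x : X.carrier) (v : A.E.fiber x) :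
    A.fiberMap g.hom x (A.fiberEquiv g x v) = v :=
  LinearEquiv.apply_symm_apply
    (LinearEquiv.ofBijective (A.fiberMap g.hom x) (A.fiberMap_bijective _ _ g.hom_inv_id x)) v

/-- The action of an automorphism of `X / J ^ 2` on the total space of `E`. -/
def totalMap (p : A.E.Total) : A.E.Total := ⟨base g.hom p.1, A.fiberEquiv g p.1 p.2⟩

theorem totalMap_one (p : A.E.Total) : A.totalMap 1 p = p := by
  obtain ⟨x, v⟩ := p
  have : A.fiberEquiv 1 x v = v :=
    (A.fiberMap_id x _).symm.trans (A.fiberMap_fiberEquiv 1 x v)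
  exact congrArg (fun w : A.E.fiber x => (⟨x, w⟩ : A.E.Total)) this

theorem totalMap_mul (p : A.E.Total) : A.totalMap (g * h) p = A.totalMap g (A.totalMap h p) := by
  obtain ⟨x, v⟩ := p
  have h1 : A.fiberEquiv (g * h) x v = A.fiberEquiv g (base h.hom x) (A.fiberEquiv h x v) := by
    refine (A.fiberMap_bijective _ _ (g * h).hom_inv_id x).1 ?_
    rw [fiberMap_fiberEquiv]
    refine Eq.trans ?_ (A.fiberMap_comp h.hom g.hom x _).symm
    rw [fiberMap_fiberEquiv, fiberMap_fiberEquiv]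
  exact congrArg (fun w : A.E.fiber (base g.hom (base h.hom x)) =>
    (⟨base g.hom (base h.hom x), w⟩ : A.E.Total)) h1

theorem isInvertible_coordMap {x₀ x : X.carrier} (hx : x ∈ A.E.baseOpen x₀)
    (hx' : base g.hom x ∈ A.E.baseOpen (base g.hom x₀)) :
    ∃ e : EuclideanSpace ℝ (Fin n) ≃L[ℝ] EuclideanSpace ℝ (Fin n),
      (e : EuclideanSpace ℝ (Fin n) →L[ℝ] EuclideanSpace ℝ (Fin n)) = A.coordMap g.hom x₀ x ∧
      ∀ v : A.E.fiber x, e.symm (A.E.coordEquiv x₀ hx v) =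
        A.E.coordEquiv (base g.hom x₀) hx' (A.fiberEquiv g x v) := by
  refine ⟨(((A.E.coordEquiv (base g.hom x₀) hx').symm.trans (A.fiberEquiv g x).symm).trans
    (A.E.coordEquiv x₀ hx)).toContinuousLinearEquiv, ?_, fun v => ?_⟩
  · ext1 v
    exact (A.coordMap_apply g.hom hx hx' v).symm
  · change A.E.coordEquiv (base g.hom x₀) hx' (A.fiberEquiv g x
      ((A.E.coordEquiv x₀ hx).symm (A.E.coordEquiv x₀ hx v))) = _
    rw [LinearEquiv.symm_apply_apply]

theorem contMDiff_totalMap :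
    ContMDiff ((𝓡 m).prod 𝓘(ℝ, EuclideanSpace ℝ (Fin n)))
      ((𝓡 m).prod 𝓘(ℝ, EuclideanSpace ℝ (Fin n))) ∞ (A.totalMap g) := by
  intro p₀
  have hproj : ContMDiffAt ((𝓡 m).prod 𝓘(ℝ, EuclideanSpace ℝ (Fin n))) (𝓡 m) ∞
      (fun p : A.E.Total => p.proj) p₀ := contMDiffAt_proj A.E.fiber
  have hfib : ContMDiffAt ((𝓡 m).prod 𝓘(ℝ, EuclideanSpace ℝ (Fin n)))
      𝓘(ℝ, EuclideanSpace ℝ (Fin n)) ∞ (fun p : A.E.Total => (A.E.triv p₀.proj p).2) p₀ :=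
    (contMDiffAt_totalSpace.1 (contMDiffAt_id (x := p₀))).2
  refine contMDiffAt_totalSpace.2 ⟨(contMDiff_base g.hom _).comp p₀ hproj, ?_⟩
  obtain ⟨e, he, -⟩ := A.isInvertible_coordMap g (A.E.mem_baseOpen p₀.proj)
    (A.E.mem_baseOpen (base g.hom p₀.proj))
  have h1 := (A.contMDiffAt_coordMap g.hom (A.mem_coordOpen g.hom p₀.proj)).comp p₀ hproj
  -- The bundle map runs opposite to the maps `E_(f x) → E_x`, so its smoothness comes from
  -- smoothness of inversion at an invertible operator.
  have h2 : ContDiffAt ℝ ∞ (ContinuousLinearMap.inverse :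
      (EuclideanSpace ℝ (Fin n) →L[ℝ] EuclideanSpace ℝ (Fin n)) → _)
      (A.coordMap g.hom p₀.proj p₀.proj) := by
    rw [← he]
    exact contDiffAt_map_inverse e
  have h3 := (h2.contMDiffAt.comp p₀ h1).clm_apply hfib
  refine h3.congr_of_eventuallyEq ?_
  have hnhds : ∀ᶠ p : A.E.Total in nhds p₀, p.proj ∈ A.coordOpen g.hom p₀.proj :=
    hproj.continuousAt.eventually
      ((A.coordOpen g.hom p₀.proj).isOpen.mem_nhds (A.mem_coordOpen g.hom p₀.proj))
  filter_upwards [hnhds] with p hp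
  have hp1 : p.proj ∈ A.E.baseOpen p₀.proj := hp.1
  have hp2 : base g.hom p.proj ∈ A.E.baseOpen (base g.hom p₀.proj) := hp.2
  obtain ⟨e', he', hv⟩ := A.isInvertible_coordMap g hp1 hp2
  refine (hv p.2).symm.trans ?_
  change _ = ContinuousLinearMap.inverse (A.coordMap g.hom p₀.proj p.proj) _
  rw [← he', ContinuousLinearMap.inverse_equiv]
  rfl

/-- The automorphism of `E` induced by an automorphism of `X / J ^ 2`. -/
def autOver : A.E.AutOver (base g.hom) where
  fiberEquiv := A.fiberEquiv g
  total :=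
    { toFun := A.totalMap g
      invFun := A.totalMap g⁻¹
      left_inv := fun p => by rw [← totalMap_mul, inv_mul_cancel, totalMap_one]
      right_inv := fun p => by rw [← totalMap_mul, mul_inv_cancel, totalMap_one]
      contMDiff_toFun := A.contMDiff_totalMap g
      contMDiff_invFun := A.contMDiff_totalMap g⁻¹ }
  total_mk _ _ := rfl

theorem isInduced_splitting : A.IsInduced (A.splitting g) := by
  refine ⟨A.autOver g, fun U s x => ?_⟩
  have h1 := A.val_liftHom g.hom U (A.ξ.equiv U le_top s) x.1 x.2
  exact h1.trans (congrArg (ExteriorAlgebra.map (A.fiberMap g.hom x.1))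
    (A.val_ξ (⟨base g.hom x.1, x.2⟩ : U) s))

end AssociatedBundle

/-! ### The sheaf `O / J ^ 2` -/

namespace AssociatedBundle

variable (A : X.AssociatedBundle n)

/-- The part of degree at most one of an element of the exterior algebra. -/
def trunc (V : Type*) [AddCommGroup V] [Module ℝ V] :
    ExteriorAlgebra ℝ V →ₗ[ℝ] ExteriorAlgebra ℝ V :=
  Algebra.linearMap ℝ _ ∘ₗ algebraMapInv.toLinearMap + ι ℝ ∘ₗ ιInv

theorem trunc_apply {V : Type*} [AddCommGroup V] [Module ℝ V] (a : ExteriorAlgebra ℝ V) :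
    trunc V a = algebraMap ℝ _ (algebraMapInv a) + ι ℝ (ιInv a) := rfl

theorem map_trunc {V W : Type*} [AddCommGroup V] [Module ℝ V] [AddCommGroup W] [Module ℝ W]
    (f : V →ₗ[ℝ] W) (a : ExteriorAlgebra ℝ V) :
    ExteriorAlgebra.map f (trunc V a) = trunc W (ExteriorAlgebra.map f a) := by
  rw [trunc_apply, trunc_apply, map_add, AlgHom.commutes, map_apply_ι, algebraMapInv_map, ιInv_map]

theorem exists_trunc {V : Opens X.carrier} (o : X.O.Sec V) :
    ∃ t : X.O.Sec V, ∀ x : V, A.val x t = trunc _ (A.val x o) := by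
  refine ⟨A.ξ.equiv V le_top ⟨fun x => trunc _ (A.val x o), fun x₀ l => ?_⟩, fun x => A.val_ξ x _⟩
  refine (((A.ξ.equiv V le_top).symm o).2 x₀ (l ∘ₗ trunc _)).congr_of_eventuallyEq
    (Filter.Eventually.of_forall fun x => ?_)
  exact congrArg l (map_trunc _ _)

/-- The lift without terms of degree above one is determined by `aug` and `lin`. Being canonical,
such lifts of compatible local sections agree on overlaps and glue in `O`, which is how
`isSheaf_quot` proceeds. -/
theorem exists_lift {V : Opens X.carrier} (q : X.O.QuotSec 2 V) :
    ∃ t : X.O.Sec V, X.O.quotMk 2 V t = q ∧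
      ∀ x : V, A.val x t = algebraMap ℝ _ (A.aug x q) + ι ℝ (A.lin x q) := by
  obtain ⟨o, rfl⟩ := X.O.quotMk_surjective 2 V q
  obtain ⟨t, ht⟩ := A.exists_trunc o
  refine ⟨t, A.eq_of_aug_lin (fun x => ?_) fun x => ?_, ht⟩
  · rw [aug_mk, aug_mk, ht, trunc_apply, map_add, algebraMapInv_algebraMap, algebraMapInv_ι,
      add_zero]
  · rw [lin_mk, lin_mk, ht, trunc_apply, map_add, ιInv_algebraMap, ιInv_ι, zero_add]

theorem isSheaf_quot (A : X.AssociatedBundle n) (hX : X.O.presheaf.IsSheaf) : (X.O.quot 2).presheaf.IsSheaf := by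
  refine isSheaf_of_glue (fun V s t h => ?_) fun I U sf h => ?_
  · refine A.eq_of_aug_lin (fun x => ?_) fun x => ?_
    · obtain ⟨W, hxW, hW, h1⟩ := h x.1 x.2
      have h2 := A.aug_res hW ⟨x.1, hxW⟩ s
      have h3 := A.aug_res hW ⟨x.1, hxW⟩ t
      exact h2.symm.trans ((congrArg (A.aug ⟨x.1, hxW⟩) h1).trans h3)
    · obtain ⟨W, hxW, hW, h1⟩ := h x.1 x.2
      have h2 := A.lin_res hW ⟨x.1, hxW⟩ s
      have h3 := A.lin_res hW ⟨x.1, hxW⟩ t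
      exact h2.symm.trans ((congrArg (A.lin ⟨x.1, hxW⟩) h1).trans h3)
  · choose t ht htv using fun i => A.exists_lift (sf i)
    obtain ⟨s, hs⟩ := exists_glue hX U (iSup U) (le_iSup U) le_rfl t fun i j =>
      A.eq_of_val fun x => by
        rw [A.val_res, A.val_res, htv, htv]
        have h0 := congrArg (A.aug x) (h i j)
        have h1 := congrArg (A.lin x) (h i j)
        have h2 := (A.aug_res inf_le_left x (sf i)).symm.trans (h0.trans (A.aug_res _ x (sf j)))
        have h3 := (A.lin_res inf_le_left x (sf i)).symm.trans (h1.trans (A.lin_res _ x (sf j)))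
        exact congrArg₂ (fun (r : ℝ) (v : A.E.fiber x.1) =>
          algebraMap ℝ (ExteriorAlgebra ℝ (A.E.fiber x.1)) r + ExteriorAlgebra.ι ℝ v) h2 h3
    exact ⟨X.O.quotMk 2 _ s, fun i => (congrArg (X.O.quotMk 2 (U i)) (hs i)).trans (ht i)⟩

end AssociatedBundle

/-- A homomorphism with a section is a split extension of its image by its kernel. -/
theorem exists_semidirectProduct_mulEquiv {G H : Type*} [Group G] [Group H] (p : G →* H)
    (N : Subgroup G) [N.Normal] (hN : N = p.ker) (σ : H →* G) (hσ : ∀ h, p (σ h) = h) :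
    ∃ e : N ⋊[(MulAut.conjNormal (H := N)).comp σ] H ≃* G,
      ∀ (a : N) (h : H), e ⟨a, h⟩ = (a : G) * σ h := by
  subst hN
  let e : p.ker ⋊[(MulAut.conjNormal (H := p.ker)).comp σ] H →* G :=
    { toFun := fun a => (a.1 : G) * σ a.2
      map_one' := by simp
      map_mul' := fun a b => by simp [mul_assoc] }
  refine ⟨MulEquiv.ofBijective e ⟨fun a b hab => ?_, fun x => ?_⟩, fun a h => rfl⟩
  · have h1 : (a.1 : G) * σ a.2 = (b.1 : G) * σ b.2 := hab
    have h2 := congrArg p h1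
    rw [map_mul, map_mul, a.1.2, b.1.2, one_mul, one_mul, hσ, hσ] at h2
    rw [h2] at h1
    exact SemidirectProduct.ext (Subtype.ext (mul_right_cancel h1)) h2
  · refine ⟨⟨⟨x * (σ (p x))⁻¹, ?_⟩, p x⟩, ?_⟩
    · rw [MonoidHom.mem_ker, map_mul, map_inv, hσ, mul_inv_cancel]
    · exact inv_mul_cancel_right x (σ (p x))

end SuperSpace


/-! ### Split supermanifolds -/

namespace ExteriorAlgebra

variable {V : Type*} [AddCommGroup V] [Module ℝ V]

theorem mul_comm_of_mem_evenOdd {i j : ZMod 2} {a b : ExteriorAlgebra ℝ V}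
    (ha : a ∈ CliffordAlgebra.evenOdd (0 : QuadraticForm ℝ V) i)
    (hb : b ∈ CliffordAlgebra.evenOdd (0 : QuadraticForm ℝ V) j) :
    a * b = (-1 : ℝ) ^ (i.val * j.val) • (b * a) := by
  have h := CliffordAlgebra.map_mul_map_of_isOrtho_of_mem_evenOdd
    (QuadraticMap.Isometry.id (0 : QuadraticForm ℝ V))
    (QuadraticMap.Isometry.id (0 : QuadraticForm ℝ V)) 
    (fun x y => QuadraticMap.isOrtho_def.2 (by simp)) a b ha hb
  rw [CliffordAlgebra.map_id] at h
  refine h.trans ?_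
  have : ∀ i j : ZMod 2, ((-1 : ℤˣ) ^ (j * i)) = (-1 : ℤˣ) ^ (i.val * j.val) := by decide
  rw [this, Units.smul_def]
  rcases Nat.even_or_odd (i.val * j.val) with h1 | h1 <;> simp [h1.neg_one_pow]

end ExteriorAlgebra

namespace TrivSheaf

open ExteriorAlgebra SuperPresheaf

variable {m n : ℕ} {M : Type u} [TopologicalSpace M] [ChartedSpace (EuclideanSpace ℝ (Fin m)) M]

theorem isSheaf : (trivSheaf m n M).presheaf.IsSheaf := by
  refine isSheaf_of_glue (fun V s t h => TrivSheaf.ext fun x => ?_) fun I U sf h => ?_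
  · obtain ⟨W, hxW, hW, h1⟩ := h x.1 x.2
    exact congrArg (eval (⟨x.1, hxW⟩ : W)) h1
  · choose i hi using fun x : (iSup U : Opens M) => Opens.mem_iSup.1 x.2
    have key : ∀ (j : I) (x : U j), eval ⟨x.1, hi ⟨x.1, le_iSup U j x.2⟩⟩
        (sf (i ⟨x.1, le_iSup U j x.2⟩)) = eval x (sf j) := fun j x =>
      congrArg (eval (⟨x.1, hi ⟨x.1, le_iSup U j x.2⟩, x.2⟩ : (U _ ⊓ U j : Opens M))) (h _ j)
    refine ⟨mk (fun x => eval ⟨x.1, hi x⟩ (sf (i x))) fun l x => ?_, fun j =>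
      TrivSheaf.ext fun x => key j x⟩
    refine contMDiffAt_of_restrict (le_iSup U (i x)) (x := ⟨x.1, hi x⟩) ?_
    refine (contMDiff_eval (sf (i x)) l _).congr_of_eventuallyEq
      (Filter.Eventually.of_forall fun y => ?_)
    exact congrArg l (key _ y)

theorem isCompl_parity (U : Opens M) :
    IsCompl ((trivSheaf m n M).parity U 0) ((trivSheaf m n M).parity U 1) := by
  have hc := CliffordAlgebra.evenOdd_isCompl (0 : QuadraticForm ℝ (EuclideanSpace ℝ (Fin n)))
  refine ⟨Submodule.disjoint_def.2 fun s h0 h1 => TrivSheaf.ext fun x => ?_,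
    Submodule.codisjoint_iff_exists_add_eq.2 fun s => ⟨mapVal (Submodule.projection _ _ hc) s,
      mapVal (Submodule.projection _ _ hc.symm) s, fun x => ?_, fun x => ?_, TrivSheaf.ext fun x => ?_⟩⟩
  · rw [map_zero]
    exact Submodule.disjoint_def.1 hc.disjoint _ (h0 x) (h1 x)
  · exact Submodule.projection_apply_mem hc _
  · exact Submodule.projection_apply_mem hc.symm _
  · rw [map_add, eval_mapVal, eval_mapVal]
    exact Submodule.projection_add_projection_eq_self hc _

end TrivSheaf

namespace SuperSpace

open ExteriorAlgebra SuperPresheaf TrivSheaf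

/-- The supermanifold `(M, C^∞ ⊗ Λₙ)`. -/
abbrev split (m n : ℕ) (M : Type u) [TopologicalSpace M]
    [ChartedSpace (EuclideanSpace ℝ (Fin m)) M] : SuperSpace.{u} m where
  carrier := M
  O := trivSheaf m n M

variable {m n : ℕ} {M : Type u} [TopologicalSpace M] [ChartedSpace (EuclideanSpace ℝ (Fin m)) M]

instance isSupermanifold_split [IsManifold (𝓡 m) ∞ M] [T2Space M] [SecondCountableTopology M] :
    (split m n M).IsSupermanifold n where
  isManifold := inferInstanceAs (IsManifold (𝓡 m) ∞ M)
  t2 := inferInstanceAs (T2Space M)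
  secondCountable := inferInstanceAs (SecondCountableTopology M)
  isSheaf := TrivSheaf.isSheaf
  gradedMonoid U :=
    { one_mem := fun _ => SetLike.GradedOne.one_mem
      mul_mem := fun _ _ _ _ ha hb x => SetLike.GradedMul.mul_mem (ha x) (hb x) }
  isInternal U := by
    refine (DirectSum.isInternal_submodule_iff_isCompl _ (i := (0 : ZMod 2)) (j := 1) (by simp)
      ?_).2 (TrivSheaf.isCompl_parity U)
    ext j
    revert j
    simp only [Set.mem_univ, Set.mem_insert_iff, Set.mem_singleton_iff, true_iff]
    decide
  supercomm U i j a b ha hb := TrivSheaf.ext fun x => by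
    rw [map_mul, map_smul, map_mul]
    exact mul_comm_of_mem_evenOdd (ha x) (hb x)
  locally_split x := ⟨⊤, trivial, ⟨⟨fun _ _ => AlgEquiv.refl, fun _ _ _ _ _ => rfl,
    fun _ _ _ _ => Iff.rfl⟩⟩⟩

variable (m n M) in
/-- The trivial bundle, as the bundle associated with a split supermanifold. -/
def splitBundle : (split m n M).AssociatedBundle n where
  E := SmoothVectorBundle.trivial m n M
  ξ := ⟨fun _ _ => AlgEquiv.refl, fun _ _ _ _ _ => rfl, fun _ _ _ _ => Iff.rfl⟩

/-- The action on sections of an endomorphism of `Λₙ`. -/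
def constPull (θ : Lam n →ₐ[ℝ] Lam n) (U : Opens M) :
    (trivSheaf m n M).Sec U →ₐ[ℝ] (trivSheaf m n M).Sec U :=
  AlgHom.ofLinearMap (mapVal θ.toLinearMap) (TrivSheaf.ext fun _ => map_one θ)
    fun _ _ => TrivSheaf.ext fun _ => map_mul θ _ _

variable (m M) in
/-- The endomorphism of the presheafed space of a split supermanifold given by an endomorphism of
`Λₙ`. -/
def constPresheafed (θ : Lam n →ₐ[ℝ] Lam n) :
    (split m n M).toPresheafed ⟶ (split m n M).toPresheafed where
  base := 𝟙 _
  c :=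
    { app := fun U : (Opens M)ᵒᵖ => AlgCat.ofHom (constPull (m := m) θ U.unop)
      naturality := fun _ _ _ => rfl }

/-- The endomorphism of a split supermanifold given by an endomorphism of `Λₙ`. -/
def constHom (θ : Lam n →ₐ[ℝ] Lam n) (hθ : ∀ i, ∀ a ∈ CliffordAlgebra.evenOdd
    (0 : QuadraticForm ℝ (EuclideanSpace ℝ (Fin n))) i, θ a ∈ CliffordAlgebra.evenOdd
    (0 : QuadraticForm ℝ (EuclideanSpace ℝ (Fin n))) i) : split m n M ⟶ split m n M :=
  Hom.mk (constPresheafed m M θ)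
    (show ContMDiff (𝓡 m) (𝓡 m) ∞ (fun x : M => x) from contMDiff_id)
    fun _ i _ hs x => hθ i _ (hs x)

/-- The automorphism of a split supermanifold given by an automorphism of `Λₙ`. -/
def constAut (θ : Lam n ≃ₐ[ℝ] Lam n) (hθ : ∀ i, ∀ a ∈ CliffordAlgebra.evenOdd
    (0 : QuadraticForm ℝ (EuclideanSpace ℝ (Fin n))) i, θ a ∈ CliffordAlgebra.evenOdd
    (0 : QuadraticForm ℝ (EuclideanSpace ℝ (Fin n))) i)
    (hθ' : ∀ i, ∀ a ∈ CliffordAlgebra.evenOdd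
    (0 : QuadraticForm ℝ (EuclideanSpace ℝ (Fin n))) i, θ.symm a ∈ CliffordAlgebra.evenOdd
    (0 : QuadraticForm ℝ (EuclideanSpace ℝ (Fin n))) i) : Aut (split m n M) where
  hom := constHom θ.toAlgHom hθ
  inv := constHom θ.symm.toAlgHom hθ'
  hom_inv_id := (splitBundle m n M).hom_ext_val _ _ rfl fun U s x _ hx' =>
    θ.apply_symm_apply (eval (⟨x, hx'⟩ : U) s)
  inv_hom_id := (splitBundle m n M).hom_ext_val _ _ rfl fun U s x _ hx' =>
    θ.symm_apply_apply (eval (⟨x, hx'⟩ : U) s)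

/-- An endomorphism of `Λₙ` which is the identity modulo `Λₙ^{≥ 2}` induces the identity. -/
theorem modPow_constHom (θ : Lam n →ₐ[ℝ] Lam n) (hθ) (h : ∀ a, θ a - a ∈ degGE _ 2) :
    Hom.modPow (constHom (m := m) (M := M) θ hθ) 2 = 𝟙 ((split m n M).modPow 2) := by
  refine Hom.ext_of_base (X := (split m n M).modPow 2) (Y := (split m n M).modPow 2) _ _ rfl
    fun U q V hV _ => congrArg ((split m n M).O.quotRes 2 (V := U) hV) ?_
  obtain ⟨s, rfl⟩ := (split m n M).O.quotMk_surjective 2 U q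
  exact Ideal.Quotient.eq.2 (TrivSheaf.mem_nilIdeal_iff.2 fun x => h (eval x s))

/-! ### Endomorphisms of a superpoint -/

section Point

variable [Unique M]

/-- The action on `Λₙ` of an endomorphism of a superpoint. -/
def ptHom (f : split m n M ⟶ split m n M) : Lam n →ₐ[ℝ] Lam n :=
  (eval (⟨default, trivial⟩ : preimageOf (Hom.hom f) ⊤)).comp
    ((pullbackOf (Hom.hom f) ⊤).comp (const m ⊤))

/-- Over a one-point space every section is the restriction of a constant one, so an endomorphism is
governed by its action on `Λₙ`. -/
theorem eval_pullback_point (f : split m n M ⟶ split m n M) {U : Opens M} (hU : default ∈ U)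
    (hU' : default ∈ preimageOf (Hom.hom f) U) (s : (trivSheaf m n M).Sec U) :
    eval (⟨default, hU'⟩ : preimageOf (Hom.hom f) U) (pullbackOf (Hom.hom f) U s) =
      ptHom f (eval ⟨default, hU⟩ s) := by
  have h1 : s = (trivSheaf m n M).res (le_top : U ≤ ⊤) (const m ⊤ (eval ⟨default, hU⟩ s)) :=
    TrivSheaf.ext fun x => by
      obtain ⟨x, hx⟩ := x
      obtain rfl := Unique.eq_default x
      rfl
  conv_lhs => rw [h1]
  exact congrArg (eval (⟨default, hU'⟩ : preimageOf (Hom.hom f) U))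
    (pullbackOf_res (Hom.hom f) (le_top : U ≤ ⊤) (const m ⊤ (eval ⟨default, hU⟩ s)))

theorem ptHom_comp (f k : split m n M ⟶ split m n M) (a : Lam n) :
    ptHom (f ≫ k) a = ptHom f (ptHom k a) :=
  eval_pullback_point f (U := preimageOf (Hom.hom k) ⊤) trivial trivial
    (pullbackOf (Hom.hom k) ⊤ (const m ⊤ a))

theorem lin_pull_congr {X : SuperSpace.{u} m} (A : X.AssociatedBundle n)
    {g h : X.modPow 2 ⟶ X.modPow 2} (hgh : g = h) {U : Opens X.carrier} (q : X.O.QuotSec 2 U)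
    (x : X.carrier) (hx : x ∈ QuotHom.pre g U) (hx' : x ∈ QuotHom.pre h U) :
    A.lin (⟨x, hx⟩ : QuotHom.pre g U) (QuotHom.pull g U q) =
        A.lin (⟨x, hx'⟩ : QuotHom.pre h U) (QuotHom.pull h U q) ∧
      A.aug (⟨x, hx⟩ : QuotHom.pre g U) (QuotHom.pull g U q) =
        A.aug (⟨x, hx'⟩ : QuotHom.pre h U) (QuotHom.pull h U q) := by
  subst hgh
  exact ⟨rfl, rfl⟩

theorem ptHom_sub_mem (f k : split m n M ⟶ split m n M) (h : Hom.modPow f 2 = Hom.modPow k 2)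
    (a : Lam n) : ptHom f a - ptHom k a ∈ degGE _ 2 := by
  have h1 := lin_pull_congr (splitBundle m n M) h ((trivSheaf m n M).quotMk 2 ⊤ (const m ⊤ a))
    default trivial trivial
  refine mem_degGE_two_iff.2 ⟨?_, ?_⟩
  · rw [map_sub]
    exact sub_eq_zero.2 h1.2
  · rw [map_sub]
    exact sub_eq_zero.2 h1.1

end Point

end SuperSpace


/-! ### Automorphisms of `Λ₃` -/

namespace ExteriorAlgebra

section Shear

variable {V : Type*} [AddCommGroup V] [Module ℝ V]

theorem ι_mem_degGE (v : V) : ι ℝ v ∈ degGE V 1 :=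
  pow_le_degGE (j := 1) le_rfl (by simp)

/-- Each of the `j` generators in a product contributes a factor `c`, up to higher degree. -/
theorem sub_smul_mem_of_mem_pow (s : ExteriorAlgebra ℝ V →ₐ[ℝ] ExteriorAlgebra ℝ V) (c : ℝ)
    (h : ∀ v, s (ι ℝ v) - c • ι ℝ v ∈ degGE V 2) {j : ℕ} {a : ExteriorAlgebra ℝ V}
    (ha : a ∈ LinearMap.range (ι ℝ : V →ₗ[ℝ] _) ^ j) : s a - c ^ j • a ∈ degGE V (j + 1) := by
  induction ha using Submodule.pow_induction_on_left' with
  | algebraMap r => simp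
  | add x y i hx hy h1 h2 =>
    rw [map_add, smul_add, add_sub_add_comm]
    exact Submodule.add_mem _ h1 h2
  | mem_mul m hm i x hx h1 =>
    obtain ⟨v, rfl⟩ := hm
    have hsx : s x ∈ degGE V i := by
      have := Submodule.add_mem _ (degGE_anti i.le_succ h1)
        (Submodule.smul_mem _ (c ^ i) (pow_le_degGE le_rfl hx))
      rwa [sub_add_cancel] at this
    have h2 := mul_mem_degGE (h v) hsx
    have h3 := Submodule.smul_mem _ c (mul_mem_degGE (ι_mem_degGE v) h1)
    have h4 := Submodule.add_mem _ (degGE_anti (by omega : i + 1 + 1 ≤ 2 + i) h2)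
      (degGE_anti (by omega : i + 1 + 1 ≤ 1 + (i + 1)) h3)
    convert h4 using 1
    rw [map_mul, sub_mul, mul_sub, smul_sub, smul_mul_assoc, mul_smul_comm, smul_smul, pow_succ' c]
    abel

theorem algHom_mem_evenOdd (s : ExteriorAlgebra ℝ V →ₐ[ℝ] ExteriorAlgebra ℝ V)
    (h : ∀ v, s (ι ℝ v) ∈ CliffordAlgebra.evenOdd (0 : QuadraticForm ℝ V) 1) (i : ZMod 2)
    (a : ExteriorAlgebra ℝ V) (ha : a ∈ CliffordAlgebra.evenOdd (0 : QuadraticForm ℝ V) i) :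
    s a ∈ CliffordAlgebra.evenOdd (0 : QuadraticForm ℝ V) i := by
  have h1 : ∀ (j : ℕ) (a : ExteriorAlgebra ℝ V), a ∈ LinearMap.range (ι ℝ : V →ₗ[ℝ] _) ^ j →
      s a ∈ CliffordAlgebra.evenOdd (0 : QuadraticForm ℝ V) j := by
    intro j a ha
    induction ha using Submodule.pow_induction_on_left' with
    | algebraMap r =>
      rw [AlgHom.commutes, Algebra.algebraMap_eq_smul_one, Nat.cast_zero]
      exact Submodule.smul_mem _ _ SetLike.GradedOne.one_mem
    | add x y i hx hy h1 h2 =>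
      rw [map_add]
      exact Submodule.add_mem _ h1 h2
    | mem_mul m hm i x hx h1 =>
      obtain ⟨v, rfl⟩ := hm
      rw [map_mul, Nat.succ_eq_add_one, add_comm, Nat.cast_add, Nat.cast_one]
      exact SetLike.GradedMul.mul_mem (h v) h1
  have h2 : CliffordAlgebra.evenOdd (0 : QuadraticForm ℝ V) i ≤
      (CliffordAlgebra.evenOdd (0 : QuadraticForm ℝ V) i).comap s.toLinearMap := by
    refine iSup_le fun j a ha => ?_
    obtain ⟨j, rfl⟩ := j
    exact h1 j a ha
  exact h2 ha

variable [FiniteDimensional ℝ V]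

theorem mul_eq_zero_of_mem_degGE (hV : Module.finrank ℝ V = 3) {a b : ExteriorAlgebra ℝ V}
    {k l : ℕ} (ha : a ∈ degGE V k) (hb : b ∈ degGE V l) (hkl : 4 ≤ k + l) : a * b = 0 := by
  have h := degGE_anti hkl (mul_mem_degGE ha hb)
  rwa [degGE_eq_bot (by omega), Submodule.mem_bot] at h

/-- The endomorphism `θ ↦ θ + f(θ) w` of the exterior algebra of a space of dimension three. -/
def shear (hV : Module.finrank ℝ V = 3) (f : Module.Dual ℝ V) {w : ExteriorAlgebra ℝ V}
    (hw : w ∈ degGE V 3) : ExteriorAlgebra ℝ V →ₐ[ℝ] ExteriorAlgebra ℝ V :=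
  lift ℝ ⟨ι ℝ + f.smulRight w, fun v => by
    -- The relation `(v + f(v) w)² = 0` holds because every product involving `w` has degree at
    -- least four.
    have h1 := mul_eq_zero_of_mem_degGE hV hw hw (by omega)
    have h2 := mul_eq_zero_of_mem_degGE hV hw (ι_mem_degGE v) (by omega)
    have h3 := mul_eq_zero_of_mem_degGE hV (ι_mem_degGE v) hw (by omega)
    simp [add_mul, mul_add, h1, h2, h3]⟩

variable (hV : Module.finrank ℝ V = 3) (f : Module.Dual ℝ V) {w : ExteriorAlgebra ℝ V}
  (hw : w ∈ degGE V 3)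

theorem shear_ι (v : V) : shear hV f hw (ι ℝ v) = ι ℝ v + f v • w := by
  simp [shear]

theorem shear_sub_mem {k : ℕ} {a : ExteriorAlgebra ℝ V} (ha : a ∈ degGE V k) :
    shear hV f hw a - a ∈ degGE V (k + 2) := by
  have h1 : ∀ (j : ℕ) (a : ExteriorAlgebra ℝ V), a ∈ LinearMap.range (ι ℝ : V →ₗ[ℝ] _) ^ j →
      shear hV f hw a - a ∈ degGE V (j + 2) := by
    intro j a ha
    induction ha using Submodule.pow_induction_on_left' with
    | algebraMap r => simp
    | add x y i hx hy h1 h2 =>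
      rw [map_add, add_sub_add_comm]
      exact Submodule.add_mem _ h1 h2
    | mem_mul m hm i x hx h1 =>
      obtain ⟨v, rfl⟩ := hm
      have hsx : shear hV f hw x ∈ degGE V i := by
        have := Submodule.add_mem _ (degGE_anti (by omega : i ≤ i + 2) h1)
          (pow_le_degGE le_rfl hx)
        rwa [sub_add_cancel] at this
      have h2 := mul_mem_degGE (ι_mem_degGE v) h1
      have h3 := mul_mem_degGE (Submodule.smul_mem _ (f v) hw) hsx
      have h4 := Submodule.add_mem _ (degGE_anti (by omega : i + 1 + 2 ≤ 1 + (i + 2)) h2)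
        (degGE_anti (by omega : i + 1 + 2 ≤ 3 + i) h3)
      convert h4 using 1
      rw [map_mul, shear_ι, add_mul, mul_sub]
      abel
  have h2 : degGE V k ≤ (degGE V (k + 2)).comap ((shear hV f hw).toLinearMap - LinearMap.id) :=
    degGE_le fun j hj a ha => degGE_anti (by omega) (h1 j a ha)
  exact h2 ha

theorem shear_eq_self {a : ExteriorAlgebra ℝ V} (ha : a ∈ degGE V 2) :
    shear hV f hw a = a := by
  have h := shear_sub_mem hV f hw ha
  rwa [degGE_eq_bot (by omega), Submodule.mem_bot, sub_eq_zero] at h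

theorem shear_shear_neg (a : ExteriorAlgebra ℝ V) :
    shear hV f hw (shear hV (-f) hw a) = a := by
  have : (shear hV f hw).comp (shear hV (-f) hw) = AlgHom.id ℝ _ := by
    ext v
    simp [shear_ι, shear_eq_self hV f hw (degGE_anti (by omega) hw)]
  exact DFunLike.congr_fun this a

/-- The shear as an automorphism. -/
def shearEquiv : ExteriorAlgebra ℝ V ≃ₐ[ℝ] ExteriorAlgebra ℝ V :=
  AlgEquiv.ofAlgHom (shear hV f hw) (shear hV (-f) hw)
    (AlgHom.ext (shear_shear_neg hV f hw))
    (AlgHom.ext fun a => by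
      have h := shear_shear_neg hV (-f) hw a
      rwa [neg_neg] at h)

theorem shear_mem_evenOdd (hw' : w ∈ CliffordAlgebra.evenOdd (0 : QuadraticForm ℝ V) 1)
    (i : ZMod 2) (a : ExteriorAlgebra ℝ V)
    (ha : a ∈ CliffordAlgebra.evenOdd (0 : QuadraticForm ℝ V) i) :
    shear hV f hw a ∈ CliffordAlgebra.evenOdd (0 : QuadraticForm ℝ V) i :=
  algHom_mem_evenOdd _ (fun v => by
    rw [shear_ι]
    exact Submodule.add_mem _ (CliffordAlgebra.ι_mem_evenOdd_one _ v)
      (Submodule.smul_mem _ _ hw')) i a ha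

/-- An endomorphism which doubles the generators modulo products does not commute with a shear. -/
theorem eq_zero_of_shear_comm (s : ExteriorAlgebra ℝ V →ₐ[ℝ] ExteriorAlgebra ℝ V)
    (hs : ∀ v, s (ι ℝ v) - (2 : ℝ) • ι ℝ v ∈ degGE V 2)
    (hw' : w ∈ LinearMap.range (ι ℝ : V →ₗ[ℝ] _) ^ 3)
    (hcomm : ∀ a, s (shear hV f hw a) = shear hV f hw (s a)) (v : V) (hv : f v = 1) : w = 0 := by
  -- `8 = 2 ^ 3`, exact because nothing lies above degree three.
  have h1 : s w = (8 : ℝ) • w := by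
    have h := sub_smul_mem_of_mem_pow s 2 hs hw'
    rw [degGE_eq_bot (by omega), Submodule.mem_bot, sub_eq_zero] at h
    rw [h]
    norm_num
  have h2 := hcomm (ι ℝ v)
  have h3 := shear_eq_self hV f hw (hs v)
  rw [map_sub, map_smul, shear_ι, hv, one_smul] at h3
  rw [shear_ι, hv, one_smul, map_add, h1] at h2
  -- Applied to `v`, commutation gives the correction `8 w` on one side and `2 w` on the other; `6 =
  -- 8 - 2`.
  have h4 : (6 : ℝ) • w = 0 := by
    rw [← h2, smul_add] at h3
    have : (6 : ℝ) • w = (s (ι ℝ v) + (8 : ℝ) • w - ((2 : ℝ) • ι ℝ v + (2 : ℝ) • w)) -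
        (s (ι ℝ v) - (2 : ℝ) • ι ℝ v) := by module
    rw [this, h3, sub_self]
  exact (smul_eq_zero.1 h4).resolve_left (by norm_num)

end Shear

end ExteriorAlgebra

/-! ### Failure of naturality on the superpoint of odd dimension three -/

namespace SuperSpace

open ExteriorAlgebra SuperPresheaf TrivSheaf

variable {m : ℕ} {M : Type u} [TopologicalSpace M] [ChartedSpace (EuclideanSpace ℝ (Fin m)) M]

theorem mem_evenOdd_one_of_mem_pow_three {n : ℕ} {w : Lam n}
    (hw : w ∈ LinearMap.range (ι ℝ : EuclideanSpace ℝ (Fin n) →ₗ[ℝ] _) ^ 3) :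
    w ∈ CliffordAlgebra.evenOdd (0 : QuadraticForm ℝ (EuclideanSpace ℝ (Fin n))) 1 :=
  Submodule.mem_iSup_of_mem (p := fun j : {j : ℕ // (j : ZMod 2) = 1} =>
    LinearMap.range (CliffordAlgebra.ι (0 : QuadraticForm ℝ (EuclideanSpace ℝ (Fin n)))) ^ (j : ℕ))
    ⟨3, by decide⟩ hw

/-- The automorphism of a split supermanifold of odd dimension `n` which scales the odd
coordinates. -/
def scaleAut (m n : ℕ) (M : Type u) [TopologicalSpace M]
    [ChartedSpace (EuclideanSpace ℝ (Fin m)) M] : Aut (split m n M) :=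
  let e : EuclideanSpace ℝ (Fin n) ≃ₗ[ℝ] EuclideanSpace ℝ (Fin n) :=
    LinearEquiv.smulOfNeZero ℝ _ (2 : ℝ) two_ne_zero
  constAut (AlgEquiv.ofAlgHom (ExteriorAlgebra.map e.toLinearMap)
    (ExteriorAlgebra.map e.symm.toLinearMap)
    (AlgHom.ext (SmoothVectorBundle.map_map_symm e)) (AlgHom.ext (SmoothVectorBundle.map_symm_map e)))
    (fun _ _ ha => map_mem_evenOdd _ ha) (fun _ _ ha => map_mem_evenOdd _ ha)

theorem ptHom_scaleAut {n : ℕ} [Unique M] (v : EuclideanSpace ℝ (Fin n)) :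
    ptHom (scaleAut m n M).hom (ι ℝ v) = (2 : ℝ) • ι ℝ v := by
  refine (map_apply_ι (R := ℝ) _ v).trans ?_
  rw [← map_smul]
  rfl

theorem conjAut_refl {C : Type*} [Category* C] {X : C} (g : Aut X) : (Iso.refl X).conjAut g = g :=
  Aut.ext (by simp [Iso.conj_apply])

theorem hom_comm_of_conjAut_eq {C : Type*} [Category* C] {X : C} (e : X ≅ X) (s : Aut X)
    (h : e.conjAut s = s) : e.hom ≫ s.hom = s.hom ≫ e.hom := by
  have h1 : e.inv ≫ s.hom ≫ e.hom = s.hom := by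
    rw [← Iso.conj_apply, ← Iso.conjAut_hom, h]
  conv_lhs => rw [← h1]
  simp

/-- There is no natural splitting on a superpoint of odd dimension three. -/
theorem not_natural_of_unique [Unique M] (σ : Aut ((split m 3 M).modPow 2) →* Aut (split m 3 M))
    (hσ : ∀ g, (split m 3 M).autModPow 2 (σ g) = g)
    (hnat : ∀ (e : split m 3 M ≅ split m 3 M) (g : Aut ((split m 3 M).modPow 2)),
      σ ((isoModPow e 2).conjAut g) = e.conjAut (σ g)) : False := by
  have hV : Module.finrank ℝ (EuclideanSpace ℝ (Fin 3)) = 3 := finrank_euclideanSpace_fin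
  -- Three is the least odd dimension with a shear of this kind: `w` must be odd of degree at least
  -- two.
  obtain ⟨w, hw, hw0⟩ : ∃ w ∈ LinearMap.range
      (ι ℝ : EuclideanSpace ℝ (Fin 3) →ₗ[ℝ] Lam 3) ^ 3, w ≠ 0 := by
    refine (Submodule.ne_bot_iff _).1 fun h => ?_
    have h1 : Module.finrank ℝ (⋀[ℝ]^3 (EuclideanSpace ℝ (Fin 3))) = 1 := by
      rw [exteriorPower.finrank_eq, hV, Nat.choose_self]
    have h2 : (⋀[ℝ]^3 (EuclideanSpace ℝ (Fin 3))) = ⊥ := h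
    rw [h2, finrank_bot] at h1
    exact zero_ne_one h1
  have hw3 : w ∈ degGE (EuclideanSpace ℝ (Fin 3)) 3 := pow_le_degGE le_rfl hw
  have hodd := mem_evenOdd_one_of_mem_pow_three hw
  let f : Module.Dual ℝ (EuclideanSpace ℝ (Fin 3)) :=
    (EuclideanSpace.basisFun (Fin 3) ℝ).toBasis.coord 0
  let e : Aut (split m 3 M) := constAut (shearEquiv hV f hw3) (shear_mem_evenOdd hV f hw3 hodd)
    (shear_mem_evenOdd hV (-f) hw3 hodd)
  -- The shear induces the identity on the quotient, so naturality forces each `σ g` to commute with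
  -- it.
  have he : isoModPow e 2 = Iso.refl _ :=
    Iso.ext (modPow_constHom _ (shear_mem_evenOdd hV f hw3 hodd) fun a => degGE_anti (by omega : 2 ≤ 0 + 2)
      (shear_sub_mem hV f hw3 (degGE_zero (V := EuclideanSpace ℝ (Fin 3)) ▸ trivial)))
  let g := (split m 3 M).autModPow 2 (scaleAut m 3 M)
  have h1 := hnat e g
  rw [he, conjAut_refl] at h1
  have h3 := hom_comm_of_conjAut_eq e (σ g) h1.symm
  have h4 : Hom.modPow (σ g).hom 2 = Hom.modPow (scaleAut m 3 M).hom 2 :=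
    congrArg Iso.hom (hσ g)
  refine hw0 (eq_zero_of_shear_comm hV f hw3 (ptHom (σ g).hom) (fun v => ?_) hw (fun a => ?_)
    (EuclideanSpace.basisFun (Fin 3) ℝ 0) ?_)
  · rw [← ptHom_scaleAut (m := m) (M := M) v]
    exact ptHom_sub_mem _ _ h4 _
  · have h5 := congrArg (fun k : split m 3 M ⟶ split m 3 M => ptHom k a) h3
    exact (ptHom_comp (σ g).hom e.hom a).symm.trans (h5.symm.trans (ptHom_comp e.hom (σ g).hom a))
  · simp [f]

theorem not_exists_natural_splitting :
    ¬ ∃ σ : ∀ (m n : ℕ) (X : SuperSpace.{u} m) [X.IsSupermanifold n] [CompactSpace X.carrier],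
        Aut (X.modPow 2) →* Aut X,
      (∀ (m n : ℕ) (X : SuperSpace.{u} m) [X.IsSupermanifold n] [CompactSpace X.carrier]
        (g : Aut (X.modPow 2)), X.autModPow 2 (σ m n X g) = g) ∧
      ∀ (m n : ℕ) (X Y : SuperSpace.{u} m) [X.IsSupermanifold n] [CompactSpace X.carrier]
        [Y.IsSupermanifold n] [CompactSpace Y.carrier] (e : X ≅ Y) (g : Aut (X.modPow 2)),
        σ m n Y ((SuperSpace.isoModPow e 2).conjAut g) = e.conjAut (σ m n X g) := by
  rintro ⟨σ, h1, h2⟩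
  -- The one-point space is taken in the ambient universe, with its chart to `ℝ⁰`.
  have hpt := (Homeomorph.homeomorphOfUnique PUnit.{u + 1}
    (EuclideanSpace ℝ (Fin 0))).isOpenEmbedding
  let _ : ChartedSpace (EuclideanSpace ℝ (Fin 0)) PUnit.{u + 1} := hpt.singletonChartedSpace
  have _ : IsManifold (𝓡 0) ∞ PUnit.{u + 1} := hpt.isManifold_singleton
  have _ : CompactSpace (split 0 3 PUnit.{u + 1}).carrier :=
    inferInstanceAs (CompactSpace PUnit.{u + 1})
  exact not_natural_of_unique (σ 0 3 (split 0 3 PUnit.{u + 1})) (h1 0 3 _)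
    (h2 0 3 (split 0 3 PUnit.{u + 1}) (split 0 3 PUnit.{u + 1}))

end SuperSpace

end

/-! ### The main theorem -/

theorem mainTheorem8 :
    (∀ (m n : ℕ) (X : SuperSpace.{u} m) [X.IsSupermanifold n] [CompactSpace X.carrier],
      -- the quotient presheaf `O / J ^ 2` is a sheaf, so `X / J ^ 2` is a ringed space
      (X.modPow 2).O.presheaf.IsSheaf ∧
      -- exactness of `1 → Nil → Aut(X) → Aut(X / J ^ 2) → 1`
      Function.Injective (X.nilAut 2).subtype ∧
      (X.nilAut 2).subtype.range = (X.autModPow 2).ker ∧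
      Function.Surjective (X.autModPow 2) ∧
      -- there are vector bundles associated with `X`, and each of them gives a splitting
      Nonempty (X.AssociatedBundle n) ∧
      ∀ A : X.AssociatedBundle n,
        ∃ σ : Aut (X.modPow 2) →* Aut X,
          ((∀ g, X.autModPow 2 (σ g) = g) ∧ ∀ g, A.IsInduced (σ g)) ∧
          (∀ τ : Aut (X.modPow 2) →* Aut X,
            ((∀ g, X.autModPow 2 (τ g) = g) ∧ ∀ g, A.IsInduced (τ g)) → τ = σ) ∧
          ∃ e : (X.nilAut 2) ⋊[(MulAut.conjNormal (H := X.nilAut 2)).comp σ] (Aut (X.modPow 2)) ≃*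
              Aut X,
            ∀ (a : X.nilAut 2) (g : Aut (X.modPow 2)), e ⟨a, g⟩ = (a : Aut X) * σ g) ∧
    -- the splittings cannot be chosen naturally in `X`
    ¬ ∃ σ : ∀ (m n : ℕ) (X : SuperSpace.{u} m) [X.IsSupermanifold n] [CompactSpace X.carrier],
        Aut (X.modPow 2) →* Aut X,
      (∀ (m n : ℕ) (X : SuperSpace.{u} m) [X.IsSupermanifold n] [CompactSpace X.carrier]
        (g : Aut (X.modPow 2)), X.autModPow 2 (σ m n X g) = g) ∧
      ∀ (m n : ℕ) (X Y : SuperSpace.{u} m) [X.IsSupermanifold n] [CompactSpace X.carrier]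
        [Y.IsSupermanifold n] [CompactSpace Y.carrier] (e : X ≅ Y) (g : Aut (X.modPow 2)),
        σ m n Y ((SuperSpace.isoModPow e 2).conjAut g) = e.conjAut (σ m n X g) := by
  refine ⟨fun m n X hX _ => ?_, SuperSpace.not_exists_natural_splitting⟩
  obtain ⟨A⟩ := hX.nonempty_associatedBundle
  refine ⟨A.isSheaf_quot hX.isSheaf, Subtype.val_injective, Subgroup.range_subtype _,
    fun g => ⟨A.splitting g, A.autModPow_splitting g⟩, ⟨A⟩, fun B => ?_⟩
  refine ⟨B.splitting, ⟨B.autModPow_splitting, B.isInduced_splitting⟩, fun τ hτ => ?_,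
    SuperSpace.exists_semidirectProduct_mulEquiv (X.autModPow 2) (X.nilAut 2) rfl B.splitting
      B.autModPow_splitting⟩
  ext1 g
  rw [B.eq_splitting_of_isInduced (τ g) (hτ.2 g), hτ.1]
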